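/- **Conventions.** Let $\mathbb S^3=\{|z_1|^2+|z_2|^2=1\}\subset\mathbb C^2$ and $\Phi(x,y,z)=\big(e^{i\sqrt2x}\sin(z+\tfrac\pi4),\,e^{i\sqrt2y}\cos(z+\tfrac\pi4)\big)$. Fix a smooth nondecreasing $\Psi:\mathbb R\to[0,1]$, equal to $0$ on $(-\infty,-1]$ and to $1$ on $[1,\infty)$, with $\Psi-\frac12$ odd, and put $\psi[a,b](t)=\Psi\big(-3+6\tfrac{t-a}{b-a}\big)$. Let $\operatorname{sgn}t=1$ for $t\ge0$ and $-1$ for $t<0$. With $r=\sqrt{x^2+y^2}$ set $$\phi[z_K,z_T,R,\tau](x,y)=z_K+(z_T-z_K)\,\psi[R,2R](r)+\operatorname{sgn}(z_T-z_K)\,\tau\operatorname{arcosh}\!\big(\tfrac r\tau\big)\,\psi[2R,R](r).$$ $T_{ext}[p_0,z_K,z_T,R,X,Y,\tau]$ maps $p=(x,y)\in[-X,X]\times[-Y,Y]$ with $|p|\ge\tau$ to $(p_0+p,\ \phi[z_K,z_T,R,\tau](p))\in\mathbb R^3$. With $q=(\frac X2,\frac Y2)$, $T_{int}[p_0,z_K,z_K',z_T,R,X,Y,\tau,\tau']$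 is defined for $p\in[-X,X]\times[-Y,Y]$ with $|p+q|\ge\tau$ and $|p-q|\ge\tau'$; it maps $p$ to $(p_0+p,h(p))$, where $h(p)=\phi[z_K,z_T,R,\tau](p+q)$ on $[-X,0]\times[-Y,0]$, $h(p)=\phi[z_K',z_T,R,\tau'](p-q)$ on $[0,X]\times[0,Y]$, and $h(p)=z_T$ elsewhere. **Waist radii.** Let $N\ge2$ and $1\le k\le\ell$ be integers, $n=\lfloor N/2\rfloor$. *Admissible waist ratios* are families $(c_i)_{1\le i\le N-1}$, depending on $m$, such that for all large $m$: $c_i>0$, $c_1=1$, $c_i=c_{N-i}$, and, with $\kappa=\frac{8\pi}{k\ell m^2}$, $$c_2^2-c_3=1-\kappa c_2\ln c_2\ (\text{if }n\ge3),\qquad -c_{i-1}+c_2c_i-c_{i+1}=-\kappa c_i\ln c_i\ (3\le i\le n-1),$$ $$-2^{(N+1)\bmod 2}c_{n-1}+(c_2-N\bmod 2)\,c_n=-\kappa c_n\ln c_n\ (\text{if }n\ge2);$$ and such that, as $m\to\infty$, $c_i\to d_i$ for $2\le i\le n$, with limits satisfying $d_2<d_3<\dots<d_n$ and (if $n\ge2$)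 $1<d_2<2$. Put $\underline\tau_i=c_i\,\frac1{10\ell m}\,e^{-\frac{k\ell m^2}{4\pi}(1-\frac{c_2}2)}$ (reading $c_2=0$ if $N=2$). For $\zeta,\xi\in\mathbb R^{N-1}$ put $\tau_1=e^{\zeta_1}\underline\tau_1$, $\tau_i=e^{\zeta_1+\zeta_i/(k\ell m^2)}\underline\tau_i$ for $1<i<N$, and $\lambda_i=\tau_i\ln\frac1{10\ell m\tau_i}$. **Initial surface.** Let $b=-2^{N\bmod2}\lambda_n-2\sum_{j=1}^{n-1}\lambda_j$ and $s_i=b+2\sum_{j=1}^{i-1}\lambda_j$. The heights of the tori are $z_1=\tau_1\xi_1+s_1$, $z_i=\frac12(\tau_{i-1}\xi_{i-1}+\tau_i\xi_i)+s_i$ for $1<i<N$, $z_N=\tau_{N-1}\xi_{N-1}+s_N$, and the heights of the catenoid centres are $z^K_i=\tau_i\xi_i+\lambda_i+s_i$ for $1\le i\le N-1$. Let $R=\frac1{10\ell m}$, $X=\frac\pi{\sqrt2km}$, $Y=\frac\pi{\sqrt2\ell m}$, and let $\Omega_i$ be the $\Phi$-image of the image of $T_{ext}[(0,0),z_1^K,z_1,R,X,Y,\tau_1]$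 for $i=1$, of $T_{int}[(2i-3)(\frac X2,\frac Y2),z_{i-1}^K,z_i^K,z_i,R,X,Y,\tau_{i-1},\tau_i]$ for $1<i<N$, and of $T_{ext}[(N-2)(X,Y),z_{N-1}^K,z_N,R,X,Y,\tau_{N-1}]$ for $i=N$. Let $\mathcal G\subset O(4)$ be generated by $(z_1,z_2)\mapsto(e^{2\pi i/(km)}z_1,z_2)$, $(z_1,z_2)\mapsto(z_1,e^{2\pi i/(\ell m)}z_2)$, $(z_1,z_2)\mapsto(\overline{z_1},z_2)$, $(z_1,z_2)\mapsto(z_1,\overline{z_2})$, and set $\Sigma[N,k,\ell,m,\zeta,\xi]=\mathcal G\bigcup_{i=1}^N\Omega_i$. **Proposition.** Let $1\le k\le\ell$ and $N\ge2$ be integers. Admissible waist ratios exist. For any admissible waist ratios and every real $c>0$ there is an integer $m_0>0$ such that for every integer $m\ge m_0$ and all $\zeta,\xi\in[-c,c]^{N-1}$ the initial surface $\Sigma[N,k,\ell,m,\zeta,\xi]$ is a smooth, closed (compact without boundary), connected, orientable surface embedded in $\mathbb S^3$, of genus $k\ell m^2(N-1)+1$, and it is invariant as a set under $\mathcal G$.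 -/

import Mathlib

open Real Set Filter Topology
open scoped ContDiff

noncomputable section

namespace StackedTori

/-! ### The ambient space -/

/-- `ℂ²` with its Hermitian norm. -/
abbrev E : Type := EuclideanSpace ℂ (Fin 2)

/-- The Euclidean plane. -/
abbrev Plane : Type := EuclideanSpace ℝ (Fin 2)

/-- The unit sphere `𝕊³ ⊂ ℂ²`. -/
def S3 : Set E := Metric.sphere 0 1

/-- `Φ(x,y,z) = (e^{i√2x} sin(z + π/4), e^{i√2y} cos(z + π/4))`. -/
def Phi (p : ℝ × ℝ × ℝ) : E :=
  !₂[Complex.exp (Complex.I * ((√2 * p.1 : ℝ) : ℂ)) * ((Real.sin (p.2.2 + π / 4) : ℝ) : ℂ),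
     Complex.exp (Complex.I * ((√2 * p.2.1 : ℝ) : ℂ)) * ((Real.cos (p.2.2 + π / 4) : ℝ) : ℂ)]

/-! ### Smooth embedded surfaces, orientability, genus -/

/-- `f`, restricted to the open set `V` of the plane, is a smooth local parametrization of the
set `S`: a smooth immersion that is a homeomorphism of `V` onto a relatively open subset
of `S`. -/
structure IsLocalParam (S : Set E) (V : Set Plane) (f : Plane → E) : Prop where
  isOpen : IsOpen V
  smooth : ContDiffOn ℝ ∞ f V
  immersion : ∀ u ∈ V, Function.Injective (fderiv ℝ f u)
  embedding : IsEmbedding (V.domRestrict f)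
  image : ∃ U : Set E, IsOpen U ∧ f '' V = S ∩ U

/-- `S` is a smooth embedded surface (two-dimensional submanifold without boundary). -/
def IsSmoothSurface (S : Set E) : Prop :=
  ∀ p ∈ S, ∃ (V : Set Plane) (f : Plane → E), IsLocalParam S V f ∧ p ∈ f '' V

/-- `S` is an orientable smooth surface: it is covered by a family of smooth local
parametrizations all of whose changes of coordinates have positive Jacobian determinant.
At `f u = g v` the derivative of the change of coordinates `g⁻¹ ∘ f` is the linear map `A`
with `Df(u) = Dg(v) ∘ A`, which is unique since `Dg(v)` is injective. -/
def IsOrientable (S : Set E) : Prop :=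
  ∃ 𝒜 : Set (Set Plane × (Plane → E)),
    (∀ a ∈ 𝒜, IsLocalParam S a.1 a.2) ∧
    (∀ p ∈ S, ∃ a ∈ 𝒜, p ∈ a.2 '' a.1) ∧
    ∀ a ∈ 𝒜, ∀ b ∈ 𝒜, ∀ u ∈ a.1, ∀ v ∈ b.1, a.2 u = b.2 v →
      ∃ A : Plane →L[ℝ] Plane, fderiv ℝ a.2 u = (fderiv ℝ b.2 v).comp A ∧ 0 < A.det

/-- The closed connected orientable surface `S` has genus `g`: its Euler characteristic,
computed from a finite cell decomposition, is `2 - 2g`. -/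
def HasGenus (S : Set E) (g : ℕ) : Prop :=
  ∃ K : Topology.CWComplex S,
    (∀ n, Finite (K.cell n)) ∧ (∀ n, 2 < n → IsEmpty (K.cell n)) ∧
    (Nat.card (K.cell 0) : ℤ) - Nat.card (K.cell 1) + Nat.card (K.cell 2) = 2 - 2 * (g : ℤ)

/-! ### Half-catenoids bent to planes -/

/-- The properties of the basic cutoff function `Ψ`. -/
structure IsCutoff (Ψ : ℝ → ℝ) : Prop where
  smooth : ContDiff ℝ ∞ Ψ
  mono : Monotone Ψ
  zero : ∀ t ≤ -1, Ψ t = 0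
  one : ∀ t, 1 ≤ t → Ψ t = 1
  odd : ∀ t, Ψ (-t) - 1 / 2 = -(Ψ t - 1 / 2)

/-- `ψ[a,b] = Ψ ∘ L`, with `L` affine, `L a = -3` and `L b = 3`. -/
def cutoff (Ψ : ℝ → ℝ) (a b t : ℝ) : ℝ := Ψ (-3 + 6 * (t - a) / (b - a))

/-- The sign function with value `1` at `0`. -/
def sgn (t : ℝ) : ℝ := if 0 ≤ t then 1 else -1

/-- The height function `φ[z_K, z_T, R, X, Y, τ]`; `X`, `Y` enter only through its domain. -/
def profile (Ψ : ℝ → ℝ) (zK zT R τ x y : ℝ) : ℝ :=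
  zK + (zT - zK) * cutoff Ψ R (2 * R) √(x ^ 2 + y ^ 2)
    + sgn (zT - zK) * (τ * Real.arcosh (√(x ^ 2 + y ^ 2) / τ))
      * cutoff Ψ (2 * R) R √(x ^ 2 + y ^ 2)

/-- The closed rectangle `[-X,X] × [-Y,Y]`. -/
def rect (X Y : ℝ) : Set (ℝ × ℝ) := Icc (-X) X ×ˢ Icc (-Y) Y

/-- The open Euclidean disc with centre `(a,b)` and radius `r`. -/
def disc (a b r : ℝ) : Set (ℝ × ℝ) := {p | √((p.1 - a) ^ 2 + (p.2 - b) ^ 2) < r}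

/-- The domain `𝕋_{X,Y,τ}`. -/
def extDomain (X Y τ : ℝ) : Set (ℝ × ℝ) := rect X Y \ disc 0 0 τ

/-- The domain `𝕋_{X,Y,τ,τ'}`. -/
def intDomain (X Y τ τ' : ℝ) : Set (ℝ × ℝ) :=
  rect X Y \ (disc (-(X / 2)) (-(Y / 2)) τ ∪ disc (X / 2) (Y / 2) τ')

/-- `T_ext[(x₀,y₀), z_K, z_T, R, X, Y, τ]`. -/
def Text (Ψ : ℝ → ℝ) (x₀ y₀ zK zT R τ : ℝ) (p : ℝ × ℝ) : ℝ × ℝ × ℝ :=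
  (x₀ + p.1, y₀ + p.2, profile Ψ zK zT R τ p.1 p.2)

open Classical in
/-- `T_int[(x₀,y₀), z_K, z_K', z_T, R, X, Y, τ, τ']`. -/
def Tint (Ψ : ℝ → ℝ) (x₀ y₀ zK zK' zT R X Y τ τ' : ℝ) (p : ℝ × ℝ) : ℝ × ℝ × ℝ :=
  (x₀ + p.1, y₀ + p.2,
    if p ∈ Icc (-X) 0 ×ˢ Icc (-Y) 0 then profile Ψ zK zT R τ (p.1 + X / 2) (p.2 + Y / 2)
    else if p ∈ Icc 0 X ×ˢ Icc 0 Y then profile Ψ zK' zT R τ' (p.1 - X / 2) (p.2 - Y / 2)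
    else zT)

/-! ### Waist radii and heights

Throughout, `N` is the number of tori, `n = N / 2` (integer part), and `c i`, `ζ i`, `ξ i` are used
only for `1 ≤ i ≤ N - 1`. -/

/-- The balancing system for the ratios `c i` of the unperturbed waist radii, for given `m`,
with the reflection symmetry `c i = c (N - i)`. -/
structure IsBalanced (N k ℓ m : ℕ) (c : ℕ → ℝ) : Prop where
  one : c 1 = 1
  pos : ∀ i, 1 ≤ i → i < N → 0 < c i
  refl : ∀ i, 1 ≤ i → i < N → c i = c (N - i)
  first : 3 ≤ N / 2 →
    c 2 * c 2 - c 3 = 1 - 8 * π / (k * ℓ * m ^ 2) * (c 2 * Real.log (c 2))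
  mid : ∀ i, 3 ≤ i → i + 1 ≤ N / 2 →
    -c (i - 1) + c 2 * c i - c (i + 1)
      = -(8 * π / (k * ℓ * m ^ 2)) * (c i * Real.log (c i))
  last : 2 ≤ N / 2 →
    -(2 : ℝ) ^ ((N + 1) % 2) * c (N / 2 - 1) + (c 2 - (N % 2 : ℕ)) * c (N / 2)
      = -(8 * π / (k * ℓ * m ^ 2)) * (c (N / 2) * Real.log (c (N / 2)))

/-- `w m i` is the ratio `c_i` for the value `m`: for large `m` these solve the balancing system,
and as `m → ∞` they converge to limits `d_2 < d_3 < ⋯ < d_n` with `1 < d_2 < 2`. -/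
def IsWaistRatios (N k ℓ : ℕ) (w : ℕ → ℕ → ℝ) : Prop :=
  (∀ᶠ m in atTop, IsBalanced N k ℓ m (w m)) ∧
  ∃ d : ℕ → ℝ,
    (2 ≤ N / 2 → 1 < d 2 ∧ d 2 < 2) ∧
    (∀ i, 2 ≤ i → i + 1 ≤ N / 2 → d i < d (i + 1)) ∧
    ∀ i, 2 ≤ i → i ≤ N / 2 → Tendsto (fun m => w m i) atTop (𝓝 (d i))

/-- The transition radius `R = 1 / (10 ℓ m)`. -/
def radR (ℓ m : ℕ) : ℝ := 1 / (10 * ℓ * m)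

/-- `X = π / (√2 k m)`. -/
def sideX (k m : ℕ) : ℝ := π / (√2 * k * m)

/-- `Y = π / (√2 ℓ m)`. -/
def sideY (ℓ m : ℕ) : ℝ := π / (√2 * ℓ * m)

/-- The unperturbed waist radius with index `i`: `c i` times
`(1 / (10 ℓ m)) exp (-(k ℓ m² / 4π) (1 - c₂ / 2))`, where `c₂` is read as `0` when `N = 2`. -/
def tauBar (N k ℓ m : ℕ) (c : ℕ → ℝ) (i : ℕ) : ℝ :=
  c i * (1 / (10 * ℓ * m) *
    Real.exp (-(k * ℓ * m ^ 2 / (4 * π)) * (1 - (if N = 2 then 0 else c 2) / 2)))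

/-- The waist radii `τ i`. -/
def tau (N k ℓ m : ℕ) (c ζ : ℕ → ℝ) (i : ℕ) : ℝ :=
  Real.exp (if i = 1 then ζ 1 else ζ 1 + ζ i / (k * ℓ * m ^ 2)) * tauBar N k ℓ m c i

/-- `τ i * ln (1 / (10 ℓ m τ i))`. -/
def lam (N k ℓ m : ℕ) (c ζ : ℕ → ℝ) (i : ℕ) : ℝ :=
  tau N k ℓ m c ζ i * Real.log (1 / (10 * ℓ * m * tau N k ℓ m c ζ i))

/-- The heights of the tori. -/
def zT (N k ℓ m : ℕ) (c ζ ξ : ℕ → ℝ) (i : ℕ) : ℝ :=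
  let τ := tau N k ℓ m c ζ
  let L := lam N k ℓ m c ζ
  if i = 1 then
    τ 1 * ξ 1 - 2 ^ (N % 2) * L (N / 2) - 2 * ∑ j ∈ Finset.Icc 1 (N / 2 - 1), L j
  else if i = N then
    τ (N - 1) * ξ (N - 1) - 2 ^ (N % 2) * L (N / 2) + 2 * ∑ j ∈ Finset.Icc (N / 2) (N - 1), L j
  else
    (τ (i - 1) * ξ (i - 1) + τ i * ξ i) / 2 - 2 ^ (N % 2) * L (N / 2)
      + 2 * (∑ j ∈ Finset.Icc 1 (i - 1), L j - ∑ j ∈ Finset.Icc 1 (N / 2 - 1), L j)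

/-- The heights of the centres of the catenoids. -/
def zK (N k ℓ m : ℕ) (c ζ ξ : ℕ → ℝ) (i : ℕ) : ℝ :=
  let τ := tau N k ℓ m c ζ
  let L := lam N k ℓ m c ζ
  τ i * ξ i + L i
    + 2 * (∑ j ∈ Finset.Icc 1 (i - 1), L j - ∑ j ∈ Finset.Icc 1 (N / 2 - 1), L j)
    - 2 ^ (N % 2) * L (N / 2)

/-! ### Symmetries and assembly -/

/-- The real-linear isometry `(z₁, z₂) ↦ (a z₁, b z₂)` of `ℂ²`. -/
def diagIso (a b : ℂ ≃ₗᵢ[ℝ] ℂ) : E ≃ₗᵢ[ℝ] E :=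
  LinearIsometryEquiv.piLpCongrRight 2 ![a, b]

/-- The group `𝒢`, generated by the rotations `(z₁,z₂) ↦ (e^{2πi/(km)} z₁, z₂)` and
`(z₁,z₂) ↦ (z₁, e^{2πi/(ℓm)} z₂)` and the reflections `(z₁,z₂) ↦ (z̄₁, z₂)` and
`(z₁,z₂) ↦ (z₁, z̄₂)`. -/
def symmGroup (k ℓ m : ℕ) : Subgroup (E ≃ₗᵢ[ℝ] E) :=
  Subgroup.closure
    {diagIso (rotation (Circle.exp (2 * π / (k * m)))) (LinearIsometryEquiv.refl ℝ ℂ),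
     diagIso (LinearIsometryEquiv.refl ℝ ℂ) (rotation (Circle.exp (2 * π / (ℓ * m)))),
     diagIso Complex.conjLIE (LinearIsometryEquiv.refl ℝ ℂ),
     diagIso (LinearIsometryEquiv.refl ℝ ℂ) Complex.conjLIE}

/-- The pieces `Ω i`, `1 ≤ i ≤ N`. The last one is centred over `(N - 2)(X, Y)`, the axis of
the catenoid that joins it to the piece below. -/
def Omega (Ψ : ℝ → ℝ) (N k ℓ m : ℕ) (c ζ ξ : ℕ → ℝ) (i : ℕ) : Set E :=
  let τ := tau N k ℓ m c ζ
  let T := zT N k ℓ m c ζ ξ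
  let K := zK N k ℓ m c ζ ξ
  let R := radR ℓ m
  let X := sideX k m
  let Y := sideY ℓ m
  if i = 1 then
    Phi '' (Text Ψ 0 0 (K 1) (T 1) R (τ 1) '' extDomain X Y (τ 1))
  else if i = N then
    Phi '' (Text Ψ (((N : ℝ) - 2) * X) (((N : ℝ) - 2) * Y) (K (N - 1)) (T N) R (τ (N - 1)) ''
      extDomain X Y (τ (N - 1)))
  else
    Phi '' (Tint Ψ ((2 * (i : ℝ) - 3) * (X / 2)) ((2 * (i : ℝ) - 3) * (Y / 2))
      (K (i - 1)) (K i) (T i) R X Y (τ (i - 1)) (τ i) '' intDomain X Y (τ (i - 1)) (τ i))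

/-- The initial surface `Σ[N, k, ℓ, m, ζ, ξ]`: the union of the images of the pieces
`Ω 1, …, Ω N` under the group `𝒢`. -/
def initialSurface (Ψ : ℝ → ℝ) (N k ℓ m : ℕ) (c ζ ξ : ℕ → ℝ) : Set E :=
  ⋃ g ∈ symmGroup k ℓ m, g '' ⋃ i ∈ Finset.Icc 1 N, Omega Ψ N k ℓ m c ζ ξ i

end StackedTori

end

open StackedTori

/-!
An initial surface is the image under `Φ` of a doubly periodic stack of `N` levels, which are flat
away from small discs and are joined by necks that are exact catenoids near their waists. Since
`Φ` is the covering by the two periods as long as `|z| < π / 4` (`Phi_eq_iff`), everything can be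
seen in the stack.

The stack is described abstractly by the structure `Stack`: level `j` lies between the heights of
two consecutive waists and is a graph, with height `up j` or `dn j` near one or the other of the
two families of axes. The axes of consecutive necks alternate between the two classes of a
checkerboard, so that the discs of the two necks at a level are disjoint. For such a stack:

* Smoothness and orientability. The levels are graphs and a neighbourhood of each waist is a
  catenoid, parametrized by angle and height (`isChart_graph`, `isChart_cat`). The chart on level
  `j` is precomposed with a reflection of the plane for odd `j`; then all changes of coordinates
  preserve the orientation (`cat_graph`), because the outward normal of a catenoid points down on
  one side of the waist and up on the other one.
* Genus. The diamonds (`ℓ¹`-balls) around the axes of one neck tile the complement of those around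
  the axes of the next one. Cutting each neck along four lines and each level along the boundaries
  of the diamonds gives a finite cell complex (`cellAddr`); every point has exactly one address in
  it (`exists_addr`, `Addr.pos_inj`), and counting cells gives the Euler characteristic
  `-2 p q (N - 1)` (`hasGenus`), where `p q` is the number of axes for each neck modulo the
  periods. A finite complex is compact.
* Connectedness. The boundaries of the diamonds at one level form a connected net, and each neck
  joins the nets of two consecutive levels (`joinedIn_level`).

The initial surface is such a stack if its heights are in good order
(`GoodHeights.initialSurface_eq`); the group acts on the stack by translations by the periods and
by reflections (`image_surf_eq`). That the heights are in good order for large `m` (`goodHeights`)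
follows from two facts (`tau_asymptotics`): the waist radii `τ i` are comparable to each other,
uniformly in the parameters, and `log (R / τ i)` tends to infinity, so that the distances
`λ i = τ i log (R / τ i)` dominate all the perturbations, which are of the order of the `τ i`;
moreover `λ i ≤ R` tends to zero.

The waist ratios solve a recursion with initial values `0`, `1` and a free parameter `t = c 2`;
the last equation determines `t`. For `1 / m = 0` the recursion is that of the Chebyshev
polynomials, the equation has the solution `t = 2 cos (π / N)` and changes its sign there
(`defect_sign`), so that for large `m` there is a solution close to it by the intermediate value
theorem (`exists_defect_eq_zero`).
-/

/-! ### Charts with a left inverse, and orientability -/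

/-- `f` parametrizes the part of `S` in the open set `O` smoothly by the open set `V`, and `L` is a
differentiable left inverse of `f` defined on all of `O`. -/
structure IsChart (S : Set E) (V : Set Plane) (f : Plane → E) (L : E → Plane) (O : Set E) :
    Prop where
  isOpen : IsOpen V
  smooth : ContDiffOn ℝ ∞ f V
  isOpen_range : IsOpen O
  diff : DifferentiableOn ℝ L O
  image : f '' V = S ∩ O
  left_inv : ∀ u ∈ V, L (f u) = u

namespace IsChart

variable {S : Set E} {V V' : Set Plane} {f f' : Plane → E} {L L' : E → Plane} {O O' : Set E}

theorem mem_range (h : IsChart S V f L O) {u : Plane} (hu : u ∈ V) : f u ∈ S ∩ O :=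
  h.image ▸ mem_image_of_mem f hu

theorem differentiableAt (h : IsChart S V f L O) {u : Plane} (hu : u ∈ V) :
    DifferentiableAt ℝ f u :=
  (h.smooth.contDiffAt (h.isOpen.mem_nhds hu)).differentiableAt (by simp)

theorem differentiableAt_inv (h : IsChart S V f L O) {p : E} (hp : p ∈ O) :
    DifferentiableAt ℝ L p :=
  (h.diff p hp).differentiableAt (h.isOpen_range.mem_nhds hp)

theorem fderiv_inv_comp (h : IsChart S V f L O) {u : Plane} (hu : u ∈ V) :
    (fderiv ℝ L (f u)).comp (fderiv ℝ f u) = ContinuousLinearMap.id ℝ Plane := by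
  have h1 : HasFDerivAt (L ∘ f) ((fderiv ℝ L (f u)).comp (fderiv ℝ f u)) u :=
    (h.differentiableAt_inv (h.mem_range hu).2).hasFDerivAt.comp u (h.differentiableAt hu).hasFDerivAt
  have h2 : L ∘ f =ᶠ[𝓝 u] id := by
    filter_upwards [h.isOpen.mem_nhds hu] with v hv using h.left_inv v hv
  exact (h1.congr_of_eventuallyEq h2.symm).unique (hasFDerivAt_id u)

theorem injective_fderiv (h : IsChart S V f L O) {u : Plane} (hu : u ∈ V) :
    Function.Injective (fderiv ℝ f u) := by
  apply Function.LeftInverse.injective (g := fderiv ℝ L (f u))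
  intro x
  exact DFunLike.congr_fun (h.fderiv_inv_comp hu) x

theorem isLocalParam (h : IsChart S V f L O) : IsLocalParam S V f where
  isOpen := h.isOpen
  smooth := h.smooth
  immersion u hu := h.injective_fderiv hu
  embedding := by
    have hfO : ∀ u : V, f u ∈ O := fun u => (h.mem_range u.2).2
    have hc : Continuous (V.domRestrict f) := h.smooth.continuousOn.domRestrict
    have hcL : Continuous (O.domRestrict L) := h.diff.continuousOn.domRestrict
    have h1 : IsEmbedding (fun u : V => (⟨f u, hfO u⟩ : O)) := by
      refine IsEmbedding.of_comp (hc.subtype_mk _) hcL ?_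
      have : (O.domRestrict L) ∘ (fun u : V => (⟨f u, hfO u⟩ : O)) = Subtype.val := by
        funext u
        exact h.left_inv u u.2
      rw [this]
      exact IsEmbedding.subtypeVal
    exact IsEmbedding.subtypeVal.comp h1
  image := ⟨O, h.isOpen_range, h.image⟩

/-- The change of coordinates between two charts is smooth, because the left inverse of one of them
is defined near the image of the other; its derivative relates the two differentials. -/
theorem fderiv_eq_comp (h : IsChart S V f L O) (h' : IsChart S V' f' L' O') {u v : Plane}
    (hu : u ∈ V) (hv : v ∈ V') (huv : f u = f' v) :
    fderiv ℝ f u = (fderiv ℝ f' v).comp (fderiv ℝ (L' ∘ f) u) := by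
  have huO : f u ∈ O' := huv ▸ (h'.mem_range hv).2
  have hLv : L' (f u) = v := by rw [huv, h'.left_inv v hv]
  have hd : DifferentiableAt ℝ (L' ∘ f) u :=
    (h'.differentiableAt_inv huO).comp u (h.differentiableAt hu)
  have h1 : f =ᶠ[𝓝 u] f' ∘ (L' ∘ f) := by
    have hcont : ContinuousAt f u := (h.differentiableAt hu).continuousAt
    filter_upwards [h.isOpen.mem_nhds hu, hcont (h'.isOpen_range.mem_nhds huO)] with w hw hwO
    obtain ⟨v', hv', hfv'⟩ : f w ∈ f' '' V' := h'.image ▸ ⟨(h.mem_range hw).1, hwO⟩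
    simp only [Function.comp_apply, ← hfv', h'.left_inv v' hv']
  rw [h1.fderiv_eq]
  have hLv' : (L' ∘ f) u = v := hLv
  rw [fderiv_comp u (by rw [hLv']; exact h'.differentiableAt hv) hd, hLv']

end IsChart

theorem isSmoothSurface_of_charts {ι : Type*} {S : Set E} {V : ι → Set Plane}
    {f : ι → Plane → E} {L : ι → E → Plane} {O : ι → Set E}
    (h : ∀ i, IsChart S (V i) (f i) (L i) (O i)) (cover : ∀ p ∈ S, ∃ i, p ∈ f i '' V i) :
    IsSmoothSurface S := fun p hp =>
  let ⟨i, hi⟩ := cover p hp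
  ⟨V i, f i, (h i).isLocalParam, hi⟩

/-- To compare the orientations at a common point it suffices to know that the differentials agree,
or the sign of the Jacobian of one of the two changes of coordinates; which of the two is easier to
compute depends on the charts. -/
theorem isOrientable_of_charts {ι : Type*} {S : Set E} {V : ι → Set Plane}
    {f : ι → Plane → E} {L : ι → E → Plane} {O : ι → Set E}
    (h : ∀ i, IsChart S (V i) (f i) (L i) (O i)) (cover : ∀ p ∈ S, ∃ i, p ∈ f i '' V i)
    (pos : ∀ i j, ∀ u ∈ V i, ∀ v ∈ V j, f i u = f j v →
      fderiv ℝ (f i) u = fderiv ℝ (f j) v ∨ 0 < (fderiv ℝ (L j ∘ f i) u).det ∨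
        0 < (fderiv ℝ (L i ∘ f j) v).det) :
    IsOrientable S := by
  refine ⟨range fun i => (V i, f i), ?_, ?_, ?_⟩
  · rintro _ ⟨i, rfl⟩
    exact (h i).isLocalParam
  · intro p hp
    obtain ⟨i, hi⟩ := cover p hp
    exact ⟨_, ⟨i, rfl⟩, hi⟩
  · rintro _ ⟨i, rfl⟩ _ ⟨j, rfl⟩ u hu v hv huv
    have e1 := (h i).fderiv_eq_comp (h j) hu hv huv
    have e2 := (h j).fderiv_eq_comp (h i) hv hu huv.symm
    rcases pos i j u hu v hv huv with h1 | h1 | h1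
    · refine ⟨ContinuousLinearMap.id ℝ Plane, by simpa using h1, ?_⟩
      simp [ContinuousLinearMap.det]
    · exact ⟨_, e1, h1⟩
    · refine ⟨_, e1, ?_⟩
      set A := fderiv ℝ (L j ∘ f i) u
      set B := fderiv ℝ (L i ∘ f j) v
      have hAB : A.comp B = ContinuousLinearMap.id ℝ Plane := by
        ext1 x
        apply (h j).injective_fderiv hv
        rw [e1] at e2
        exact (DFunLike.congr_fun e2 x).symm
      have hdet : A.det * B.det = 1 := by
        have := congrArg ContinuousLinearMap.det hAB
        simpa [ContinuousLinearMap.det, ContinuousLinearMap.coe_comp, LinearMap.det_comp] using this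
      nlinarith [h1, hdet]

/-! ### Finite cell complexes -/

/-- A finite cell decomposition of dimension at most two, given by continuous maps of cubes. The
inverses of the characteristic maps need not be checked: a closed cell is compact, and its boundary
misses its interior. -/
theorem hasGenus_of_cells {S : Set E} {g : ℕ} (I : ℕ → Type) (φ : ∀ n, I n → (Fin n → ℝ) → E)
    (hfin : ∀ n, Finite (I n)) (hempty : ∀ n, 2 < n → IsEmpty (I n))
    (hcont : ∀ n i, ContinuousOn (φ n i) (Metric.closedBall 0 1))
    (hinj : ∀ n i n' i', ∀ x ∈ Metric.ball (0 : Fin n → ℝ) 1, ∀ x' ∈ Metric.ball (0 : Fin n' → ℝ) 1,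
      φ n i x = φ n' i' x' → (⟨n, i, x⟩ : Σ n, I n × (Fin n → ℝ)) = ⟨n', i', x'⟩)
    (hmem : ∀ n i, ∀ x ∈ Metric.closedBall (0 : Fin n → ℝ) 1, φ n i x ∈ S)
    (hsurj : ∀ p ∈ S, ∃ n i, ∃ x ∈ Metric.ball (0 : Fin n → ℝ) 1, φ n i x = p)
    (hbdry : ∀ n i, ∀ x ∈ Metric.sphere (0 : Fin n → ℝ) 1,
      ∃ n' < n, ∃ i', ∃ x' ∈ Metric.ball (0 : Fin n' → ℝ) 1, φ n' i' x' = φ n i x)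
    (hcard : (Nat.card (I 0) : ℤ) - Nat.card (I 1) + Nat.card (I 2) = 2 - 2 * (g : ℤ)) :
    HasGenus S g := by
  classical
  have hball : ∀ n, Metric.ball (0 : Fin n → ℝ) 1 ⊆ Metric.closedBall 0 1 :=
    fun n => Metric.ball_subset_closedBall
  have hinjOn : ∀ n i, InjOn (φ n i) (Metric.ball 0 1) := by
    intro n i x hx x' hx' he
    have := hinj n i n i x hx x' hx' he
    simpa using this
  let mp : ∀ n, I n → PartialEquiv (Fin n → ℝ) E := fun n i => (hinjOn n i).toPartialEquiv _ _
  have hmp : ∀ n i x, mp n i x = φ n i x := fun n i x => rfl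
  have hmpimg : ∀ n i s, mp n i '' s = φ n i '' s := fun n i s => rfl
  have hsymm : ∀ n i, ContinuousOn (mp n i).symm (mp n i).target := by
    intro n i
    rw [continuousOn_iff_isClosed]
    intro t ht
    -- The image of a closed subset of the cube is compact; inside the open cell only the points of
    -- the open cube contribute to it.
    refine ⟨φ n i '' (t ∩ Metric.closedBall 0 1), ?_, ?_⟩
    · apply IsCompact.isClosed
      exact ((isCompact_closedBall 0 1).inter_left ht).image_of_continuousOn
        ((hcont n i).mono inter_subset_right)
    · ext p
      constructor
      · rintro ⟨hpt, x, hx, rfl⟩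
        have : (mp n i).symm (φ n i x) = x := (mp n i).left_inv hx
        rw [mem_preimage, this] at hpt
        exact ⟨⟨x, ⟨hpt, hball n hx⟩, rfl⟩, ⟨x, hx, rfl⟩⟩
      · rintro ⟨⟨y, ⟨hyt, hy⟩, hyp⟩, x, hx, hxp⟩
        refine ⟨?_, x, hx, hxp⟩
        have h1 : (mp n i).symm p = x := by rw [← hxp]; exact (mp n i).left_inv hx
        rw [mem_preimage, h1]
        have hy1 : y ∈ Metric.ball (0 : Fin n → ℝ) 1 := by
          by_contra hyb
          have hys : y ∈ Metric.sphere (0 : Fin n → ℝ) 1 := by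
            rw [Metric.mem_closedBall] at hy
            rw [Metric.mem_ball, not_lt] at hyb
            exact le_antisymm hy hyb
          obtain ⟨n', hn', i', x', hx', he⟩ := hbdry n i y hys
          have := hinj n' i' n i x' hx' x hx (by rw [he, hyp]; exact hxp.symm)
          have h2 : n' = n := congrArg Sigma.fst this
          omega
        have : y = x := hinjOn n i hy1 hx (by rw [hyp]; exact hxp.symm)
        rwa [← this]
  refine ⟨Topology.CWComplex.mkFinite S I mp ?_ hfin (fun _ _ => rfl) hcont hsymm ?_ ?_ ?_,
    hfin, hempty, hcard⟩
  · exact eventually_atTop.2 ⟨3, fun n hn => hempty n hn⟩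
  · rintro ⟨n, i⟩ - ⟨n', i'⟩ - hne
    rw [Function.onFun, Set.disjoint_left]
    rintro p ⟨x, hx, hxp⟩ ⟨x', hx', hxp'⟩
    have := hinj n i n' i' x hx x' hx' (hxp.trans hxp'.symm)
    apply hne
    have h2 := congrArg (fun z : Σ n, I n × (Fin n → ℝ) => (⟨z.1, z.2.1⟩ : Σ n, I n)) this
    exact h2
  · intro n i x hx
    obtain ⟨n', hn', i', x', hx', he⟩ := hbdry n i x hx
    simp only [mem_iUnion]
    exact ⟨n', hn', i', x', hball n' hx', he⟩
  · ext p
    simp only [mem_iUnion]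
    constructor
    · rintro ⟨n, i, x, hx, rfl⟩
      exact hmem n i x hx
    · intro hp
      obtain ⟨n, i, x, hx, he⟩ := hsurj p hp
      exact ⟨n, i, x, hball n hx, he⟩

/-! ### The parametrization `Φ` and its local inverses -/

theorem contDiff_Phi : ContDiff ℝ ∞ Phi := by
  have hc : ContDiff ℝ ∞ (fun x : ℝ => (x : ℂ)) := Complex.ofRealCLM.contDiff
  rw [contDiff_piLp]
  intro i
  fin_cases i
  · simp only [Phi, Fin.zero_eta, PiLp.toLp_apply, Matrix.cons_val_zero]
    exact (Complex.contDiff_exp.comp (contDiff_const.mul (hc.comp (by fun_prop)))).mul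
      (hc.comp (by fun_prop))
  · simp only [Phi, Fin.mk_one, PiLp.toLp_apply, Matrix.cons_val_one]
    exact (Complex.contDiff_exp.comp (contDiff_const.mul (hc.comp (by fun_prop)))).mul
      (hc.comp (by fun_prop))

/-- The complex number with modulus `s` and argument `√2 x`: the coordinates of `Φ` have this
form. -/
noncomputable def polarPt (x s : ℝ) : ℂ := Complex.exp (Complex.I * ((√2 * x : ℝ) : ℂ)) * (s : ℂ)

/-- The `x` in `polarPt x s`, chosen closest to `b`. -/
noncomputable def angleNear (b : ℝ) (w : ℂ) : ℝ :=
  b + (w * Complex.exp (-(Complex.I * ((√2 * b : ℝ) : ℂ)))).arg / √2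

/-- The complex plane slit along the ray opposite to the argument `√2 b`. -/
noncomputable def slitNear (b : ℝ) : Set ℂ :=
  {w | w * Complex.exp (-(Complex.I * ((√2 * b : ℝ) : ℂ))) ∈ Complex.slitPlane}

theorem Phi_zero (p : ℝ × ℝ × ℝ) : Phi p 0 = polarPt p.1 (sin (p.2.2 + π / 4)) := rfl

theorem Phi_one (p : ℝ × ℝ × ℝ) : Phi p 1 = polarPt p.2.1 (cos (p.2.2 + π / 4)) := rfl

theorem sqrt_two_pos : 0 < √(2 : ℝ) := by positivity

theorem polarPt_mul_exp (x s b : ℝ) :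
    polarPt x s * Complex.exp (-(Complex.I * ((√2 * b : ℝ) : ℂ))) =
      s * (Complex.cos ((√2 * (x - b) : ℝ) : ℂ) + Complex.sin ((√2 * (x - b) : ℝ) : ℂ) *
        Complex.I) := by
  rw [← Complex.exp_mul_I, polarPt, mul_right_comm, ← Complex.exp_add, mul_comm]
  congr 2
  push_cast
  ring

theorem norm_polarPt (x s : ℝ) : ‖polarPt x s‖ = |s| := by
  rw [polarPt, norm_mul, mul_comm Complex.I, Complex.norm_exp_ofReal_mul_I, one_mul,
    Complex.norm_real, Real.norm_eq_abs]

theorem arg_polarPt {x s b : ℝ} (hs : 0 < s) (hx : |x - b| < π / √2) :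
    (polarPt x s * Complex.exp (-(Complex.I * ((√2 * b : ℝ) : ℂ)))).arg = √2 * (x - b) := by
  have h1 := abs_lt.1 hx
  have h2 : √2 * (π / √2) = π := by field_simp
  rw [polarPt_mul_exp]
  refine Complex.arg_mul_cos_add_sin_mul_I hs ⟨?_, ?_⟩
  · nlinarith [sqrt_two_pos]
  · nlinarith [sqrt_two_pos]

theorem polarPt_mem_slitNear {x s b : ℝ} (hs : 0 < s) (hx : |x - b| < π / √2) :
    polarPt x s ∈ slitNear b := by
  have h2 : √2 * (π / √2) = π := by field_simp
  rw [slitNear, mem_ofPred_eq, Complex.mem_slitPlane_iff_arg, arg_polarPt hs hx]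
  refine ⟨?_, ?_⟩
  · nlinarith [sqrt_two_pos, (abs_lt.1 hx).2]
  · rw [← norm_ne_zero_iff, norm_mul, norm_polarPt, ← mul_neg, mul_comm, mul_comm Complex.I,
      ← Complex.ofReal_neg]
    simp [Complex.norm_exp, hs.ne']

theorem angleNear_polarPt {x s b : ℝ} (hs : 0 < s) (hx : |x - b| < π / √2) :
    angleNear b (polarPt x s) = x := by
  rw [angleNear, arg_polarPt hs hx]
  field_simp
  ring

theorem polarPt_angleNear (b : ℝ) (w : ℂ) : polarPt (angleNear b w) ‖w‖ = w := by
  set v := w * Complex.exp (-(Complex.I * ((√2 * b : ℝ) : ℂ))) with hv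
  have h1 : ‖v‖ = ‖w‖ := by
    rw [hv, norm_mul]
    simp [Complex.norm_exp]
  have h2 := Complex.norm_mul_exp_arg_mul_I v
  have h3 : √2 * (angleNear b w) = √2 * b + v.arg := by
    rw [angleNear, ← hv]
    field_simp
  rw [polarPt, h3, ← h1]
  calc _ = Complex.exp (Complex.I * ((√2 * b : ℝ) : ℂ)) * (‖v‖ * Complex.exp (v.arg * Complex.I)) := by
        rw [mul_comm (‖v‖ : ℂ), ← mul_assoc, ← Complex.exp_add]
        congr 2
        push_cast
        ring
    _ = w := by
        rw [h2, hv, mul_left_comm, ← Complex.exp_add, add_neg_cancel, Complex.exp_zero, mul_one]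

theorem abs_angleNear_sub_lt {b : ℝ} {w : ℂ} (hw : w ∈ slitNear b) :
    |angleNear b w - b| < π / √2 := by
  rw [angleNear, add_sub_cancel_left, abs_div, abs_of_pos sqrt_two_pos]
  refine div_lt_div_of_pos_right ?_ sqrt_two_pos
  refine lt_of_le_of_ne (Complex.abs_arg_le_pi _) ?_
  intro h
  have h1 := (Complex.mem_slitPlane_iff_arg.1 hw).1
  rcases abs_choice (w * Complex.exp (-(Complex.I * ((√2 * b : ℝ) : ℂ)))).arg with h2 | h2
  · exact h1 (by rw [← h2, h])
  · have := Complex.neg_pi_lt_arg (w * Complex.exp (-(Complex.I * ((√2 * b : ℝ) : ℂ))))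
    linarith

theorem isOpen_slitNear (b : ℝ) : IsOpen (slitNear b) :=
  Complex.isOpen_slitPlane.preimage (by fun_prop)

theorem differentiableAt_angleNear {b : ℝ} {w : ℂ} (hw : w ∈ slitNear b) :
    DifferentiableAt ℝ (angleNear b) w := by
  have h1 : angleNear b = fun w => b +
      Complex.imCLM (Complex.log (w * Complex.exp (-(Complex.I * ((√2 * b : ℝ) : ℂ))))) / √2 := by
    funext w
    simp [angleNear, Complex.log_im]
  have h2 : DifferentiableAt ℝ Complex.log
      (w * Complex.exp (-(Complex.I * ((√2 * b : ℝ) : ℂ)))) :=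
    (Complex.differentiableAt_log hw).restrictScalars ℝ
  have h3 : DifferentiableAt ℝ
      (fun w : ℂ => w * Complex.exp (-(Complex.I * ((√2 * b : ℝ) : ℂ)))) w := by fun_prop
  rw [h1]
  have h4 : DifferentiableAt ℝ (fun w : ℂ => Complex.log
      (w * Complex.exp (-(Complex.I * ((√2 * b : ℝ) : ℂ))))) w :=
    DifferentiableAt.comp (g := Complex.log)
      (f := fun w : ℂ => w * Complex.exp (-(Complex.I * ((√2 * b : ℝ) : ℂ)))) w h2 h3
  have h5 : DifferentiableAt ℝ (fun w : ℂ => Complex.imCLM (Complex.log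
      (w * Complex.exp (-(Complex.I * ((√2 * b : ℝ) : ℂ)))))) w :=
    DifferentiableAt.comp (g := Complex.imCLM)
      (f := fun w : ℂ => Complex.log (w * Complex.exp (-(Complex.I * ((√2 * b : ℝ) : ℂ))))) w
      Complex.imCLM.differentiableAt h4
  exact DifferentiableAt.const_add (f := fun w => Complex.imCLM (Complex.log
      (w * Complex.exp (-(Complex.I * ((√2 * b : ℝ) : ℂ))))) / √2) b
    (by simpa only [div_eq_mul_inv] using h5.mul_const _)

/-- The period of `Φ` in its first two variables. -/
noncomputable def per : ℝ := √2 * π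

theorem per_pos : 0 < per := by unfold per; positivity

theorem per_div_two : per / 2 = π / √2 := by
  have : √2 * √2 = (2 : ℝ) := Real.mul_self_sqrt (by norm_num)
  rw [per, div_eq_div_iff (by norm_num) sqrt_two_pos.ne']
  linear_combination π * this

theorem polarPt_add_period (x s : ℝ) (n : ℤ) : polarPt (x + n * per) s = polarPt x s := by
  have h : √2 * √2 = (2 : ℝ) := Real.mul_self_sqrt (by norm_num)
  have h1 : √2 * (x + n * per) = √2 * x + n * (2 * π) := by
    rw [per]; linear_combination n * π * h
  rw [polarPt, polarPt, h1]
  congr 1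
  rw [Complex.exp_eq_exp_iff_exists_int]
  refine ⟨n, ?_⟩
  push_cast
  ring

theorem polarPt_eq_iff {x x' s s' : ℝ} (hs : 0 < s) (hs' : 0 < s') :
    polarPt x s = polarPt x' s' ↔ s = s' ∧ ∃ n : ℤ, x = x' + n * per := by
  constructor
  · intro h
    have h1 : s = s' := by
      have := congrArg norm h
      rwa [norm_polarPt, norm_polarPt, abs_of_pos hs, abs_of_pos hs'] at this
    refine ⟨h1, ?_⟩
    subst h1
    rw [polarPt, polarPt] at h
    have h2 := mul_right_cancel₀ (Complex.ofReal_ne_zero.2 hs.ne') h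
    obtain ⟨n, hn⟩ := Complex.exp_eq_exp_iff_exists_int.1 h2
    refine ⟨n, ?_⟩
    have h3 := congrArg Complex.im hn
    simp at h3
    have h : √2 * √2 = (2 : ℝ) := Real.mul_self_sqrt (by norm_num)
    have : √2 * x = √2 * (x' + n * per) := by
      rw [per]; linear_combination h3 - n * π * h
    exact mul_left_cancel₀ sqrt_two_pos.ne' this
  · rintro ⟨rfl, n, rfl⟩
    exact polarPt_add_period _ _ _

theorem sin_slab_pos {z : ℝ} (hz : |z| < π / 4) : 0 < sin (z + π / 4) := by
  have := abs_lt.1 hz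
  exact sin_pos_of_pos_of_lt_pi (by linarith) (by linarith [pi_pos])

theorem cos_slab_pos {z : ℝ} (hz : |z| < π / 4) : 0 < cos (z + π / 4) := by
  have := abs_lt.1 hz
  exact cos_pos_of_mem_Ioo ⟨by linarith [pi_pos], by linarith⟩

theorem Phi_add_period (x y z : ℝ) (n n' : ℤ) :
    Phi (x + n * per, y + n' * per, z) = Phi (x, y, z) := by
  ext i
  fin_cases i
  · exact polarPt_add_period x _ n
  · exact polarPt_add_period y _ n'

/-- On the slab `|z| < π / 4` both sine and cosine of `z + π / 4` are positive, so that `Φ` is there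
the covering of its image by the periods in `x` and `y`. -/
theorem Phi_eq_iff {p p' : ℝ × ℝ × ℝ} (hp : |p.2.2| < π / 4) (hp' : |p'.2.2| < π / 4) :
    Phi p = Phi p' ↔ p.2.2 = p'.2.2 ∧ (∃ n : ℤ, p.1 = p'.1 + n * per) ∧
      ∃ n : ℤ, p.2.1 = p'.2.1 + n * per := by
  constructor
  · intro h
    have h0 : Phi p 0 = Phi p' 0 := by rw [h]
    have h1 : Phi p 1 = Phi p' 1 := by rw [h]
    rw [Phi_zero, Phi_zero, polarPt_eq_iff (sin_slab_pos hp) (sin_slab_pos hp')] at h0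
    rw [Phi_one, Phi_one, polarPt_eq_iff (cos_slab_pos hp) (cos_slab_pos hp')] at h1
    refine ⟨?_, h0.2, h1.2⟩
    have a1 := abs_lt.1 hp
    have a2 := abs_lt.1 hp'
    have := injOn_sin (x₁ := p.2.2 + π / 4) (x₂ := p'.2.2 + π / 4)
      ⟨by linarith [pi_pos], by linarith⟩ ⟨by linarith [pi_pos], by linarith⟩ h0.1
    linarith
  · rintro ⟨h1, ⟨n, hn⟩, n', hn'⟩
    obtain ⟨x, y, z⟩ := p
    obtain ⟨x', y', z'⟩ := p'
    simp only at h1 hn hn'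
    subst h1 hn hn'
    exact Phi_add_period _ _ _ _ _

theorem Phi_mem_S3 (p : ℝ × ℝ × ℝ) : Phi p ∈ S3 := by
  rw [S3, mem_sphere_zero_iff_norm, EuclideanSpace.norm_eq, Fin.sum_univ_two, Phi_zero, Phi_one,
    norm_polarPt, norm_polarPt, sq_abs, sq_abs, sin_sq_add_cos_sq, sqrt_one]

/-- A local inverse of `Φ`, with the first two coordinates close to those of `b`. -/
noncomputable def lift (b : ℝ × ℝ) (w : E) : ℝ × ℝ × ℝ :=
  (angleNear b.1 (w 0), angleNear b.2 (w 1),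
    arcsin (Complex.normSq (w 0) - Complex.normSq (w 1)) / 2)

/-- The domain of the local inverse `lift b`. -/
noncomputable def liftDom (b : ℝ × ℝ) : Set E :=
  {w | w 0 ∈ slitNear b.1 ∧ w 1 ∈ slitNear b.2 ∧
    |Complex.normSq (w 0) - Complex.normSq (w 1)| < 1}

theorem isOpen_liftDom (b : ℝ × ℝ) : IsOpen (liftDom b) := by
  have h : ∀ i : Fin 2, Continuous fun w : E => w i := fun i => by fun_prop
  refine ((isOpen_slitNear _).preimage (h 0)).inter
    (((isOpen_slitNear _).preimage (h 1)).inter (isOpen_Iio.preimage (t := Iio (1 : ℝ)) ?_))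
  exact ((Complex.continuous_normSq.comp (h 0)).sub (Complex.continuous_normSq.comp (h 1))).abs

theorem differentiableOn_lift (b : ℝ × ℝ) : DifferentiableOn ℝ (lift b) (liftDom b) := by
  rintro w ⟨h0, h1, h2⟩
  apply DifferentiableAt.differentiableWithinAt
  have hp : ∀ i : Fin 2, DifferentiableAt ℝ (fun w : E => w i) w := fun i => by fun_prop
  have hn : ∀ z : ℂ, DifferentiableAt ℝ Complex.normSq z := by
    intro z
    have : (Complex.normSq : ℂ → ℝ) = fun z => Complex.reCLM z * Complex.reCLM z +
      Complex.imCLM z * Complex.imCLM z := by funext z; simp [Complex.normSq_apply]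
    rw [this]
    fun_prop
  have h3 := abs_lt.1 h2
  have h4 : DifferentiableAt ℝ
      (fun w : E => arcsin (Complex.normSq (w 0) - Complex.normSq (w 1)) / 2) w := by
    simp only [div_eq_mul_inv]
    refine DifferentiableAt.mul_const ?_ _
    refine DifferentiableAt.comp (g := arcsin)
      (f := fun w : E => Complex.normSq (w 0) - Complex.normSq (w 1)) w
      (Real.differentiableAt_arcsin.2 ⟨by linarith, by linarith⟩) ?_
    exact (DifferentiableAt.comp (g := Complex.normSq) (f := fun w : E => w 0) w (hn _) (hp 0)).sub
      (DifferentiableAt.comp (g := Complex.normSq) (f := fun w : E => w 1) w (hn _) (hp 1))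
  have h5 : DifferentiableAt ℝ (fun w : E => angleNear b.1 (w 0)) w :=
    DifferentiableAt.comp (g := angleNear b.1) (f := fun w : E => w 0) w
      (differentiableAt_angleNear h0) (hp 0)
  have h6 : DifferentiableAt ℝ (fun w : E => angleNear b.2 (w 1)) w :=
    DifferentiableAt.comp (g := angleNear b.2) (f := fun w : E => w 1) w
      (differentiableAt_angleNear h1) (hp 1)
  exact h5.prodMk (h6.prodMk h4)

theorem normSq_Phi_sub (p : ℝ × ℝ × ℝ) :
    Complex.normSq (Phi p 0) - Complex.normSq (Phi p 1) = sin (2 * p.2.2) := by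
  rw [Complex.normSq_eq_norm_sq, Complex.normSq_eq_norm_sq, Phi_zero, Phi_one, norm_polarPt,
    norm_polarPt, sq_abs, sq_abs, sin_add, cos_add, sin_two_mul, cos_pi_div_four, sin_pi_div_four]
  have : √2 * √2 = (2 : ℝ) := Real.mul_self_sqrt (by norm_num)
  linear_combination (sin p.2.2 * cos p.2.2) * this

theorem lift_height (b : ℝ × ℝ) {p : ℝ × ℝ × ℝ} (hz : |p.2.2| < π / 4) :
    (lift b (Phi p)).2.2 = p.2.2 := by
  have := abs_lt.1 hz
  simp only [lift]
  rw [normSq_Phi_sub, arcsin_sin (by linarith) (by linarith)]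
  ring

theorem abs_normSq_Phi_lt {p : ℝ × ℝ × ℝ} (hz : |p.2.2| < π / 4) :
    |Complex.normSq (Phi p 0) - Complex.normSq (Phi p 1)| < 1 := by
  have := abs_lt.1 hz
  rw [normSq_Phi_sub, abs_lt]
  constructor
  · rw [show (-1 : ℝ) = sin (-(π / 2)) by rw [sin_neg, sin_pi_div_two]]
    exact sin_lt_sin_of_lt_of_le_pi_div_two (by linarith) (by linarith) (by linarith)
  · rw [← sin_pi_div_two]
    exact sin_lt_sin_of_lt_of_le_pi_div_two (by linarith) (by linarith) (by linarith)

theorem Phi_mem_liftDom {b : ℝ × ℝ} {p : ℝ × ℝ × ℝ} (hx : |p.1 - b.1| < π / √2)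
    (hy : |p.2.1 - b.2| < π / √2) (hz : |p.2.2| < π / 4) : Phi p ∈ liftDom b :=
  ⟨polarPt_mem_slitNear (sin_slab_pos hz) hx, polarPt_mem_slitNear (cos_slab_pos hz) hy,
    abs_normSq_Phi_lt hz⟩

theorem lift_Phi {b : ℝ × ℝ} {p : ℝ × ℝ × ℝ} (hx : |p.1 - b.1| < π / √2)
    (hy : |p.2.1 - b.2| < π / √2) (hz : |p.2.2| < π / 4) : lift b (Phi p) = p := by
  refine Prod.ext ?_ (Prod.ext ?_ (lift_height b hz))
  · exact angleNear_polarPt (sin_slab_pos hz) hx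
  · exact angleNear_polarPt (cos_slab_pos hz) hy

theorem Phi_lift (b : ℝ × ℝ) {p : ℝ × ℝ × ℝ} (hz : |p.2.2| < π / 4) :
    Phi (lift b (Phi p)) = Phi p := by
  ext i
  fin_cases i
  · have h := polarPt_angleNear b.1 (Phi p 0)
    rw [Phi_zero p, norm_polarPt, abs_of_pos (sin_slab_pos hz)] at h
    change Phi (lift b (Phi p)) 0 = Phi p 0
    rw [Phi_zero, lift_height b hz]
    exact h
  · have h := polarPt_angleNear b.2 (Phi p 1)
    rw [Phi_one p, norm_polarPt, abs_of_pos (cos_slab_pos hz)] at h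
    change Phi (lift b (Phi p)) 1 = Phi p 1
    rw [Phi_one, lift_height b hz]
    exact h

theorem lift_near {b : ℝ × ℝ} {w : E} (hw : w ∈ liftDom b) :
    |(lift b w).1 - b.1| < π / √2 ∧ |(lift b w).2.1 - b.2| < π / √2 :=
  ⟨abs_angleNear_sub_lt hw.1, abs_angleNear_sub_lt hw.2.1⟩

/-- `lift b ∘ Φ` is locally the translation by a period. -/
theorem lift_Phi_eventually {T : Type*} [TopologicalSpace T] {u : T} (b : ℝ × ℝ)
    {F : T → ℝ × ℝ × ℝ} (hF : ContinuousAt F u) (hz : ∀ᶠ v in 𝓝 u, |(F v).2.2| < π / 4)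
    (hu : Phi (F u) ∈ liftDom b) :
    ∃ c d : ℝ, ∀ᶠ v in 𝓝 u, (lift b (Phi (F v))).1 = (F v).1 + c ∧
      (lift b (Phi (F v))).2.1 = (F v).2.1 + d := by
  have hl : ContinuousAt (fun v => lift b (Phi (F v))) u := by
    have h1 : ContinuousAt (fun v => Phi (F v)) u :=
      contDiff_Phi.continuous.continuousAt.comp hF
    exact ((differentiableOn_lift b).continuousOn.continuousAt
      ((isOpen_liftDom b).mem_nhds hu)).comp (f := fun v => Phi (F v)) h1
  -- A continuous function with values in `ℤ * per` is locally constant.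
  have key : ∀ (a e : T → ℝ), ContinuousAt a u → ContinuousAt e u →
      (∀ᶠ v in 𝓝 u, ∃ n : ℤ, a v = e v + n * per) → ∃ c : ℝ, ∀ᶠ v in 𝓝 u, a v = e v + c := by
    intro a e ha he h
    refine ⟨a u - e u, ?_⟩
    have h1 : ContinuousAt (fun v => (a v - e v) - (a u - e u)) u := (ha.sub he).sub continuousAt_const
    have h2 : ∀ᶠ v in 𝓝 u, |(a v - e v) - (a u - e u)| < per := by
      have := h1.abs.eventually_lt (continuousAt_const (y := per)) (by simpa using per_pos)
      exact this
    obtain ⟨n0, hn0⟩ := h.self_of_nhds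
    filter_upwards [h, h2] with v hv hv2
    obtain ⟨n, hn⟩ := hv
    have h3 : (a v - e v) - (a u - e u) = ((n - n0 : ℤ) : ℝ) * per := by
      rw [hn, hn0]; push_cast; ring
    rw [h3, abs_mul, abs_of_pos per_pos] at hv2
    have h4 : |((n - n0 : ℤ) : ℝ)| < 1 := by
      by_contra hcon
      nlinarith [per_pos]
    have h5 : n - n0 = 0 := Int.abs_lt_one_iff.1 (by exact_mod_cast h4)
    rw [h5] at h3
    simp only [Int.cast_zero, zero_mul] at h3
    linarith
  have hev : ∀ᶠ v in 𝓝 u, (∃ n : ℤ, (lift b (Phi (F v))).1 = (F v).1 + n * per) ∧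
      ∃ n : ℤ, (lift b (Phi (F v))).2.1 = (F v).2.1 + n * per := by
    filter_upwards [hz] with v hv
    have h1 := Phi_lift b hv
    rw [Phi_eq_iff (by rw [lift_height b hv]; exact hv) hv] at h1
    exact h1.2
  obtain ⟨c, hc⟩ := key _ _ (continuous_fst.continuousAt.comp hl)
    (continuous_fst.continuousAt.comp hF) (hev.mono fun v hv => hv.1)
  obtain ⟨d, hd⟩ := key _ _ ((continuous_fst.comp continuous_snd).continuousAt.comp hl)
    ((continuous_fst.comp continuous_snd).continuousAt.comp hF) (hev.mono fun v hv => hv.2)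
  exact ⟨c, d, hc.and hd⟩

/-! ### Folding the plane onto a rectangle -/

/-- The distance from `x` to the lattice `2Xℤ`. -/
noncomputable def fold (X x : ℝ) : ℝ := ‖(x : AddCircle (2 * X))‖

theorem fold_le {X : ℝ} (hX : 0 < X) (x : ℝ) : fold X x ≤ X := by
  have := AddCircle.norm_le_half_period (2 * X) (x := (x : AddCircle (2 * X)))
    (by positivity : (2 * X : ℝ) ≠ 0)
  rw [abs_of_pos (by positivity : (0 : ℝ) < 2 * X)] at this
  unfold fold
  linarith

theorem fold_eq_abs {X : ℝ} (hX : 0 < X) {x : ℝ} (hx : |x| ≤ X) : fold X x = |x| := by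
  refine (AddCircle.norm_coe_eq_abs_iff (2 * X) (by positivity : (2 * X : ℝ) ≠ 0)).2 ?_
  rw [abs_of_pos (by positivity : (0 : ℝ) < 2 * X)]
  linarith

theorem fold_neg (X x : ℝ) : fold X (-x) = fold X x := by
  unfold fold
  rw [AddCircle.coe_neg, norm_neg]

theorem fold_add_int (X x : ℝ) (n : ℤ) : fold X (x + n * (2 * X)) = fold X x := by
  unfold fold
  have : ((n * (2 * X) : ℝ) : AddCircle (2 * X)) = 0 := by
    rw [← zsmul_eq_mul]
    exact AddCircle.coe_eq_zero_iff (2 * X) |>.2 ⟨n, rfl⟩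
  rw [AddCircle.coe_add, this, add_zero]

theorem continuous_fold (X : ℝ) : Continuous (fold X) :=
  continuous_norm.comp (AddCircle.continuous_mk' (2 * X))

theorem exists_fold_eq {X : ℝ} (hX : 0 < X) (x : ℝ) :
    ∃ n : ℤ, |x - n * (2 * X)| ≤ X ∧ fold X x = |x - n * (2 * X)| := by
  refine ⟨round ((2 * X)⁻¹ * x), ?_, AddCircle.norm_eq (2 * X)⟩
  have h := AddCircle.norm_eq (2 * X) (x := x)
  rw [← h]
  exact fold_le hX x

theorem fold_sub_self {X : ℝ} (hX : 0 < X) (x : ℝ) : fold X (x - X) = X - fold X x := by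
  obtain ⟨n, hn, he⟩ := exists_fold_eq hX x
  rw [he]
  have h1 : fold X (x - X) = fold X ((x - n * (2 * X)) - X) := by
    rw [← fold_add_int X (x - n * (2 * X) - X) n]
    congr 1
    ring
  rw [h1]
  set y := x - n * (2 * X)
  rcases le_total 0 y with hy | hy
  · rw [abs_of_nonneg hy] at hn ⊢
    rw [fold_eq_abs hX (by rw [abs_le]; constructor <;> linarith), abs_of_nonpos (by linarith)]
    ring
  · rw [abs_of_nonpos hy] at hn ⊢
    have h2 : fold X (y - X) = fold X (y + X) := by
      rw [← fold_add_int X (y - X) 1]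
      congr 1
      push_cast
      ring
    rw [h2, fold_eq_abs hX (by rw [abs_le]; constructor <;> linarith), abs_of_nonneg (by linarith)]
    ring

/-! ### Stacks of levels joined by necks -/

/-- The data of a doubly periodic stack of `N` levels over the plane with periods `2X` and `2Y`,
where `X = per / (2p)` and `Y = per / (2q)`. Level `j` lies between the heights `K j` and `K (j+1)`.
Neck `j` is the part near the height `K j`; it has a waist of radius `t j` around the points
`((j-1)X, (j-1)Y)` modulo the periods and joins level `j - 1` to level `j`, for `0 < j < N`. The
necks `0` and `N` do not exist, which is expressed by `t < 0`. Near neck `j` the height of level `j`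
is the function `up j` of the distance to the axis, and near neck `j + 1` it is `dn j`. -/
structure Stack where
  /-- the number of levels -/
  N : ℕ
  /-- the number of periods in the first direction -/
  p : ℕ
  /-- the number of periods in the second direction -/
  q : ℕ
  /-- outside the discs of this radius around the necks the levels are flat -/
  r₀ : ℝ
  /-- a slightly smaller radius with the same property -/
  r₁ : ℝ
  /-- the radii of the waists -/
  t : ℕ → ℝ
  /-- the heights of the waists -/
  K : ℕ → ℝ
  /-- the heights of the levels -/
  T : ℕ → ℝ
  /-- the height of level `j` around neck `j` -/
  up : ℕ → ℝ → ℝ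
  /-- the height of level `j` around neck `j + 1` -/
  dn : ℕ → ℝ → ℝ
  two_le : 2 ≤ N
  p_pos : 0 < p
  q_pos : 0 < q
  r₁_pos : 0 < r₁
  r₁_lt : r₁ < r₀
  r₀_lt_p : r₀ < per / (2 * p) / 2
  r₀_lt_q : r₀ < per / (2 * q) / 2
  t_pos : ∀ j, 0 < j → j < N → 0 < t j
  t_lt : ∀ j, j ≤ N → t j < r₁
  t_zero : t 0 < 0
  t_last : t N < 0
  K_zero : -(π / 4) ≤ K 0
  K_last : K N ≤ π / 4
  lt_T : ∀ j < N, K j < T j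
  T_lt : ∀ j < N, T j < K (j + 1)
  up_far : ∀ j < N, ∀ r, r₁ ≤ r → up j r = T j
  dn_far : ∀ j < N, ∀ r, r₁ ≤ r → dn j r = T j
  up_zero : ∀ r, up 0 r = T 0
  dn_last : ∀ r, dn (N - 1) r = T (N - 1)
  up_waist : ∀ j, 0 < j → j < N → up j (t j) = K j
  dn_waist : ∀ j, j + 1 < N → dn j (t (j + 1)) = K (j + 1)
  up_mem : ∀ j < N, ∀ r, t j < r → up j r ∈ Ioo (K j) (K (j + 1))
  dn_mem : ∀ j < N, ∀ r, t (j + 1) < r → dn j r ∈ Ioo (K j) (K (j + 1))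
  up_smooth : ∀ j, 0 < j → j < N → ContDiffOn ℝ ∞ (up j) (Ioi (t j))
  dn_smooth : ∀ j, j + 1 < N → ContDiffOn ℝ ∞ (dn j) (Ioi (t (j + 1)))
  up_cont : ∀ j, 0 < j → j < N → ContinuousOn (up j) (Ici (t j))
  dn_cont : ∀ j, j + 1 < N → ContinuousOn (dn j) (Ici (t (j + 1)))
  up_cat : ∀ j, 0 < j → j < N → ∃ ε > 0,
    (∀ r, t j ≤ r → up j r < K j + ε → r = t j * cosh ((up j r - K j) / t j)) ∧
    ∀ s, 0 ≤ s → t j * s < ε → up j (t j * cosh s) = K j + t j * s ∧ t j * cosh s < r₀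
  dn_cat : ∀ j, j + 1 < N → ∃ ε > 0,
    (∀ r, t (j + 1) ≤ r → K (j + 1) - ε < dn j r →
      r = t (j + 1) * cosh ((K (j + 1) - dn j r) / t (j + 1))) ∧
    ∀ s, 0 ≤ s → t (j + 1) * s < ε →
      dn j (t (j + 1) * cosh s) = K (j + 1) - t (j + 1) * s ∧ t (j + 1) * cosh s < r₀

namespace Stack

variable (A : Stack)

/-- Half of the period in the first direction. -/
noncomputable def X : ℝ := per / (2 * A.p)

/-- Half of the period in the second direction. -/
noncomputable def Y : ℝ := per / (2 * A.q)

theorem X_pos : 0 < A.X :=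
  div_pos per_pos (mul_pos two_pos (Nat.cast_pos.2 A.p_pos))

theorem Y_pos : 0 < A.Y :=
  div_pos per_pos (mul_pos two_pos (Nat.cast_pos.2 A.q_pos))

theorem per_eq_X : per = A.p * (2 * A.X) := by
  have := A.p_pos
  unfold X
  field_simp

theorem per_eq_Y : per = A.q * (2 * A.Y) := by
  have := A.q_pos
  unfold Y
  field_simp

theorem r₀_lt_X : A.r₀ < A.X / 2 := A.r₀_lt_p

theorem r₀_lt_Y : A.r₀ < A.Y / 2 := A.r₀_lt_q

theorem r₀_pos : 0 < A.r₀ := A.r₁_pos.trans A.r₁_lt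

theorem K_lt_succ {j : ℕ} (hj : j < A.N) : A.K j < A.K (j + 1) := (A.lt_T j hj).trans (A.T_lt j hj)

theorem K_mono {i j : ℕ} (hij : i ≤ j) (hj : j ≤ A.N) : A.K i ≤ A.K j := by
  induction j, hij using Nat.le_induction with
  | base => exact le_rfl
  | succ k hk ih => exact (ih (by omega)).trans (A.K_lt_succ (by omega)).le

theorem K_lt {i j : ℕ} (hij : i < j) (hj : j ≤ A.N) : A.K i < A.K j :=
  (A.K_lt_succ (by omega)).trans_le (A.K_mono hij hj)

/-- The distance to the axes of neck `j`. -/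
noncomputable def rho (j : ℕ) (p : ℝ × ℝ) : ℝ :=
  √(fold A.X (p.1 - ((j : ℝ) - 1) * A.X) ^ 2 + fold A.Y (p.2 - ((j : ℝ) - 1) * A.Y) ^ 2)

theorem rho_nonneg (j : ℕ) (p : ℝ × ℝ) : 0 ≤ A.rho j p := sqrt_nonneg _

theorem continuous_rho (j : ℕ) : Continuous (A.rho j) := by
  unfold rho
  have h1 := (continuous_fold A.X).comp
    (continuous_fst.sub (continuous_const (y := ((j : ℝ) - 1) * A.X)) : Continuous fun p : ℝ × ℝ => _)
  have h2 := (continuous_fold A.Y).comp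
    (continuous_snd.sub (continuous_const (y := ((j : ℝ) - 1) * A.Y)) : Continuous fun p : ℝ × ℝ => _)
  exact ((h1.pow 2).add (h2.pow 2)).sqrt

theorem rho_add_int (j : ℕ) (x y : ℝ) (n m : ℤ) :
    A.rho j (x + n * (2 * A.X), y + m * (2 * A.Y)) = A.rho j (x, y) := by
  unfold rho
  simp only
  rw [← fold_add_int A.X (x - ((j : ℝ) - 1) * A.X) n, ← fold_add_int A.Y (y - ((j : ℝ) - 1) * A.Y) m]
  congr 4 <;> ring_nf

theorem rho_neg (j : ℕ) (x y : ℝ) : A.rho j (-x, y) = A.rho j (x, y) ∧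
    A.rho j (x, -y) = A.rho j (x, y) := by
  have key : ∀ X x : ℝ, fold X (-x - ((j : ℝ) - 1) * X) = fold X (x - ((j : ℝ) - 1) * X) := by
    intro X x
    rw [← fold_neg, ← fold_add_int X _ (1 - (j : ℤ))]
    congr 1
    push_cast
    ring
  unfold rho
  constructor
  · simp only [key]
  · simp only [key]

theorem rho_succ (j : ℕ) (p : ℝ × ℝ) : A.rho (j + 1) p =
    √((A.X - fold A.X (p.1 - ((j : ℝ) - 1) * A.X)) ^ 2 +
      (A.Y - fold A.Y (p.2 - ((j : ℝ) - 1) * A.Y)) ^ 2) := by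
  rw [rho, ← fold_sub_self A.X_pos, ← fold_sub_self A.Y_pos]
  push_cast
  ring_nf

theorem rho_add_two (j : ℕ) (p : ℝ × ℝ) : A.rho (j + 2) p = A.rho j p := by
  rw [rho, rho, ← fold_add_int A.X (p.1 - ((j : ℝ) - 1) * A.X) (-1),
    ← fold_add_int A.Y (p.2 - ((j : ℝ) - 1) * A.Y) (-1)]
  push_cast
  ring_nf

theorem lt_rho_succ_of_fold {j : ℕ} {p : ℝ × ℝ}
    (h : fold A.X (p.1 - ((j : ℝ) - 1) * A.X) ≤ A.X / 2 ∨
      fold A.Y (p.2 - ((j : ℝ) - 1) * A.Y) ≤ A.Y / 2) : A.r₀ < A.rho (j + 1) p := by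
  rw [rho_succ]
  apply Real.lt_sqrt_of_sq_lt
  have h0 := A.r₀_pos
  rcases h with h | h
  · have := A.r₀_lt_X
    nlinarith [sq_nonneg (A.Y - fold A.Y (p.2 - ((j : ℝ) - 1) * A.Y))]
  · have := A.r₀_lt_Y
    nlinarith [sq_nonneg (A.X - fold A.X (p.1 - ((j : ℝ) - 1) * A.X))]

/-- The discs around consecutive necks are disjoint. -/
theorem lt_rho_succ {j : ℕ} {p : ℝ × ℝ} (h : A.rho j p < A.r₀) : A.r₀ < A.rho (j + 1) p := by
  apply A.lt_rho_succ_of_fold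
  left
  have h1 : fold A.X (p.1 - ((j : ℝ) - 1) * A.X) ≤ A.rho j p := by
    apply Real.le_sqrt_of_sq_le
    nlinarith [sq_nonneg (fold A.Y (p.2 - ((j : ℝ) - 1) * A.Y))]
  linarith [A.r₀_lt_X]

theorem lt_rho_of_succ {j : ℕ} {p : ℝ × ℝ} (h : A.rho (j + 1) p < A.r₀) : A.r₀ < A.rho j p := by
  rw [← rho_add_two]
  exact A.lt_rho_succ h

/-- The part of the plane over which level `j` lies. -/
def dom (j : ℕ) : Set (ℝ × ℝ) := {p | A.t j ≤ A.rho j p ∧ A.t (j + 1) ≤ A.rho (j + 1) p}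

/-- The interior of `dom j`. -/
def domInt (j : ℕ) : Set (ℝ × ℝ) := {p | A.t j < A.rho j p ∧ A.t (j + 1) < A.rho (j + 1) p}

theorem isOpen_domInt (j : ℕ) : IsOpen (A.domInt j) :=
  (isOpen_Ioi.preimage (A.continuous_rho j)).inter (isOpen_Ioi.preimage (A.continuous_rho (j + 1)))

open Classical in
/-- The height of level `j`. -/
noncomputable def hgt (j : ℕ) (p : ℝ × ℝ) : ℝ :=
  if A.rho (j + 1) p < A.r₀ then A.dn j (A.rho (j + 1) p) else A.up j (A.rho j p)

variable {A}

theorem hgt_eq_up {j : ℕ} (hj : j < A.N) {p : ℝ × ℝ} (h : A.r₁ ≤ A.rho (j + 1) p) :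
    A.hgt j p = A.up j (A.rho j p) := by
  unfold hgt
  split_ifs with h1
  · rw [A.dn_far j hj _ h, A.up_far j hj _ (by linarith [A.lt_rho_of_succ h1, A.r₁_lt])]
  · rfl

theorem hgt_eq_dn {j : ℕ} (hj : j < A.N) {p : ℝ × ℝ} (h : A.r₁ ≤ A.rho j p) :
    A.hgt j p = A.dn j (A.rho (j + 1) p) := by
  unfold hgt
  split_ifs with h1
  · rfl
  · rw [A.dn_far j hj _ (by linarith [A.r₁_lt]), A.up_far j hj _ h]

theorem hgt_eq_T {j : ℕ} (hj : j < A.N) {p : ℝ × ℝ} (h : A.r₁ ≤ A.rho j p)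
    (h' : A.r₁ ≤ A.rho (j + 1) p) : A.hgt j p = A.T j := by
  rw [hgt_eq_dn hj h, A.dn_far j hj _ h']

theorem hgt_cases {j : ℕ} (hj : j < A.N) (p : ℝ × ℝ) :
    (A.hgt j p = A.up j (A.rho j p) ∧ A.r₀ ≤ A.rho (j + 1) p) ∨
      (A.hgt j p = A.dn j (A.rho (j + 1) p) ∧ A.r₀ ≤ A.rho j p) := by
  by_cases h : A.rho (j + 1) p < A.r₀
  · exact Or.inr ⟨hgt_eq_dn hj (A.r₁_lt.trans (A.lt_rho_of_succ h)).le, (A.lt_rho_of_succ h).le⟩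
  · exact Or.inl ⟨hgt_eq_up hj (A.r₁_lt.le.trans (not_lt.1 h)), not_lt.1 h⟩

theorem hgt_mem {j : ℕ} (hj : j < A.N) {p : ℝ × ℝ} (hp : p ∈ A.domInt j) :
    A.hgt j p ∈ Ioo (A.K j) (A.K (j + 1)) := by
  rcases hgt_cases hj p with h | h
  · rw [h.1]
    exact A.up_mem j hj _ hp.1
  · rw [h.1]
    exact A.dn_mem j hj _ hp.2

theorem pos_of_rho_eq {j : ℕ} (hj : j ≤ A.N) {p : ℝ × ℝ} (h : A.t j = A.rho j p) :
    0 < j ∧ j < A.N := by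
  have h0 := A.rho_nonneg j p
  constructor
  · rcases Nat.eq_zero_or_pos j with rfl | h1
    · linarith [A.t_zero]
    · exact h1
  · rcases hj.lt_or_eq with h1 | rfl
    · exact h1
    · linarith [A.t_last]

theorem hgt_of_rho_eq {j : ℕ} (hj : j < A.N) {p : ℝ × ℝ} (h : A.t j = A.rho j p) :
    A.hgt j p = A.K j := by
  have h1 : A.r₀ < A.rho (j + 1) p := A.lt_rho_succ (by linarith [A.t_lt j hj.le, A.r₁_lt])
  rw [hgt_eq_up hj (by linarith [A.r₁_lt]), ← h]
  have := pos_of_rho_eq hj.le h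
  exact A.up_waist j this.1 this.2

theorem hgt_of_rho_succ_eq {j : ℕ} (hj : j < A.N) {p : ℝ × ℝ}
    (h : A.t (j + 1) = A.rho (j + 1) p) : A.hgt j p = A.K (j + 1) := by
  have h1 : A.r₀ < A.rho j p := A.lt_rho_of_succ (by linarith [A.t_lt (j + 1) hj, A.r₁_lt])
  rw [hgt_eq_dn hj (by linarith [A.r₁_lt]), ← h]
  have := pos_of_rho_eq (j := j + 1) hj h
  exact A.dn_waist j this.2

theorem hgt_mem_Icc {j : ℕ} (hj : j < A.N) {p : ℝ × ℝ} (hp : p ∈ A.dom j) :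
    A.hgt j p ∈ Icc (A.K j) (A.K (j + 1)) := by
  have hK := A.K_lt_succ hj
  rcases hp.1.eq_or_lt with h | h
  · rw [hgt_of_rho_eq hj h]
    exact ⟨le_rfl, hK.le⟩
  rcases hp.2.eq_or_lt with h' | h'
  · rw [hgt_of_rho_succ_eq hj h']
    exact ⟨hK.le, le_rfl⟩
  exact Ioo_subset_Icc_self (hgt_mem hj ⟨h, h'⟩)

theorem abs_lt_of_mem_Ioo {j : ℕ} (hj : j < A.N) {z : ℝ} (hz : z ∈ Ioo (A.K j) (A.K (j + 1))) :
    |z| < π / 4 := by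
  have h1 := A.K_mono (Nat.zero_le j) hj.le
  have h2 := A.K_mono (i := j + 1) hj le_rfl
  rw [abs_lt]
  constructor <;> linarith [A.K_zero, A.K_last, hz.1, hz.2]

theorem abs_K_lt {j : ℕ} (h0 : 0 < j) (hj : j < A.N) : |A.K j| < π / 4 := by
  rw [abs_lt]
  constructor
  · linarith [A.K_zero, A.K_lt h0 hj.le]
  · linarith [A.K_last, A.K_lt hj le_rfl]

theorem abs_hgt_lt {j : ℕ} (hj : j < A.N) {p : ℝ × ℝ} (hp : p ∈ A.dom j) :
    |A.hgt j p| < π / 4 := by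
  rcases hp.1.eq_or_lt with h | h
  · rw [hgt_of_rho_eq hj h]
    have := pos_of_rho_eq hj.le h
    exact abs_K_lt this.1 this.2
  rcases hp.2.eq_or_lt with h' | h'
  · rw [hgt_of_rho_succ_eq hj h']
    have := pos_of_rho_eq (j := j + 1) hj h'
    exact abs_K_lt this.1 this.2
  exact abs_lt_of_mem_Ioo hj (hgt_mem hj ⟨h, h'⟩)

variable (A) in
/-- The periodic surface formed by the levels. -/
def lifted : Set (ℝ × ℝ × ℝ) :=
  {w | ∃ j < A.N, (w.1, w.2.1) ∈ A.dom j ∧ w.2.2 = A.hgt j (w.1, w.2.1)}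

variable (A) in
/-- The closed surface in the three-sphere. -/
def surf : Set E := Phi '' A.lifted

theorem abs_lt_of_mem_lifted {w : ℝ × ℝ × ℝ} (hw : w ∈ A.lifted) : |w.2.2| < π / 4 := by
  obtain ⟨j, hj, hd, hz⟩ := hw
  rw [hz]
  exact abs_hgt_lt hj hd

theorem dom_add_int (j : ℕ) (x y : ℝ) (n m : ℤ) :
    (x + n * (2 * A.X), y + m * (2 * A.Y)) ∈ A.dom j ↔ (x, y) ∈ A.dom j := by
  simp only [dom, mem_ofPred_eq, rho_add_int]

theorem hgt_add_int (j : ℕ) (x y : ℝ) (n m : ℤ) :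
    A.hgt j (x + n * (2 * A.X), y + m * (2 * A.Y)) = A.hgt j (x, y) := by
  simp only [hgt, rho_add_int]

theorem lifted_add_int {x y z : ℝ} (n m : ℤ) :
    (x + n * (2 * A.X), y + m * (2 * A.Y), z) ∈ A.lifted ↔ (x, y, z) ∈ A.lifted := by
  simp only [lifted, mem_ofPred_eq, dom_add_int, hgt_add_int]

theorem hgt_add_per (j : ℕ) (x y : ℝ) (n m : ℤ) :
    A.hgt j (x + n * per, y + m * per) = A.hgt j (x, y) := by
  rw [← hgt_add_int j x y (n * A.p) (m * A.q)]
  congr 2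
  · conv_lhs => rw [A.per_eq_X]
    push_cast; ring
  · conv_lhs => rw [A.per_eq_Y]
    push_cast; ring

theorem lifted_add_per {x y z : ℝ} (n m : ℤ) :
    (x + n * per, y + m * per, z) ∈ A.lifted ↔ (x, y, z) ∈ A.lifted := by
  rw [← lifted_add_int (x := x) (y := y) (n * A.p) (m * A.q)]
  have h1 : x + n * per = x + ((n * A.p : ℤ) : ℝ) * (2 * A.X) := by
    rw [A.per_eq_X]; push_cast; ring
  have h2 : y + m * per = y + ((m * A.q : ℤ) : ℝ) * (2 * A.Y) := by
    rw [A.per_eq_Y]; push_cast; ring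
  rw [h1, h2]

theorem mem_lifted_of_Phi_mem {w : ℝ × ℝ × ℝ} (hz : |w.2.2| < π / 4) (hw : Phi w ∈ A.surf) :
    w ∈ A.lifted := by
  obtain ⟨w', hw', he⟩ := hw
  obtain ⟨h1, ⟨n, hn⟩, m, hm⟩ := (Phi_eq_iff (abs_lt_of_mem_lifted hw') hz).1 he
  obtain ⟨x, y, z⟩ := w
  obtain ⟨x', y', z'⟩ := w'
  simp only at h1 hn hm
  subst h1 hn hm
  exact (lifted_add_per n m).1 hw'

/-- The levels are separated by the planes through the waists. -/
theorem level_of_mem {w : ℝ × ℝ × ℝ} (hw : w ∈ A.lifted) {j : ℕ} (hj : j < A.N)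
    (hz : w.2.2 ∈ Ioo (A.K j) (A.K (j + 1))) :
    (w.1, w.2.1) ∈ A.domInt j ∧ w.2.2 = A.hgt j (w.1, w.2.1) := by
  obtain ⟨i, hi, hd, he⟩ := hw
  have h1 := hgt_mem_Icc hi hd
  rw [← he] at h1
  have hij : i = j := by
    rcases lt_trichotomy i j with h | h | h
    · linarith [A.K_mono (i := i + 1) h hj.le, h1.2, hz.1]
    · exact h
    · linarith [A.K_mono (i := j + 1) h hi.le, h1.1, hz.2]
  subst hij
  refine ⟨⟨lt_of_le_of_ne hd.1 ?_, lt_of_le_of_ne hd.2 ?_⟩, he⟩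
  · intro h
    rw [he, hgt_of_rho_eq hi h] at hz
    exact lt_irrefl _ hz.1
  · intro h
    rw [he, hgt_of_rho_succ_eq hi h] at hz
    exact lt_irrefl _ hz.2

end Stack

namespace Stack

variable {A : Stack}

/-! ### Smoothness of the levels -/

theorem rho_eq_of_near {j : ℕ} {x y : ℝ} (n m : ℤ)
    (hx : |x - (((j : ℝ) - 1) * A.X + n * (2 * A.X))| ≤ A.X)
    (hy : |y - (((j : ℝ) - 1) * A.Y + m * (2 * A.Y))| ≤ A.Y) :
    A.rho j (x, y) = √((x - (((j : ℝ) - 1) * A.X + n * (2 * A.X))) ^ 2 +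
      (y - (((j : ℝ) - 1) * A.Y + m * (2 * A.Y))) ^ 2) := by
  have key : ∀ (X x : ℝ) (n : ℤ), 0 < X → |x - (((j : ℝ) - 1) * X + n * (2 * X))| ≤ X →
      fold X (x - ((j : ℝ) - 1) * X) = |x - (((j : ℝ) - 1) * X + n * (2 * X))| := by
    intro X x n hX h
    rw [← fold_eq_abs hX h, ← fold_add_int X (x - (((j : ℝ) - 1) * X + n * (2 * X))) n]
    congr 1
    ring
  simp only [rho]
  rw [key _ _ n A.X_pos hx, key _ _ m A.Y_pos hy, sq_abs, sq_abs]

theorem exists_center (j : ℕ) (x y : ℝ) : ∃ n m : ℤ,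
    |x - (((j : ℝ) - 1) * A.X + n * (2 * A.X))| ≤ A.X ∧
    |y - (((j : ℝ) - 1) * A.Y + m * (2 * A.Y))| ≤ A.Y := by
  obtain ⟨n, hn, -⟩ := exists_fold_eq A.X_pos (x - ((j : ℝ) - 1) * A.X)
  obtain ⟨m, hm, -⟩ := exists_fold_eq A.Y_pos (y - ((j : ℝ) - 1) * A.Y)
  exact ⟨n, m, by rwa [← sub_sub], by rwa [← sub_sub]⟩

theorem abs_le_sqrt_sq_add_sq (a b : ℝ) : |a| ≤ √(a ^ 2 + b ^ 2) ∧ |b| ≤ √(a ^ 2 + b ^ 2) :=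
  ⟨Real.abs_le_sqrt (by nlinarith [sq_nonneg b]), Real.abs_le_sqrt (by nlinarith [sq_nonneg a])⟩

theorem rho_eventually {j : ℕ} {p : ℝ × ℝ} (h : A.rho j p < A.r₀) :
    ∃ c : ℝ × ℝ, ∀ᶠ p' in 𝓝 p, A.rho j p' = √((p'.1 - c.1) ^ 2 + (p'.2 - c.2) ^ 2) := by
  obtain ⟨x, y⟩ := p
  obtain ⟨n, m, hn, hm⟩ := exists_center (A := A) j x y
  rw [rho_eq_of_near n m hn hm] at h
  have h1 := abs_le_sqrt_sq_add_sq (x - (((j : ℝ) - 1) * A.X + n * (2 * A.X)))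
    (y - (((j : ℝ) - 1) * A.Y + m * (2 * A.Y)))
  refine ⟨(((j : ℝ) - 1) * A.X + n * (2 * A.X), ((j : ℝ) - 1) * A.Y + m * (2 * A.Y)), ?_⟩
  have h2 : ∀ᶠ p' : ℝ × ℝ in 𝓝 (x, y), |p'.1 - (((j : ℝ) - 1) * A.X + n * (2 * A.X))| < A.X := by
    refine ContinuousAt.eventually_lt (by fun_prop) (by fun_prop) ?_
    linarith [h1.1, A.r₀_lt_X, A.X_pos]
  have h3 : ∀ᶠ p' : ℝ × ℝ in 𝓝 (x, y), |p'.2 - (((j : ℝ) - 1) * A.Y + m * (2 * A.Y))| < A.Y := by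
    refine ContinuousAt.eventually_lt (by fun_prop) (by fun_prop) ?_
    linarith [h1.2, A.r₀_lt_Y, A.Y_pos]
  filter_upwards [h2, h3] with p' hp2 hp3
  exact rho_eq_of_near n m hp2.le hp3.le

theorem contDiffAt_comp_rho {j : ℕ} {p : ℝ × ℝ} {h : ℝ → ℝ} {c τ : ℝ} (hτ : 0 < τ)
    (hp : τ < A.rho j p) (hs : ContDiffOn ℝ ∞ h (Ioi τ)) (hfar : ∀ r, A.r₁ ≤ r → h r = c) :
    ContDiffAt ℝ ∞ (fun p => h (A.rho j p)) p := by
  by_cases h1 : A.rho j p < A.r₀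
  · obtain ⟨c, hc⟩ := rho_eventually h1
    have h2 : ContDiffAt ℝ ∞ (fun p' : ℝ × ℝ => √((p'.1 - c.1) ^ 2 + (p'.2 - c.2) ^ 2)) p := by
      refine ContDiffAt.sqrt (by fun_prop) ?_
      intro h0
      rw [hc.self_of_nhds, h0, sqrt_zero] at hp
      linarith
    have h3 : ContDiffAt ℝ ∞ (A.rho j) p := h2.congr_of_eventuallyEq hc
    exact (hs.contDiffAt (Ioi_mem_nhds hp)).comp p h3
  · have h2 : ∀ᶠ p' in 𝓝 p, A.r₁ < A.rho j p' :=
      (A.continuous_rho j).continuousAt.eventually_const_lt (A.r₁_lt.trans_le (not_lt.1 h1))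
    refine (contDiffAt_const (c := c)).congr_of_eventuallyEq ?_
    filter_upwards [h2] with p' hp' using hfar _ hp'.le

theorem contDiffAt_up {j : ℕ} (hj : j < A.N) {p : ℝ × ℝ} (hp : A.t j < A.rho j p) :
    ContDiffAt ℝ ∞ (fun p => A.up j (A.rho j p)) p := by
  rcases Nat.eq_zero_or_pos j with rfl | h0
  · simp only [A.up_zero]
    exact contDiffAt_const
  · exact contDiffAt_comp_rho (A.t_pos j h0 hj) hp (A.up_smooth j h0 hj) (A.up_far j hj)

theorem contDiffAt_dn {j : ℕ} (hj : j < A.N) {p : ℝ × ℝ} (hp : A.t (j + 1) < A.rho (j + 1) p) :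
    ContDiffAt ℝ ∞ (fun p => A.dn j (A.rho (j + 1) p)) p := by
  rcases (Nat.succ_le_of_lt hj).eq_or_lt with h0 | h0
  · obtain rfl : j = A.N - 1 := by omega
    simp only [A.dn_last]
    exact contDiffAt_const
  · exact contDiffAt_comp_rho (A.t_pos (j + 1) (by omega) h0) hp (A.dn_smooth j h0) (A.dn_far j hj)

theorem contDiffAt_hgt {j : ℕ} (hj : j < A.N) {p : ℝ × ℝ} (hp : p ∈ A.domInt j) :
    ContDiffAt ℝ ∞ (A.hgt j) p := by
  by_cases h1 : A.r₁ < A.rho (j + 1) p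
  · refine (contDiffAt_up hj hp.1).congr_of_eventuallyEq ?_
    filter_upwards [(A.continuous_rho (j + 1)).continuousAt.eventually_const_lt h1] with p' hp'
    exact hgt_eq_up hj hp'.le
  · have h2 : A.r₁ < A.rho j p :=
      A.r₁_lt.trans (A.lt_rho_of_succ ((not_lt.1 h1).trans_lt A.r₁_lt))
    refine (contDiffAt_dn hj hp.2).congr_of_eventuallyEq ?_
    filter_upwards [(A.continuous_rho j).continuousAt.eventually_const_lt h2] with p' hp'
    exact hgt_eq_dn hj hp'.le

/-! ### Charts on the levels -/

/-- The sign that orients level `j`. -/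
def sg (j : ℕ) : ℝ := (-1) ^ j

theorem sg_mul_self (j : ℕ) : sg j * sg j = 1 := by
  rw [sg, ← mul_pow]
  simp

theorem sg_succ (j : ℕ) : sg (j + 1) = -sg j := by
  rw [sg, sg, pow_succ]
  ring

variable (A) in
/-- Level `j` as a graph, with the orientation of the plane reversed for odd `j`. -/
noncomputable def graphMap (j : ℕ) (u : Plane) : ℝ × ℝ × ℝ :=
  (u 0, sg j * u 1, A.hgt j (u 0, sg j * u 1))

variable (A) in
/-- The domain of a chart on level `j`: a fundamental rectangle of `Φ` around `b`, without the
necks. -/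
def graphDom (j : ℕ) (b : ℝ × ℝ) : Set Plane :=
  {u | |u 0 - b.1| < π / √2 ∧ |sg j * u 1 - b.2| < π / √2 ∧ (u 0, sg j * u 1) ∈ A.domInt j}

variable (A) in
/-- The part of the sphere in which `graphMap` parametrizes the surface. -/
def graphRange (j : ℕ) (b : ℝ × ℝ) : Set E :=
  liftDom b ∩ {w | (lift b w).2.2 ∈ Ioo (A.K j) (A.K (j + 1))}

/-- The left inverse of `Phi ∘ graphMap`. -/
noncomputable def graphInv (j : ℕ) (b : ℝ × ℝ) (w : E) : Plane :=
  !₂[(lift b w).1, sg j * (lift b w).2.1]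

theorem contDiff_coord : ContDiff ℝ ∞ (fun u : Plane => u 0) ∧ ContDiff ℝ ∞ (fun u : Plane => u 1) :=
  ⟨contDiff_piLp_apply (i := 0) 2, contDiff_piLp_apply (i := 1) 2⟩

theorem continuous_lift_height (b : ℝ × ℝ) : Continuous fun w => (lift b w).2.2 := by
  have h : ∀ i : Fin 2, Continuous fun w : E => w i := fun i => by fun_prop
  exact (continuous_arcsin.comp ((Complex.continuous_normSq.comp (h 0)).sub
    (Complex.continuous_normSq.comp (h 1)))).div_const 2

theorem differentiable_toLp {w : E} {a b : E → ℝ} (ha : DifferentiableAt ℝ a w)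
    (hb : DifferentiableAt ℝ b w) : DifferentiableAt ℝ (fun w => (!₂[a w, b w] : Plane)) w := by
  rw [differentiableAt_piLp]
  intro i
  fin_cases i
  · exact ha
  · exact hb

theorem differentiableAt_lift {b : ℝ × ℝ} {w : E} (hw : w ∈ liftDom b) :
    DifferentiableAt ℝ (fun w => (lift b w).1) w ∧ DifferentiableAt ℝ (fun w => (lift b w).2.1) w ∧
      DifferentiableAt ℝ (fun w => (lift b w).2.2) w := by
  have h := (differentiableOn_lift b).differentiableAt ((isOpen_liftDom b).mem_nhds hw)
  exact ⟨h.fst, h.snd.fst, h.snd.snd⟩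

theorem isChart_graph {j : ℕ} (hj : j < A.N) (b : ℝ × ℝ) :
    IsChart A.surf (A.graphDom j b) (Phi ∘ A.graphMap j) (graphInv j b) (A.graphRange j b) := by
  have hc := contDiff_coord
  have hc0 := hc.1.continuous
  have hc1 := hc.2.continuous
  have hxy : ContDiff ℝ ∞ (fun u : Plane => (u 0, sg j * u 1)) :=
    hc.1.prodMk (contDiff_const.mul hc.2)
  have hmaps : ∀ u ∈ A.graphDom j b, A.graphMap j u ∈ A.lifted ∧
      (A.graphMap j u).2.2 ∈ Ioo (A.K j) (A.K (j + 1)) := by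
    rintro u ⟨-, -, h⟩
    exact ⟨⟨j, hj, ⟨h.1.le, h.2.le⟩, rfl⟩, hgt_mem hj h⟩
  have hlift : ∀ u ∈ A.graphDom j b, lift b (Phi (A.graphMap j u)) = A.graphMap j u := by
    intro u hu
    exact lift_Phi hu.1 hu.2.1 (abs_lt_of_mem_lifted (hmaps u hu).1)
  refine ⟨?_, ?_, ?_, ?_, ?_, ?_⟩
  · refine (isOpen_Iio.preimage (t := Iio (π / √2)) (f := fun u : Plane => |u 0 - b.1|) ?_).inter
      ((isOpen_Iio.preimage (t := Iio (π / √2)) (f := fun u : Plane => |sg j * u 1 - b.2|) ?_).inter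
        ((A.isOpen_domInt j).preimage hxy.continuous))
    · exact (hc0.sub continuous_const).abs
    · exact ((continuous_const.mul hc1).sub continuous_const).abs
  · intro u hu
    apply ContDiffAt.contDiffWithinAt
    have h1 : ContDiffAt ℝ ∞ (fun u : Plane => A.hgt j (u 0, sg j * u 1)) u :=
      ContDiffAt.comp (g := A.hgt j) (f := fun u : Plane => (u 0, sg j * u 1)) u
        (contDiffAt_hgt hj hu.2.2) hxy.contDiffAt
    have h2 : ContDiffAt ℝ ∞ (A.graphMap j) u :=
      hc.1.contDiffAt.prodMk ((contDiff_const.mul hc.2).contDiffAt.prodMk h1)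
    exact ContDiffAt.comp u contDiff_Phi.contDiffAt h2
  · exact (isOpen_liftDom b).inter (isOpen_Ioo.preimage (continuous_lift_height b))
  · rintro w ⟨hw, -⟩
    have h := differentiableAt_lift hw
    have h1 : DifferentiableAt ℝ (fun w => sg j * (lift b w).2.1) w := h.2.1.const_mul (sg j)
    exact (differentiable_toLp h.1 h1).differentiableWithinAt
  · ext w
    constructor
    · rintro ⟨u, hu, rfl⟩
      have h1 := hmaps u hu
      refine ⟨⟨_, h1.1, rfl⟩, Phi_mem_liftDom hu.1 hu.2.1 (abs_lt_of_mem_lifted h1.1), ?_⟩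
      rw [mem_ofPred_eq, Function.comp_apply, hlift u hu]
      exact h1.2
    · rintro ⟨⟨v, hv, rfl⟩, hd, hz⟩
      have hv' := abs_lt_of_mem_lifted hv
      have h1 := Phi_lift b hv'
      have h2 : lift b (Phi v) ∈ A.lifted :=
        mem_lifted_of_Phi_mem (by rwa [lift_height b hv']) (by rw [h1]; exact ⟨v, hv, rfl⟩)
      have h3 := level_of_mem h2 hj hz
      have h4 := lift_near hd
      have e1 : sg j * (sg j * (lift b (Phi v)).2.1) = (lift b (Phi v)).2.1 := by
        rw [← mul_assoc, sg_mul_self, one_mul]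
      refine ⟨graphInv j b (Phi v), ⟨h4.1, ?_, ?_⟩, ?_⟩
      · simpa only [graphInv, PiLp.toLp_apply, Matrix.cons_val_one, Matrix.cons_val_fin_one, e1]
          using h4.2
      · simpa only [graphInv, PiLp.toLp_apply, Matrix.cons_val_zero, Matrix.cons_val_one,
          Matrix.cons_val_fin_one, e1] using h3.1
      · rw [Function.comp_apply]
        conv_rhs => rw [← h1]
        congr 1
        refine Prod.ext rfl (Prod.ext e1 ?_)
        simp only [graphMap, graphInv, PiLp.toLp_apply, Matrix.cons_val_zero, Matrix.cons_val_one,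
          Matrix.cons_val_fin_one, e1]
        exact h3.2.symm
  · intro u hu
    simp only [Function.comp_apply, graphInv, hlift u hu]
    ext i
    fin_cases i
    · rfl
    · change sg j * (sg j * u 1) = u 1
      rw [← mul_assoc, sg_mul_self, one_mul]

end Stack

namespace Stack

variable {A : Stack}

/-! ### Charts across the waists -/

theorem exists_lt_of_continuousOn {f : ℝ → ℝ} {a b k c : ℝ} (hab : a ≤ b)
    (hf : ContinuousOn f (Icc a b)) (hk : ∀ r ∈ Icc a b, k < f r) (hc : ∀ r, b ≤ r → f r = c) :
    ∃ ε > 0, ∀ r, a ≤ r → k + ε ≤ f r := by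
  obtain ⟨x, hx, hmin⟩ := isCompact_Icc.exists_isMinOn (nonempty_Icc.2 hab) hf
  refine ⟨f x - k, sub_pos.2 (hk x hx), fun r hr => ?_⟩
  rw [add_sub_cancel]
  rcases le_total r b with h | h
  · exact hmin ⟨hr, h⟩
  · rw [hc r h, ← hc b le_rfl]
    exact hmin ⟨hab, le_rfl⟩

theorem dn_bound {j : ℕ} (hj : j < A.N) :
    ∃ ε > 0, ∀ r, A.t (j + 1) ≤ r → A.K j + ε ≤ A.dn j r := by
  rcases (Nat.succ_le_of_lt hj).eq_or_lt with h0 | h0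
  · obtain rfl : j = A.N - 1 := by omega
    refine ⟨A.T (A.N - 1) - A.K (A.N - 1), sub_pos.2 (A.lt_T _ hj), fun r _ => ?_⟩
    rw [A.dn_last]
    linarith
  · refine exists_lt_of_continuousOn (A.t_lt (j + 1) hj).le
      ((A.dn_cont j h0).mono Icc_subset_Ici_self) ?_ (A.dn_far j hj)
    rintro r ⟨hr, -⟩
    rcases hr.eq_or_lt with h | h
    · rw [← h, A.dn_waist j h0]
      exact A.K_lt_succ hj
    · exact (A.dn_mem j hj r h).1

theorem up_bound {j : ℕ} (hj : j < A.N) :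
    ∃ ε > 0, ∀ r, A.t j ≤ r → A.up j r ≤ A.K (j + 1) - ε := by
  rcases Nat.eq_zero_or_pos j with rfl | h0
  · refine ⟨A.K 1 - A.T 0, sub_pos.2 (A.T_lt _ hj), fun r _ => ?_⟩
    rw [A.up_zero]
    linarith
  · have hk : ∀ r ∈ Icc (A.t j) A.r₁, -A.K (j + 1) < -A.up j r := by
      rintro r ⟨hr, -⟩
      rw [neg_lt_neg_iff]
      rcases hr.eq_or_lt with h | h
      · rw [← h, A.up_waist j h0 hj]
        exact A.K_lt_succ hj
      · exact (A.up_mem j hj r h).2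
    obtain ⟨ε, hε, h⟩ := exists_lt_of_continuousOn (c := -A.T j) (A.t_lt j hj.le).le
      ((A.up_cont j h0 hj).mono Icc_subset_Ici_self).neg hk
      (fun r hr => by rw [Pi.neg_apply, A.up_far j hj r hr])
    exact ⟨ε, hε, fun r hr => by have := h r hr; rw [Pi.neg_apply] at this; linarith⟩

/-- Near the height of a waist the surface is a catenoid. -/
theorem exists_catenoid {j : ℕ} (hj : j + 1 < A.N) : ∃ ε > 0,
    ε ≤ (A.K (j + 1) - A.K j) / 2 ∧ ε ≤ (A.K (j + 2) - A.K (j + 1)) / 2 ∧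
    (∀ s, A.t (j + 1) * |s| < ε → A.t (j + 1) * cosh s < A.r₀) ∧
    (∀ w ∈ A.lifted, |w.2.2 - A.K (j + 1)| < ε →
      A.rho (j + 1) (w.1, w.2.1) = A.t (j + 1) * cosh ((w.2.2 - A.K (j + 1)) / A.t (j + 1))) ∧
    ∀ x y s, A.t (j + 1) * |s| < ε → A.rho (j + 1) (x, y) = A.t (j + 1) * cosh s →
      (x, y, A.K (j + 1) + A.t (j + 1) * s) ∈ A.lifted := by
  have hj' : j < A.N := by omega
  have ht : 0 < A.t (j + 1) := A.t_pos (j + 1) (by omega) hj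
  obtain ⟨ε₁, hε₁, h1, h1'⟩ := A.up_cat (j + 1) (by omega) hj
  obtain ⟨ε₂, hε₂, h2, h2'⟩ := A.dn_cat j hj
  obtain ⟨ε₃, hε₃, h3⟩ := dn_bound hj
  obtain ⟨ε₄, hε₄, h4⟩ := up_bound hj'
  have hK1 := A.K_lt_succ hj'
  have hK2 := A.K_lt_succ hj
  obtain ⟨ε, hε, hle⟩ : ∃ ε > 0, ∀ e ∈ ({ε₁, ε₂, ε₃, ε₄, (A.K (j + 1) - A.K j) / 2,
      (A.K (j + 2) - A.K (j + 1)) / 2} : Finset ℝ), ε ≤ e := by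
    refine ⟨_, (Finset.lt_min'_iff _ ⟨ε₁, by simp⟩).2 ?_, fun e he => Finset.min'_le _ e he⟩
    simp only [Finset.mem_insert, Finset.mem_singleton]
    rintro e (rfl | rfl | rfl | rfl | rfl | rfl) <;> first | assumption | linarith
  have e1 := hle ε₁ (by simp)
  have e2 := hle ε₂ (by simp)
  have e3 := hle ε₃ (by simp)
  have e4 := hle ε₄ (by simp)
  have e5 := hle ((A.K (j + 1) - A.K j) / 2) (by simp)
  have e6 := hle ((A.K (j + 2) - A.K (j + 1)) / 2) (by simp)
  have hcosh : ∀ s, A.t (j + 1) * |s| < ε → A.t (j + 1) * cosh s < A.r₀ := by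
    intro s hs
    rw [← cosh_abs]
    exact (h1' |s| (abs_nonneg s) (hs.trans_le e1)).2
  refine ⟨ε, hε, e5, e6, hcosh, ?_, ?_⟩
  · rintro w ⟨i, hi, hd, hz⟩ hw
    have hw' := abs_lt.1 hw
    have hmem := hgt_mem_Icc hi hd
    rw [← hz] at hmem
    have hij : i = j + 1 ∨ i = j := by
      by_contra hcon
      rcases lt_or_gt_of_ne (fun h => hcon (Or.inr h)) with h | h
      · linarith [A.K_mono (i := i + 1) (j := j) h hj'.le, hmem.2]
      · have h5 : j + 2 ≤ i := by omega
        linarith [A.K_mono h5 hi.le, hmem.1]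
    rcases hij with rfl | rfl
    · rcases hgt_cases hi (w.1, w.2.1) with h | h
      · rw [h.1] at hz
        rw [hz]
        exact h1 _ hd.1 (by rw [← hz]; linarith)
      · have := h3 _ hd.2
        rw [← h.1, ← hz] at this
        linarith
    · rcases hgt_cases hi (w.1, w.2.1) with h | h
      · have := h4 _ hd.1
        rw [← h.1, ← hz] at this
        linarith
      · rw [h.1] at hz
        have h5 := h2 _ hd.2 (by rw [← hz]; linarith)
        rw [← hz] at h5
        rw [h5, ← cosh_neg]
        congr 2
        ring
  · intro x y s hs hrho
    have hr := hcosh s hs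
    rw [← hrho] at hr
    have hge : A.t (j + 1) ≤ A.rho (j + 1) (x, y) := by
      rw [hrho]
      nlinarith [one_le_cosh s]
    rcases le_total 0 s with h | h
    · rw [abs_of_nonneg h] at hs
      have h5 := A.lt_rho_succ hr
      refine ⟨j + 1, hj, ⟨hge, ?_⟩, ?_⟩
      · linarith [A.t_lt (j + 1 + 1) (by omega), A.r₁_lt]
      · simp only
        rw [hgt_eq_up hj (by linarith [A.r₁_lt]), hrho]
        exact (h1' s h (hs.trans_le e1)).1.symm
    · rw [abs_of_nonpos h] at hs
      have h5 := A.lt_rho_of_succ hr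
      refine ⟨j, hj', ⟨?_, hge⟩, ?_⟩
      · linarith [A.t_lt j (by omega), A.r₁_lt]
      · simp only
        rw [hgt_eq_dn hj' (by linarith [A.r₁_lt]), hrho, ← cosh_neg,
          (h2' (-s) (by linarith) (hs.trans_le e2)).1]
        ring

variable (A) in
/-- The size in the vertical direction of the catenoidal charts across the waists at height
`K (j + 1)`. -/
noncomputable def eps (j : ℕ) (hj : j + 1 < A.N) : ℝ := (exists_catenoid (A := A) hj).choose

variable (A) in
/-- The axes of neck `j + 1`. -/
noncomputable def axis (j : ℕ) (n m : ℤ) : ℝ × ℝ :=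
  (j * A.X + n * (2 * A.X), j * A.Y + m * (2 * A.Y))

variable (A) in
/-- The catenoid of neck `j + 1` around the axis with indices `n`, `m`, parametrized by the angle
and the height. -/
noncomputable def catMap (j : ℕ) (n m : ℤ) (u : Plane) : ℝ × ℝ × ℝ :=
  ((A.axis j n m).1 + A.t (j + 1) * cosh (u 1) * cos (u 0),
    (A.axis j n m).2 + A.t (j + 1) * cosh (u 1) * sin (u 0),
    A.K (j + 1) + A.t (j + 1) * (sg j * u 1))

variable (A) in
/-- The domain of a catenoidal chart. -/
def catDom (j : ℕ) (hj : j + 1 < A.N) (θ : ℝ) : Set Plane :=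
  {u | |u 0 - θ| < π ∧ A.t (j + 1) * |u 1| < A.eps j hj}

variable (A) in
/-- The horizontal position relative to an axis, as a complex number. -/
noncomputable def relPos (j : ℕ) (n m : ℤ) (w : E) : ℂ :=
  ⟨(lift (A.axis j n m) w).1 - (A.axis j n m).1, (lift (A.axis j n m) w).2.1 - (A.axis j n m).2⟩

variable (A) in
/-- The part of the sphere in which `catMap` parametrizes the surface. -/
def catRange (j : ℕ) (hj : j + 1 < A.N) (n m : ℤ) (θ : ℝ) : Set E :=
  liftDom (A.axis j n m) ∩ (A.relPos j n m ⁻¹' (slitNear (θ / √2) ∩ Metric.ball 0 A.r₀) ∩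
    {w | |(lift (A.axis j n m) w).2.2 - A.K (j + 1)| < A.eps j hj})

variable (A) in
/-- The left inverse of `Phi ∘ catMap`. -/
noncomputable def catInv (j : ℕ) (n m : ℤ) (θ : ℝ) (w : E) : Plane :=
  !₂[√2 * angleNear (θ / √2) (A.relPos j n m w),
    sg j * (((lift (A.axis j n m) w).2.2 - A.K (j + 1)) / A.t (j + 1))]

theorem half_per_X : A.X ≤ π / √2 ∧ A.Y ≤ π / √2 := by
  have h1 : (1 : ℝ) ≤ A.p := by exact_mod_cast A.p_pos
  have h2 : (1 : ℝ) ≤ A.q := by exact_mod_cast A.q_pos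
  rw [← per_div_two]
  constructor
  · nlinarith [A.per_eq_X, A.X_pos]
  · nlinarith [A.per_eq_Y, A.Y_pos]

theorem abs_sg_mul (j : ℕ) (x : ℝ) : |sg j * x| = |x| := by
  rw [abs_mul]
  have : |sg j| = 1 := by
    rw [sg, abs_pow, abs_neg, abs_one, one_pow]
  rw [this, one_mul]

theorem rho_axis {j : ℕ} {n m : ℤ} {x y : ℝ} (hx : |x - (A.axis j n m).1| ≤ A.X)
    (hy : |y - (A.axis j n m).2| ≤ A.Y) : A.rho (j + 1) (x, y) =
      √((x - (A.axis j n m).1) ^ 2 + (y - (A.axis j n m).2) ^ 2) := by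
  have e : ((j + 1 : ℕ) : ℝ) - 1 = j := by push_cast; ring
  have := rho_eq_of_near (A := A) (j := j + 1) (x := x) (y := y) n m
  rw [e] at this
  exact this hx hy

theorem polarPt_angle (θ r : ℝ) : polarPt (θ / √2) r = ⟨r * cos θ, r * sin θ⟩ := by
  rw [polarPt, mul_div_cancel₀ _ sqrt_two_pos.ne', mul_comm Complex.I, Complex.exp_mul_I,
    ← Complex.ofReal_cos, ← Complex.ofReal_sin]
  apply Complex.ext
  · rw [Complex.re_mul_ofReal, Complex.add_re, Complex.ofReal_re, Complex.re_ofReal_mul,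
      Complex.I_re]
    ring
  · rw [Complex.im_mul_ofReal, Complex.add_im, Complex.ofReal_im, Complex.im_ofReal_mul,
      Complex.I_im]
    ring

theorem norm_mk (a b : ℝ) : ‖(⟨a, b⟩ : ℂ)‖ = √(a ^ 2 + b ^ 2) := by
  rw [Complex.norm_def, Complex.normSq_mk]
  ring_nf

theorem differentiableAt_relPos {j : ℕ} {n m : ℤ} {w : E} (hw : w ∈ liftDom (A.axis j n m)) :
    DifferentiableAt ℝ (A.relPos j n m) w := by
  have h := differentiableAt_lift hw
  have e : A.relPos j n m = fun w => Complex.equivRealProdCLM.symm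
      ((lift (A.axis j n m) w).1 - (A.axis j n m).1,
        (lift (A.axis j n m) w).2.1 - (A.axis j n m).2) := by
    funext w
    apply Complex.ext <;> simp [relPos]
  rw [e]
  exact (ContinuousLinearEquiv.differentiableAt _).comp w
    ((h.1.sub_const (A.axis j n m).1).prodMk (h.2.1.sub_const (A.axis j n m).2))

theorem catMap_spec {j : ℕ} {hj : j + 1 < A.N} (n m : ℤ) {θ : ℝ} {u : Plane}
    (hu : u ∈ A.catDom j hj θ) :
    A.catMap j n m u ∈ A.lifted ∧ lift (A.axis j n m) (Phi (A.catMap j n m u)) = A.catMap j n m u ∧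
      Phi (A.catMap j n m u) ∈ liftDom (A.axis j n m) ∧
      A.relPos j n m (Phi (A.catMap j n m u)) = polarPt (u 0 / √2) (A.t (j + 1) * cosh (u 1)) ∧
      A.t (j + 1) * cosh (u 1) < A.r₀ := by
  obtain ⟨-, -, -, hcosh, -, hlif⟩ := (exists_catenoid (A := A) hj).choose_spec
  have ht : 0 < A.t (j + 1) := A.t_pos (j + 1) (by omega) hj
  have hr := hcosh (u 1) hu.2
  have hr0 : 0 < A.t (j + 1) * cosh (u 1) := mul_pos ht (cosh_pos _)
  set r := A.t (j + 1) * cosh (u 1) with hrdef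
  have hx : |(A.catMap j n m u).1 - (A.axis j n m).1| ≤ r := by
    simp only [catMap, add_sub_cancel_left]
    rw [abs_mul, abs_of_pos hr0]
    nlinarith [abs_cos_le_one (u 0)]
  have hy : |(A.catMap j n m u).2.1 - (A.axis j n m).2| ≤ r := by
    simp only [catMap, add_sub_cancel_left]
    rw [abs_mul, abs_of_pos hr0]
    nlinarith [abs_sin_le_one (u 0)]
  have hX := A.r₀_lt_X
  have hY := A.r₀_lt_Y
  have hX0 := A.X_pos
  have hY0 := A.Y_pos
  have hper := half_per_X (A := A)
  have hrho : A.rho (j + 1) ((A.catMap j n m u).1, (A.catMap j n m u).2.1) = r := by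
    rw [rho_axis (by linarith) (by linarith)]
    simp only [catMap, add_sub_cancel_left]
    rw [← hrdef, mul_pow r, mul_pow r, ← mul_add, cos_sq_add_sin_sq, mul_one, sqrt_sq hr0.le]
  have h1 : A.catMap j n m u ∈ A.lifted := by
    refine hlif _ _ _ ?_ ?_
    · rw [abs_sg_mul]
      exact hu.2
    · refine hrho.trans (hrdef.trans ?_)
      congr 1
      rw [← cosh_abs (sg j * u 1), abs_sg_mul, cosh_abs]
  have h2 := abs_lt_of_mem_lifted h1
  have h3 : lift (A.axis j n m) (Phi (A.catMap j n m u)) = A.catMap j n m u :=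
    lift_Phi (by linarith [hper.1]) (by linarith [hper.2]) h2
  refine ⟨h1, h3, Phi_mem_liftDom (by linarith [hper.1]) (by linarith [hper.2]) h2, ?_, hr⟩
  rw [polarPt_angle, relPos, h3]
  simp [catMap, hrdef]

theorem isChart_cat {j : ℕ} (hj : j + 1 < A.N) (n m : ℤ) (θ : ℝ) :
    IsChart A.surf (A.catDom j hj θ) (Phi ∘ A.catMap j n m) (A.catInv j n m θ)
      (A.catRange j hj n m θ) := by
  have ht : 0 < A.t (j + 1) := A.t_pos (j + 1) (by omega) hj
  have hc := contDiff_coord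
  have hc0 := hc.1.continuous
  have hc1 := hc.2.continuous
  have hang : ∀ x : ℝ, |x - θ| < π → |x / √2 - θ / √2| < π / √2 := by
    intro x hx
    rw [← sub_div, abs_div, abs_of_pos sqrt_two_pos]
    exact div_lt_div_of_pos_right hx sqrt_two_pos
  obtain ⟨-, -, -, -, hcat, -⟩ := (exists_catenoid (A := A) hj).choose_spec
  refine ⟨?_, ?_, ?_, ?_, ?_, ?_⟩
  · refine (isOpen_Iio.preimage (t := Iio π) (f := fun u : Plane => |u 0 - θ|) ?_).inter
      (isOpen_Iio.preimage (t := Iio (A.eps j hj))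
        (f := fun u : Plane => A.t (j + 1) * |u 1|) ?_)
    · exact (hc0.sub continuous_const).abs
    · exact continuous_const.mul hc1.abs
  · have h1 : ContDiff ℝ ∞ (A.catMap j n m) :=
      (contDiff_const.add ((contDiff_const.mul (contDiff_cosh.comp hc.2)).mul
        (contDiff_cos.comp hc.1))).prodMk
      ((contDiff_const.add ((contDiff_const.mul (contDiff_cosh.comp hc.2)).mul
        (contDiff_sin.comp hc.1))).prodMk
        (contDiff_const.add (contDiff_const.mul (contDiff_const.mul hc.2))))
    exact (contDiff_Phi.comp h1).contDiffOn
  · have hcont : ContinuousOn (A.relPos j n m) (liftDom (A.axis j n m)) :=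
      fun w hw => (differentiableAt_relPos hw).continuousAt.continuousWithinAt
    have h1 := hcont.isOpen_inter_preimage (isOpen_liftDom _)
      ((isOpen_slitNear (θ / √2)).inter (Metric.isOpen_ball (x := (0 : ℂ)) (ε := A.r₀)))
    have h2 : IsOpen {w | |(lift (A.axis j n m) w).2.2 - A.K (j + 1)| < A.eps j hj} :=
      isOpen_Iio.preimage (t := Iio (A.eps j hj))
        (f := fun w => |(lift (A.axis j n m) w).2.2 - A.K (j + 1)|)
        ((continuous_lift_height _).sub continuous_const).abs
    rw [catRange, ← inter_assoc]
    exact h1.inter h2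
  · rintro w ⟨hw, ⟨hw1, -⟩, -⟩
    have h1 := differentiableAt_lift hw
    have h2 : DifferentiableAt ℝ
        (fun w => √2 * angleNear (θ / √2) (A.relPos j n m w)) w :=
      (DifferentiableAt.comp (g := angleNear (θ / √2)) (f := A.relPos j n m) w
        (differentiableAt_angleNear hw1) (differentiableAt_relPos hw)).const_mul (√2)
    have h3 : DifferentiableAt ℝ (fun w => sg j *
        (((lift (A.axis j n m) w).2.2 - A.K (j + 1)) / A.t (j + 1))) w := by
      simp only [div_eq_mul_inv]
      exact ((h1.2.2.sub_const _).mul_const _).const_mul _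
    exact (differentiable_toLp h2 h3).differentiableWithinAt
  · ext w
    constructor
    · rintro ⟨u, hu, rfl⟩
      obtain ⟨h1, h2, h3, h4, h5⟩ := catMap_spec n m hu
      have hr0 : 0 < A.t (j + 1) * cosh (u 1) := mul_pos ht (cosh_pos _)
      refine ⟨⟨_, h1, rfl⟩, h3, ⟨?_, ?_⟩, ?_⟩
      · rw [Function.comp_apply, h4]
        exact polarPt_mem_slitNear hr0 (hang _ hu.1)
      · rw [Function.comp_apply, h4, mem_ball_zero_iff, norm_polarPt, abs_of_pos hr0]
        exact h5
      · rw [mem_ofPred_eq, Function.comp_apply, h2]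
        simp only [catMap, add_sub_cancel_left]
        rw [abs_mul, abs_sg_mul, abs_of_pos ht]
        exact hu.2
    · rintro ⟨⟨v, hv, rfl⟩, hd, ⟨hs, hb⟩, hz⟩
      rw [mem_ofPred_eq] at hz
      have hv' := abs_lt_of_mem_lifted hv
      have h1 := Phi_lift (A.axis j n m) hv'
      have h2 : lift (A.axis j n m) (Phi v) ∈ A.lifted :=
        mem_lifted_of_Phi_mem (by rwa [lift_height _ hv']) (by rw [h1]; exact ⟨v, hv, rfl⟩)
      have hrel : ‖A.relPos j n m (Phi v)‖ < A.r₀ := by rwa [← mem_ball_zero_iff]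
      have h3 := hcat _ h2 hz
      have hsq := abs_le_sqrt_sq_add_sq
        ((lift (A.axis j n m) (Phi v)).1 - (A.axis j n m).1)
        ((lift (A.axis j n m) (Phi v)).2.1 - (A.axis j n m).2)
      have hnorm : ‖A.relPos j n m (Phi v)‖ = _ := norm_mk _ _
      rw [← hnorm] at hsq
      rw [rho_axis (by linarith [A.r₀_lt_X, A.X_pos]) (by linarith [A.r₀_lt_Y, A.Y_pos]),
        ← hnorm] at h3
      set v' := lift (A.axis j n m) (Phi v) with hv'def
      set s := (v'.2.2 - A.K (j + 1)) / A.t (j + 1) with hsdef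
      have hs' : sg j * (sg j * s) = s := by rw [← mul_assoc, sg_mul_self, one_mul]
      have hts : A.t (j + 1) * s = v'.2.2 - A.K (j + 1) := by
        rw [hsdef]; field_simp
      have hcosh : cosh (sg j * s) = cosh s := by
        rw [← cosh_abs (sg j * s), abs_sg_mul, cosh_abs]
      set φ := √2 * angleNear (θ / √2) (A.relPos j n m (Phi v)) with hφ
      have hφ' : φ / √2 = angleNear (θ / √2) (A.relPos j n m (Phi v)) := by
        rw [hφ]; field_simp
      have hpol := polarPt_angleNear (θ / √2) (A.relPos j n m (Phi v))
      rw [← hφ', polarPt_angle, h3] at hpol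
      refine ⟨A.catInv j n m θ (Phi v), ⟨?_, ?_⟩, ?_⟩
      · have := abs_angleNear_sub_lt hs
        rw [← hφ', ← sub_div, abs_div, abs_of_pos sqrt_two_pos] at this
        exact (div_lt_div_iff_of_pos_right sqrt_two_pos).1 this
      · change A.t (j + 1) * |sg j * s| < _
        rw [abs_sg_mul, ← abs_of_pos ht, ← abs_mul, hts]
        exact hz
      · rw [Function.comp_apply]
        conv_rhs => rw [← h1]
        congr 1
        change ((A.axis j n m).1 + A.t (j + 1) * cosh (sg j * s) * cos φ,
          (A.axis j n m).2 + A.t (j + 1) * cosh (sg j * s) * sin φ,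
          A.K (j + 1) + A.t (j + 1) * (sg j * (sg j * s))) = v'
        rw [hcosh, hs', hts]
        have hre := congrArg Complex.re hpol
        have him := congrArg Complex.im hpol
        simp only [relPos] at hre him
        refine Prod.ext ?_ (Prod.ext ?_ ?_)
        · simp only [hre]; ring
        · simp only [him]; ring
        · simp only; ring
  · intro u hu
    obtain ⟨h1, h2, h3, h4, h5⟩ := catMap_spec n m hu
    have hr0 : 0 < A.t (j + 1) * cosh (u 1) := mul_pos ht (cosh_pos _)
    ext i
    fin_cases i
    · change √2 * angleNear (θ / √2) (A.relPos j n m (Phi (A.catMap j n m u))) = u 0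
      rw [h4, angleNear_polarPt hr0 (hang _ hu.1)]
      field_simp
    · change sg j * (((lift (A.axis j n m) (Phi (A.catMap j n m u))).2.2 - A.K (j + 1)) /
        A.t (j + 1)) = u 1
      rw [h2]
      simp only [catMap, add_sub_cancel_left]
      rw [mul_div_cancel_left₀ _ ht.ne', ← mul_assoc, sg_mul_self, one_mul]

end Stack

namespace Stack

variable {A : Stack}

/-! ### The surface is smooth and orientable -/

/-- The determinant of an endomorphism of the plane in the standard coordinates. -/
theorem det_eq (B : Plane →L[ℝ] Plane) :
    B.det = B !₂[1, 0] 0 * B !₂[0, 1] 1 - B !₂[0, 1] 0 * B !₂[1, 0] 1 := by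
  have h := LinearMap.det_toMatrix (EuclideanSpace.basisFun (Fin 2) ℝ).toBasis (B : Plane →ₗ[ℝ] Plane)
  have e0 : EuclideanSpace.basisFun (Fin 2) ℝ 0 = !₂[1, 0] := by
    ext i; fin_cases i <;> simp
  have e1 : EuclideanSpace.basisFun (Fin 2) ℝ 1 = !₂[0, 1] := by
    ext i; fin_cases i <;> simp
  rw [ContinuousLinearMap.det, ← h, Matrix.det_fin_two]
  simp only [LinearMap.toMatrix_apply, OrthonormalBasis.coe_toBasis, e0, e1,
    OrthonormalBasis.coe_toBasis_repr_apply, EuclideanSpace.basisFun_repr]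
  rfl

/-- The Jacobian determinant from the partial derivatives. -/
theorem det_fderiv {F : Plane → Plane} {u : Plane} (hF : DifferentiableAt ℝ F u)
    {a b c d : ℝ} (ha : HasDerivAt (fun s : ℝ => F (u + s • !₂[1, 0]) 0) a 0)
    (hb : HasDerivAt (fun s : ℝ => F (u + s • !₂[0, 1]) 0) b 0)
    (hc : HasDerivAt (fun s : ℝ => F (u + s • !₂[1, 0]) 1) c 0)
    (hd : HasDerivAt (fun s : ℝ => F (u + s • !₂[0, 1]) 1) d 0) :
    (fderiv ℝ F u).det = a * d - b * c := by
  have key : ∀ (v : Plane) (i : Fin 2),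
      HasDerivAt (fun s : ℝ => F (u + s • v) i) (fderiv ℝ F u v i) 0 := by
    intro v i
    have h1 : HasDerivAt (fun s : ℝ => u + s • v) v 0 := by
      simpa using ((hasDerivAt_id (0 : ℝ)).smul_const v).const_add u
    have h2 : HasFDerivAt F (fderiv ℝ F u) (u + (0 : ℝ) • v) := by
      simpa using hF.hasFDerivAt
    have h3 := h2.comp_hasDerivAt (0 : ℝ) h1
    exact ((EuclideanSpace.proj (𝕜 := ℝ) i).hasFDerivAt.comp_hasDerivAt (0 : ℝ) h3 :)
  rw [det_eq, (key _ 0).unique ha, (key _ 1).unique hd, (key _ 0).unique hb, (key _ 1).unique hc]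

theorem plane_ext {u v : Plane} (h0 : u 0 = v 0) (h1 : u 1 = v 1) : u = v := by
  ext i
  fin_cases i
  · exact h0
  · exact h1

theorem fderiv_eq_of_periodic {f : Plane → E} {u v w : Plane} (h : ∀ x, f (x + w) = f x)
    (hu : u = v + w) : fderiv ℝ f u = fderiv ℝ f v := by
  have : (fun x => f (x + w)) = f := funext h
  rw [hu, ← fderiv_comp_add_right, this]

/-- Two charts on the levels differ by a period. -/
theorem graph_graph {i j : ℕ} (hi : i < A.N) (hj : j < A.N) {b b' : ℝ × ℝ} {u v : Plane}
    (hu : u ∈ A.graphDom i b) (hv : v ∈ A.graphDom j b')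
    (h : Phi (A.graphMap i u) = Phi (A.graphMap j v)) :
    fderiv ℝ (Phi ∘ A.graphMap i) u = fderiv ℝ (Phi ∘ A.graphMap j) v := by
  have hu' := hgt_mem hi hu.2.2
  have hv' := hgt_mem hj hv.2.2
  obtain ⟨h1, ⟨n, hn⟩, m, hm⟩ := (Phi_eq_iff (abs_lt_of_mem_Ioo hi hu')
    (abs_lt_of_mem_Ioo hj hv')).1 h
  have hij : i = j := by
    have h1' : A.hgt i (u 0, sg i * u 1) = A.hgt j (v 0, sg j * v 1) := h1
    rw [h1'] at hu'
    rcases lt_trichotomy i j with h | h | h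
    · linarith [A.K_mono (i := i + 1) h hj.le, hu'.2, hv'.1]
    · exact h
    · linarith [A.K_mono (i := j + 1) h hi.le, hu'.1, hv'.2]
  subst hij
  have hs : ∀ x y : ℝ, sg i * (x + sg i * y) = sg i * x + y := by
    intro x y
    linear_combination y * sg_mul_self i
  refine fderiv_eq_of_periodic (w := !₂[n * per, sg i * (m * per)]) ?_ ?_
  · intro x
    simp only [Function.comp_apply, graphMap, PiLp.add_apply,
      Matrix.cons_val_zero, Matrix.cons_val_one, Matrix.cons_val_fin_one, hs]
    rw [hgt_add_per, Phi_add_period]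
  · refine plane_ext hn ?_
    have hm' : sg i * u 1 = sg i * v 1 + m * per := hm
    change u 1 = v 1 + sg i * (m * per)
    linear_combination sg i * hm' + (v 1 - u 1) * sg_mul_self i

/-- Two charts across the waists of the same neck differ by a full turn. -/
theorem cat_cat {i j : ℕ} {hi : i + 1 < A.N} {hj : j + 1 < A.N} {n m n' m' : ℤ} {θ θ' : ℝ}
    {u v : Plane} (hu : u ∈ A.catDom i hi θ) (hv : v ∈ A.catDom j hj θ')
    (h : Phi (A.catMap i n m u) = Phi (A.catMap j n' m' v)) (hij : i = j) :
    fderiv ℝ (Phi ∘ A.catMap i n m) u = fderiv ℝ (Phi ∘ A.catMap j n' m') v := by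
  subst hij
  have ht : 0 < A.t (i + 1) := A.t_pos (i + 1) (by omega) hi
  obtain ⟨l1, -, -, -, r1⟩ := catMap_spec n m hu
  obtain ⟨l2, -, -, -, r2⟩ := catMap_spec n' m' hv
  obtain ⟨h1, ⟨a, ha⟩, b, hb⟩ := (Phi_eq_iff (abs_lt_of_mem_lifted l1)
    (abs_lt_of_mem_lifted l2)).1 h
  have huv : u 1 = v 1 := by
    have h2 : A.K (i + 1) + A.t (i + 1) * (sg i * u 1) = A.K (i + 1) + A.t (i + 1) * (sg i * v 1) :=
      h1
    have h3 := mul_left_cancel₀ ht.ne' (add_left_cancel h2)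
    linear_combination sg i * h3 + (v 1 - u 1) * sg_mul_self i
  set r := A.t (i + 1) * cosh (u 1) with hr
  have hr0 : 0 < r := mul_pos ht (cosh_pos _)
  have hra : r = A.t (i + 1) * cosh (v 1) := by rw [hr, huv]
  have ha' : i * A.X + n * (2 * A.X) + r * cos (u 0) =
      i * A.X + n' * (2 * A.X) + r * cos (v 0) + a * (A.p * (2 * A.X)) := by
    rw [← A.per_eq_X]
    simpa only [catMap, axis, ← huv, ← hr] using ha
  have hb' : i * A.Y + m * (2 * A.Y) + r * sin (u 0) =
      i * A.Y + m' * (2 * A.Y) + r * sin (v 0) + b * (A.q * (2 * A.Y)) := by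
    rw [← A.per_eq_Y]
    simpa only [catMap, axis, ← huv, ← hr] using hb
  have hX := A.X_pos
  have hY := A.Y_pos
  -- The waists are small compared to the distance of the axes, so that the axes agree modulo the
  -- period of `Φ`.
  have key : ∀ (X : ℝ) (k : ℤ) (c c' : ℝ), 0 < X → r < X / 2 → |c| ≤ 1 → |c'| ≤ 1 →
      k * (2 * X) = r * c - r * c' → k = 0 := by
    intro X k c c' hX hrX hc hc' he
    have h5 : |(k : ℝ)| * (2 * X) < 1 * (2 * X) := by
      rw [← abs_of_pos (show 0 < 2 * X by linarith), ← abs_mul, he,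
        abs_of_pos (show 0 < 2 * X by linarith), ← mul_sub, abs_mul, abs_of_pos hr0]
      have : |c - c'| ≤ 2 := (abs_sub _ _).trans (by linarith)
      nlinarith
    have h6 : |(k : ℝ)| < 1 := lt_of_mul_lt_mul_right h5 (by linarith)
    exact Int.abs_lt_one_iff.1 (by exact_mod_cast h6)
  have e1 := key A.X (n - n' - a * A.p) (cos (v 0)) (cos (u 0)) hX (r1.trans A.r₀_lt_X)
    (abs_cos_le_one _) (abs_cos_le_one _) (by push_cast; linear_combination ha')
  have e2 := key A.Y (m - m' - b * A.q) (sin (v 0)) (sin (u 0)) hY (r1.trans A.r₀_lt_Y)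
    (abs_sin_le_one _) (abs_sin_le_one _) (by push_cast; linear_combination hb')
  have e1' : (n : ℝ) - n' - a * A.p = 0 := by exact_mod_cast e1
  have e2' : (m : ℝ) - m' - b * A.q = 0 := by exact_mod_cast e2
  have hcos : cos (u 0) = cos (v 0) := by
    apply mul_left_cancel₀ hr0.ne'
    linear_combination ha' - 2 * A.X * e1'
  have hsin : sin (u 0) = sin (v 0) := by
    apply mul_left_cancel₀ hr0.ne'
    linear_combination hb' - 2 * A.Y * e2'
  have hfun : Phi ∘ A.catMap i n m = Phi ∘ A.catMap i n' m' := by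
    funext x
    have : A.catMap i n m x = ((A.catMap i n' m' x).1 + a * per,
        (A.catMap i n' m' x).2.1 + b * per, (A.catMap i n' m' x).2.2) := by
      refine Prod.ext ?_ (Prod.ext ?_ rfl)
      · simp only [catMap, axis]
        rw [A.per_eq_X]
        linear_combination 2 * A.X * e1'
      · simp only [catMap, axis]
        rw [A.per_eq_Y]
        linear_combination 2 * A.Y * e2'
    rw [Function.comp_apply, this, Phi_add_period]
    rfl
  obtain ⟨k, hk⟩ := Real.Angle.angle_eq_iff_two_pi_dvd_sub.1 (Real.Angle.cos_sin_inj hcos hsin)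
  rw [hfun]
  refine fderiv_eq_of_periodic (w := !₂[k * (2 * π), 0]) ?_ ?_
  · intro x
    simp only [Function.comp_apply, catMap, PiLp.add_apply,
      Matrix.cons_val_zero, Matrix.cons_val_one, Matrix.cons_val_fin_one, cos_add_int_mul_two_pi,
      sin_add_int_mul_two_pi, add_zero]
  · refine plane_ext ?_ ?_
    · change u 0 = v 0 + k * (2 * π)
      linear_combination hk
    · change u 1 = v 1 + 0
      rw [huv, add_zero]

/-- The charts on the levels and those across the waists are oriented in the same way: the
Jacobian of the horizontal projection of the catenoid has opposite signs above and below the waist,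
and so have the orientations of consecutive levels. -/
theorem cat_graph {i j : ℕ} {hi : i + 1 < A.N} (hj : j < A.N) {n m : ℤ} {θ : ℝ} {b : ℝ × ℝ}
    {u v : Plane} (hu : u ∈ A.catDom i hi θ) (hv : v ∈ A.graphDom j b)
    (h : Phi (A.catMap i n m u) = Phi (A.graphMap j v)) :
    0 < (fderiv ℝ (graphInv j b ∘ (Phi ∘ A.catMap i n m)) u).det := by
  have ht : 0 < A.t (i + 1) := A.t_pos (i + 1) (by omega) hi
  obtain ⟨l1, -, -, -, r1⟩ := catMap_spec n m hu
  obtain ⟨-, hε1, hε2, -⟩ := (exists_catenoid (A := A) hi).choose_spec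
  have hz := hgt_mem hj hv.2.2
  have habs := abs_lt_of_mem_Ioo hj hz
  have h1 : A.K (i + 1) + A.t (i + 1) * (sg i * u 1) = A.hgt j (v 0, sg j * v 1) :=
    ((Phi_eq_iff (abs_lt_of_mem_lifted l1) habs).1 h).1
  rw [← h1] at hz
  have hsmall : |A.t (i + 1) * (sg i * u 1)| < A.eps i hi := by
    rw [abs_mul, abs_sg_mul, abs_of_pos ht]
    exact hu.2
  have hsm := abs_lt.1 hsmall
  change A.eps i hi ≤ _ at hε1 hε2
  -- `sg i * u 1` is the signed height above the waist.
  have hsign : sg j * sinh (u 1) < 0 := by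
    have hji : j = i ∨ j = i + 1 := by
      by_contra hcon
      rcases lt_or_ge j i with h2 | h2
      · linarith [A.K_mono (i := j + 1) h2 (by omega), hz.2]
      · have h5 : i + 2 ≤ j := by omega
        linarith [A.K_mono h5 hj.le, hz.1]
    have hs := sg_mul_self i
    rcases hji with rfl | rfl
    · have h2 : sg j * u 1 < 0 := by
        by_contra hcon
        nlinarith [mul_nonneg ht.le (not_lt.1 hcon), hz.2]
      rcases lt_trichotomy (sinh (u 1)) 0 with h3 | h3 | h3
      · have := sinh_neg_iff.1 h3
        have : 0 < sg j := by nlinarith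
        nlinarith
      · have := sinh_eq_zero.1 h3
        rw [this] at h2
        simp at h2
      · have := sinh_pos_iff.1 h3
        have : sg j < 0 := by nlinarith
        nlinarith
    · have h2 : 0 < sg i * u 1 := by
        by_contra hcon
        nlinarith [mul_nonneg ht.le (neg_nonneg.2 (not_lt.1 hcon)), hz.1]
      rw [sg_succ]
      rcases lt_trichotomy (sinh (u 1)) 0 with h3 | h3 | h3
      · have := sinh_neg_iff.1 h3
        have : sg i < 0 := by nlinarith
        nlinarith
      · have := sinh_eq_zero.1 h3
        rw [this] at h2
        simp at h2
      · have := sinh_pos_iff.1 h3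
        have : 0 < sg i := by nlinarith
        nlinarith
  have hO : Phi (A.catMap i n m u) ∈ liftDom b := by
    rw [h]
    exact ((isChart_graph hj b).mem_range hv).2.1
  have hcont : ContinuousAt (A.catMap i n m) u := by
    have hc0 := contDiff_coord.1.continuous
    have hc1 := contDiff_coord.2.continuous
    refine ContinuousAt.prodMk ?_ (ContinuousAt.prodMk ?_ ?_)
    · exact (continuous_const.add ((continuous_const.mul (continuous_cosh.comp hc1)).mul
        (continuous_cos.comp hc0))).continuousAt
    · exact (continuous_const.add ((continuous_const.mul (continuous_cosh.comp hc1)).mul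
        (continuous_sin.comp hc0))).continuousAt
    · exact (continuous_const.add (continuous_const.mul (continuous_const.mul hc1))).continuousAt
  have hslab : ∀ᶠ w in 𝓝 u, |(A.catMap i n m w).2.2| < π / 4 := by
    have h2 : ContinuousAt (fun w => |(A.catMap i n m w).2.2|) u := hcont.snd.snd.abs
    exact h2.eventually_lt continuousAt_const (abs_lt_of_mem_lifted l1)
  obtain ⟨c, d, hcd⟩ := lift_Phi_eventually b hcont hslab hO
  set F : Plane → Plane := fun w => !₂[(A.catMap i n m w).1 + c, sg j * ((A.catMap i n m w).2.1 + d)]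
    with hF
  have hev : graphInv j b ∘ (Phi ∘ A.catMap i n m) =ᶠ[𝓝 u] F := by
    filter_upwards [hcd] with w hw
    simp only [Function.comp_apply, graphInv, hF, hw.1, hw.2]
  have hdiff : DifferentiableAt ℝ F u := by
    refine DifferentiableAt.congr_of_eventuallyEq ?_ hev.symm
    exact ((isChart_graph hj b).differentiableAt_inv (by
      rw [Function.comp_apply, h]; exact ((isChart_graph hj b).mem_range hv).2)).comp u
      ((isChart_cat hi n m θ).differentiableAt hu)
  rw [hev.fderiv_eq]
  set τ := A.t (i + 1)
  have hs0 : HasDerivAt (fun s : ℝ => u 0 + s) 1 0 := (hasDerivAt_id (0 : ℝ)).const_add _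
  have hs1 : HasDerivAt (fun s : ℝ => u 1 + s) 1 0 := (hasDerivAt_id (0 : ℝ)).const_add _
  have d1 : HasDerivAt (fun s : ℝ => cos (u 0 + s)) (-sin (u 0)) 0 := by
    simpa using hs0.cos
  have d2 : HasDerivAt (fun s : ℝ => sin (u 0 + s)) (cos (u 0)) 0 := by
    simpa using hs0.sin
  have d3 : HasDerivAt (fun s : ℝ => cosh (u 1 + s)) (sinh (u 1)) 0 := by
    simpa using hs1.cosh
  have key := det_fderiv (F := F) (u := u) (a := τ * cosh (u 1) * -sin (u 0))
    (b := τ * sinh (u 1) * cos (u 0)) (c := sg j * (τ * cosh (u 1) * cos (u 0)))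
    (d := sg j * (τ * sinh (u 1) * sin (u 0))) hdiff ?_ ?_ ?_ ?_
  · rw [key]
    have e : τ * cosh (u 1) * -sin (u 0) * (sg j * (τ * sinh (u 1) * sin (u 0))) -
        τ * sinh (u 1) * cos (u 0) * (sg j * (τ * cosh (u 1) * cos (u 0))) =
        τ ^ 2 * cosh (u 1) * -(sg j * sinh (u 1)) := by
      linear_combination -τ ^ 2 * cosh (u 1) * sg j * sinh (u 1) * sin_sq_add_cos_sq (u 0)
    rw [e]
    exact mul_pos (mul_pos (pow_pos ht 2) (cosh_pos _)) (by linarith)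
  · have : (fun s : ℝ => F (u + s • !₂[1, 0]) 0) = fun s =>
        (A.axis i n m).1 + τ * cosh (u 1) * cos (u 0 + s) + c := by
      funext s
      simp [hF, catMap, τ]
    rw [this]
    exact ((d1.const_mul _).const_add _).add_const _
  · have : (fun s : ℝ => F (u + s • !₂[0, 1]) 0) = fun s =>
        (A.axis i n m).1 + τ * cosh (u 1 + s) * cos (u 0) + c := by
      funext s
      simp [hF, catMap, τ]
    rw [this]
    exact (((d3.const_mul _).mul_const _).const_add _).add_const _
  · have : (fun s : ℝ => F (u + s • !₂[1, 0]) 1) = fun s =>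
        sg j * ((A.axis i n m).2 + τ * cosh (u 1) * sin (u 0 + s) + d) := by
      funext s
      simp [hF, catMap, τ]
    rw [this]
    exact (((d2.const_mul _).const_add _).add_const _).const_mul _
  · have : (fun s : ℝ => F (u + s • !₂[0, 1]) 1) = fun s =>
        sg j * ((A.axis i n m).2 + τ * cosh (u 1 + s) * sin (u 0) + d) := by
      funext s
      simp [hF, catMap, τ]
    rw [this]
    exact ((((d3.const_mul _).mul_const _).const_add _).add_const _).const_mul _

variable (A) in
/-- The indices of the charts: those on the levels and those across the waists. -/
abbrev ChartIndex : Type := ({j // j < A.N} × (ℝ × ℝ)) ⊕ ({j // j + 1 < A.N} × (ℤ × ℤ) × ℝ)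

variable (A) in
/-- The domains of the charts. -/
noncomputable def chartDom : A.ChartIndex → Set Plane
  | .inl i => A.graphDom i.1 i.2
  | .inr i => A.catDom i.1 i.1.2 i.2.2

variable (A) in
/-- The local parametrizations of the surface. -/
noncomputable def chartMap : A.ChartIndex → Plane → E
  | .inl i => Phi ∘ A.graphMap i.1
  | .inr i => Phi ∘ A.catMap i.1 i.2.1.1 i.2.1.2

variable (A) in
/-- The left inverses of the local parametrizations. -/
noncomputable def chartInv : A.ChartIndex → E → Plane
  | .inl i => graphInv i.1 i.2
  | .inr i => A.catInv i.1 i.2.1.1 i.2.1.2 i.2.2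

variable (A) in
/-- The open sets in which the charts parametrize the surface. -/
def chartRange : A.ChartIndex → Set E
  | .inl i => A.graphRange i.1 i.2
  | .inr i => A.catRange i.1 i.1.2 i.2.1.1 i.2.1.2 i.2.2

variable (A) in
theorem isChart : ∀ i : A.ChartIndex,
    IsChart A.surf (A.chartDom i) (A.chartMap i) (A.chartInv i) (A.chartRange i)
  | .inl i => isChart_graph i.1.2 i.2
  | .inr i => isChart_cat i.1.2 i.2.1.1 i.2.1.2 i.2.2

theorem waist_covered {j : ℕ} (hj : j + 1 < A.N) {x y : ℝ}
    (h : A.t (j + 1) = A.rho (j + 1) (x, y)) :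
    ∃ i, Phi (x, y, A.K (j + 1)) ∈ A.chartMap i '' A.chartDom i := by
  have ht : 0 < A.t (j + 1) := A.t_pos (j + 1) (by omega) hj
  obtain ⟨hε, -⟩ := (exists_catenoid (A := A) hj).choose_spec
  obtain ⟨n, m, hn, hm⟩ := exists_center (A := A) (j + 1) x y
  have e : ((j + 1 : ℕ) : ℝ) - 1 = j := by push_cast; ring
  rw [e] at hn hm
  rw [rho_axis (n := n) (m := m) hn hm, ← norm_mk] at h
  set ζ : ℂ := ⟨x - (A.axis j n m).1, y - (A.axis j n m).2⟩ with hζ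
  have hpol := polarPt_angleNear 0 ζ
  set θ := √2 * angleNear 0 ζ with hθ
  have hθ' : θ / √2 = angleNear 0 ζ := by rw [hθ]; field_simp
  rw [← hθ', polarPt_angle, ← h] at hpol
  have hre : A.t (j + 1) * cos θ = x - (A.axis j n m).1 := congrArg Complex.re hpol
  have him : A.t (j + 1) * sin θ = y - (A.axis j n m).2 := congrArg Complex.im hpol
  refine ⟨.inr (⟨j, hj⟩, (n, m), θ), !₂[θ, 0], ⟨?_, ?_⟩, ?_⟩
  · change |θ - θ| < π
    rw [sub_self, abs_zero]
    exact pi_pos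
  · change A.t (j + 1) * |(0 : ℝ)| < A.eps j hj
    rw [abs_zero, mul_zero]
    exact hε
  · change Phi ((A.axis j n m).1 + A.t (j + 1) * cosh 0 * cos θ,
      (A.axis j n m).2 + A.t (j + 1) * cosh 0 * sin θ, A.K (j + 1) + A.t (j + 1) * (sg j * 0)) = _
    rw [cosh_zero, mul_one, hre, him, mul_zero, mul_zero, add_zero, add_sub_cancel, add_sub_cancel]

theorem chart_cover (p : E) (hp : p ∈ A.surf) : ∃ i, p ∈ A.chartMap i '' A.chartDom i := by
  obtain ⟨⟨x, y, z⟩, ⟨j, hj, hd, hz⟩, rfl⟩ := hp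
  simp only at hd hz
  subst hz
  rcases hd.1.eq_or_lt with h | h
  · rw [hgt_of_rho_eq hj h]
    obtain ⟨h0, -⟩ := pos_of_rho_eq hj.le h
    obtain ⟨i, rfl⟩ : ∃ i, j = i + 1 := ⟨j - 1, by omega⟩
    exact waist_covered hj h
  rcases hd.2.eq_or_lt with h' | h'
  · rw [hgt_of_rho_succ_eq hj h']
    obtain ⟨-, h1⟩ := pos_of_rho_eq (j := j + 1) hj h'
    exact waist_covered h1 h'
  have hs : sg j * (sg j * y) = y := by rw [← mul_assoc, sg_mul_self, one_mul]
  refine ⟨.inl (⟨j, hj⟩, (x, y)), !₂[x, sg j * y], ⟨?_, ?_, ?_⟩, ?_⟩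
  · change |x - x| < π / √2
    rw [sub_self, abs_zero]
    positivity
  · change |sg j * (sg j * y) - y| < π / √2
    rw [hs, sub_self, abs_zero]
    positivity
  · change (x, sg j * (sg j * y)) ∈ A.domInt j
    rw [hs]
    exact ⟨h, h'⟩
  · change Phi (x, sg j * (sg j * y), A.hgt j (x, sg j * (sg j * y))) = _
    rw [hs]

variable (A) in
theorem isSmoothSurface : IsSmoothSurface A.surf :=
  isSmoothSurface_of_charts A.isChart chart_cover

/-- The vertical windows of the charts across different waists are disjoint. -/
theorem cat_index_eq {i j : ℕ} {hi : i + 1 < A.N} {hj : j + 1 < A.N} {n m n' m' : ℤ} {θ θ' : ℝ}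
    {u v : Plane} (hu : u ∈ A.catDom i hi θ) (hv : v ∈ A.catDom j hj θ')
    (h : Phi (A.catMap i n m u) = Phi (A.catMap j n' m' v)) : i = j := by
  have key : ∀ {i : ℕ} {hi : i + 1 < A.N} {n m : ℤ} {θ : ℝ} {u : Plane},
      u ∈ A.catDom i hi θ → (A.K i + A.K (i + 1)) / 2 < (A.catMap i n m u).2.2 ∧
        (A.catMap i n m u).2.2 < (A.K (i + 1) + A.K (i + 2)) / 2 := by
    intro i hi n m θ u hu
    have ht : 0 < A.t (i + 1) := A.t_pos (i + 1) (by omega) hi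
    obtain ⟨-, hε1, hε2, -⟩ := (exists_catenoid (A := A) hi).choose_spec
    have h1 : |A.t (i + 1) * (sg i * u 1)| < A.eps i hi := by
      rw [abs_mul, abs_sg_mul, abs_of_pos ht]
      exact hu.2
    have h2 := abs_lt.1 h1
    change A.eps i hi ≤ _ at hε1 hε2
    simp only [catMap]
    constructor <;> linarith
  obtain ⟨l1, -⟩ := catMap_spec n m hu
  obtain ⟨l2, -⟩ := catMap_spec n' m' hv
  have hz := ((Phi_eq_iff (abs_lt_of_mem_lifted l1) (abs_lt_of_mem_lifted l2)).1 h).1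
  have h1 := key (n := n) (m := m) hu
  have h2 := key (n := n') (m := m') hv
  rw [hz] at h1
  rcases lt_trichotomy i j with h | h | h
  · linarith [A.K_mono (i := i + 1) (j := j) h (by omega),
      A.K_mono (i := i + 2) (j := j + 1) (by omega) (by omega)]
  · exact h
  · linarith [A.K_mono (i := j + 1) (j := i) h (by omega),
      A.K_mono (i := j + 2) (j := i + 1) (by omega) (by omega)]

variable (A) in
theorem isOrientable : IsOrientable A.surf := by
  refine isOrientable_of_charts A.isChart chart_cover ?_
  rintro (i | i) (j | j) u hu v hv h
  · exact Or.inl (graph_graph i.1.2 j.1.2 hu hv h)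
  · exact Or.inr (Or.inr (cat_graph i.1.2 hv hu h.symm))
  · exact Or.inr (Or.inl (cat_graph j.1.2 hu hv h))
  · exact Or.inl (cat_cat hu hv h (cat_index_eq hu hv h))

end Stack

/-- A set with a finite cell decomposition is a finite union of compact closed cells. -/
theorem HasGenus.isCompact {S : Set E} {g : ℕ} (h : HasGenus S g) : IsCompact S := by
  obtain ⟨K, hfin, hempty, -⟩ := h
  have h1 : (⋃ n : Fin 3, ⋃ i : K.cell n, K.map n i '' Metric.closedBall 0 1) = S := by
    refine Eq.trans ?_ K.union'
    ext p
    simp only [mem_iUnion]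
    constructor
    · rintro ⟨n, i, hp⟩
      exact ⟨n, i, hp⟩
    · rintro ⟨n, i, hp⟩
      have hn : n < 3 := by
        by_contra hn
        exact (hempty n (by omega)).false i
      exact ⟨⟨n, hn⟩, i, hp⟩
  rw [← h1]
  refine isCompact_iUnion fun n => ?_
  have := hfin n
  exact isCompact_iUnion fun i =>
    (isCompact_closedBall 0 1).image_of_continuousOn (K.continuousOn n i)

namespace Stack

variable {A : Stack}

/-! ### Diamonds around the axes -/

variable (A) in
/-- The point at height `z` over the position `a`, in units of `X` and `Y`, relative to an axis with
the coordinates `σ` modulo `2`. -/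
noncomputable def pt (σ : ℤ) (c : ℤ × ℤ) (a : ℝ × ℝ) (z : ℝ) : ℝ × ℝ × ℝ :=
  ((σ + 2 * c.1 + a.1) * A.X, (σ + 2 * c.2 + a.2) * A.Y, z)

variable (A) in
/-- The Euclidean length of `(X a, Y b)`. -/
noncomputable def len (a : ℝ × ℝ) : ℝ := √((A.X * a.1) ^ 2 + (A.Y * a.2) ^ 2)

/-- The `ℓ¹`-norm in the plane; its balls are the diamonds. -/
def taxi (a : ℝ × ℝ) : ℝ := |a.1| + |a.2|

theorem len_smul {l : ℝ} (hl : 0 ≤ l) (a : ℝ × ℝ) : A.len (l • a) = l * A.len a := by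
  unfold len
  have : (A.X * (l • a).1) ^ 2 + (A.Y * (l • a).2) ^ 2 =
      l ^ 2 * ((A.X * a.1) ^ 2 + (A.Y * a.2) ^ 2) := by
    simp only [Prod.smul_fst, Prod.smul_snd, smul_eq_mul]
    ring
  rw [this, sqrt_mul (sq_nonneg l), sqrt_sq hl]

theorem taxi_smul {l : ℝ} (hl : 0 ≤ l) (a : ℝ × ℝ) : taxi (l • a) = l * taxi a := by
  simp only [taxi, Prod.smul_fst, Prod.smul_snd, smul_eq_mul, abs_mul, abs_of_nonneg hl]
  ring

theorem r₀_lt_len {a : ℝ × ℝ} (ha : 1 ≤ taxi a) : A.r₀ < A.len a := by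
  have hX := A.r₀_lt_X
  have hY := A.r₀_lt_Y
  have hX0 := A.X_pos
  have hY0 := A.Y_pos
  have h := abs_le_sqrt_sq_add_sq (A.X * a.1) (A.Y * a.2)
  rw [abs_mul, abs_mul, abs_of_pos hX0, abs_of_pos hY0] at h
  change _ ≤ A.len a ∧ _ ≤ A.len a at h
  unfold taxi at ha
  rcases le_total (1 / 2) |a.1| with h1 | h1
  · nlinarith
  · nlinarith

theorem rho_pt {ν : ℕ} {σ : ℤ} (hσ : (σ : ℝ) = (ν : ℝ) - 1) {c : ℤ × ℤ} {a : ℝ × ℝ}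
    (ha : taxi a ≤ 1) (z : ℝ) :
    A.rho ν ((A.pt σ c a z).1, (A.pt σ c a z).2.1) = A.len a := by
  have hX0 := A.X_pos
  have hY0 := A.Y_pos
  have e1 : (A.pt σ c a z).1 - (((ν : ℝ) - 1) * A.X + c.1 * (2 * A.X)) = A.X * a.1 := by
    simp only [pt, ← hσ]; ring
  have e2 : (A.pt σ c a z).2.1 - (((ν : ℝ) - 1) * A.Y + c.2 * (2 * A.Y)) = A.Y * a.2 := by
    simp only [pt, ← hσ]; ring
  have h1 : |a.1| ≤ 1 := by unfold taxi at ha; linarith [abs_nonneg a.2]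
  have h2 : |a.2| ≤ 1 := by unfold taxi at ha; linarith [abs_nonneg a.1]
  rw [rho_eq_of_near c.1 c.2, e1, e2, len]
  · rw [e1, abs_mul, abs_of_pos hX0]
    nlinarith
  · rw [e2, abs_mul, abs_of_pos hY0]
    nlinarith

theorem fold_pt {ν : ℕ} {σ : ℤ} (hσ : (σ : ℝ) = (ν : ℝ) - 1) {c : ℤ × ℤ} {a : ℝ × ℝ}
    (ha : taxi a ≤ 1) (z : ℝ) :
    fold A.X ((A.pt σ c a z).1 - ((ν : ℝ) - 1) * A.X) ≤ A.X / 2 ∨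
      fold A.Y ((A.pt σ c a z).2.1 - ((ν : ℝ) - 1) * A.Y) ≤ A.Y / 2 := by
  have hX0 := A.X_pos
  have hY0 := A.Y_pos
  have h1 : |a.1| ≤ 1 := by unfold taxi at ha; linarith [abs_nonneg a.2]
  have h2 : |a.2| ≤ 1 := by unfold taxi at ha; linarith [abs_nonneg a.1]
  have key : ∀ (X a : ℝ) (n : ℤ), 0 < X → |a| ≤ 1 →
      fold X ((σ + 2 * n + a) * X - ((ν : ℝ) - 1) * X) = |a| * X := by
    intro X a n hX ha
    have e : (σ + 2 * n + a) * X - ((ν : ℝ) - 1) * X = a * X + n * (2 * X) := by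
      rw [← hσ]; ring
    rw [e, fold_add_int, fold_eq_abs hX, abs_mul, abs_of_pos hX]
    rw [abs_mul, abs_of_pos hX]
    nlinarith
  simp only [pt]
  rw [key _ _ _ hX0 h1, key _ _ _ hY0 h2]
  unfold taxi at ha
  rcases le_total |a.1| (1 / 2) with h | h
  · left; nlinarith
  · right; nlinarith

theorem lt_rho_pt_succ {ν : ℕ} {σ : ℤ} (hσ : (σ : ℝ) = (ν : ℝ) - 1) {c : ℤ × ℤ} {a : ℝ × ℝ}
    (ha : taxi a ≤ 1) (z : ℝ) : A.r₀ < A.rho (ν + 1) ((A.pt σ c a z).1, (A.pt σ c a z).2.1) :=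
  A.lt_rho_succ_of_fold (fold_pt hσ ha z)

/-- The part of level `j` in the diamonds around the axes of neck `j + 1`. -/
theorem hgt_pt_dn {j : ℕ} (hj : j < A.N) {c : ℤ × ℤ} {a : ℝ × ℝ} (ha : taxi a ≤ 1) (z : ℝ) :
    A.hgt j ((A.pt j c a z).1, (A.pt j c a z).2.1) = A.dn j (A.len a) ∧
    A.r₀ < A.rho j ((A.pt j c a z).1, (A.pt j c a z).2.1) := by
  have hσ : (((j : ℕ) : ℤ) : ℝ) = ((j + 1 : ℕ) : ℝ) - 1 := by push_cast; ring
  have h1 := lt_rho_pt_succ (A := A) hσ (c := c) ha z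
  rw [rho_add_two] at h1
  refine ⟨?_, h1⟩
  rw [hgt_eq_dn hj (A.r₁_lt.trans h1).le, rho_pt hσ ha]

/-- The part of level `j` in the diamonds around the axes of neck `j`. -/
theorem hgt_pt_up {j : ℕ} (hj : j < A.N) {c : ℤ × ℤ} {a : ℝ × ℝ} (ha : taxi a ≤ 1) (z : ℝ) :
    A.hgt j ((A.pt (j - 1) c a z).1, (A.pt (j - 1) c a z).2.1) = A.up j (A.len a) ∧
    A.r₀ < A.rho (j + 1) ((A.pt (j - 1) c a z).1, (A.pt (j - 1) c a z).2.1) := by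
  have hσ : (((j : ℤ) - 1 : ℤ) : ℝ) = (j : ℝ) - 1 := by push_cast; ring
  have h1 := lt_rho_pt_succ (A := A) hσ (c := c) ha z
  refine ⟨?_, h1⟩
  rw [hgt_eq_up hj (A.r₁_lt.trans h1).le, rho_pt hσ ha]

theorem pt_dn_mem {j : ℕ} (hj : j < A.N) {c : ℤ × ℤ} {a : ℝ × ℝ} (ha : taxi a ≤ 1)
    (ht : A.t (j + 1) ≤ A.len a) {z : ℝ} (hz : z = A.dn j (A.len a)) :
    A.pt j c a z ∈ A.lifted := by
  have hσ : (((j : ℕ) : ℤ) : ℝ) = ((j + 1 : ℕ) : ℝ) - 1 := by push_cast; ring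
  have h := hgt_pt_dn hj (c := c) ha z
  refine ⟨j, hj, ⟨?_, ?_⟩, ?_⟩
  · linarith [A.t_lt j hj.le, A.r₁_lt]
  · rwa [rho_pt hσ ha]
  · rw [h.1]; exact hz

theorem pt_up_mem {j : ℕ} (hj : j < A.N) {c : ℤ × ℤ} {a : ℝ × ℝ} (ha : taxi a ≤ 1)
    (ht : A.t j ≤ A.len a) {z : ℝ} (hz : z = A.up j (A.len a)) :
    A.pt (j - 1) c a z ∈ A.lifted := by
  have hσ : (((j : ℤ) - 1 : ℤ) : ℝ) = (j : ℝ) - 1 := by push_cast; ring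
  have h := hgt_pt_up hj (c := c) ha z
  refine ⟨j, hj, ⟨?_, ?_⟩, ?_⟩
  · rwa [rho_pt hσ ha]
  · linarith [A.t_lt (j + 1) hj, A.r₁_lt]
  · rw [h.1]; exact hz

/-- The corners of the diamond. -/
def corner : Fin 4 → ℝ × ℝ := ![(1, 0), (0, 1), (-1, 0), (0, -1)]

/-- The sides of the diamond. -/
def side (k : Fin 4) (u : ℝ) : ℝ × ℝ := (1 - u) • corner k + u • corner (k + 1)

theorem side_zero (k : Fin 4) : side k 0 = corner k := by simp [side]

theorem side_one (k : Fin 4) : side k 1 = corner (k + 1) := by simp [side]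

theorem side_cases (u : ℝ) : side 0 u = (1 - u, u) ∧ side 1 u = (-u, 1 - u) ∧
    side 2 u = (-(1 - u), -u) ∧ side 3 u = (u, -(1 - u)) := by
  refine ⟨?_, ?_, ?_, ?_⟩ <;> ext <;> simp [side, corner]

theorem continuous_side (k : Fin 4) : Continuous (side k) := by
  unfold side
  fun_prop

theorem taxi_side (k : Fin 4) {u : ℝ} (hu : u ∈ Icc (0 : ℝ) 1) : taxi (side k u) = 1 := by
  obtain ⟨h0, h1, h2, h3⟩ := side_cases u
  have e1 := abs_of_nonneg hu.1
  have e2 := abs_of_nonneg (sub_nonneg.2 hu.2)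
  fin_cases k <;> simp only [Fin.zero_eta, Fin.mk_one, Fin.reduceFinMk, h0, h1, h2, h3, taxi,
    abs_neg, e1, e2] <;> ring

set_option linter.unnecessarySeqFocus false in
/-- Polar coordinates for the `ℓ¹`-norm: existence. -/
theorem exists_side {a : ℝ × ℝ} (ha : 0 < taxi a) :
    ∃ k, ∃ u ∈ Ico (0 : ℝ) 1, a = taxi a • side k u := by
  obtain ⟨x, y⟩ := a
  unfold taxi at *
  simp only at *
  have key : ∀ (k : Fin 4) (u : ℝ), 0 ≤ u → u < |x| + |y| →
      (|x| + |y|) • side k (u / (|x| + |y|)) = (x, y) →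
      ∃ k, ∃ u ∈ Ico (0 : ℝ) 1, (x, y) = (|x| + |y|) • side k u := by
    intro k u h0 h1 h2
    exact ⟨k, u / (|x| + |y|), ⟨div_nonneg h0 ha.le, (div_lt_one ha).2 h1⟩, h2.symm⟩
  have hs := fun u : ℝ => side_cases (u / (|x| + |y|))
  by_cases hx : 0 < x ∧ 0 ≤ y
  · have e1 := abs_of_pos hx.1
    have e2 := abs_of_nonneg hx.2
    refine key 0 y hx.2 (by linarith) ?_
    rw [(hs y).1]
    ext <;> simp <;> field_simp <;> linarith
  by_cases hx2 : x ≤ 0 ∧ 0 < y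
  · have e1 := abs_of_nonpos hx2.1
    have e2 := abs_of_pos hx2.2
    refine key 1 (-x) (by linarith) (by linarith) ?_
    rw [(hs (-x)).2.1]
    ext <;> simp <;> field_simp <;> linarith
  by_cases hx3 : x < 0 ∧ y ≤ 0
  · have e1 := abs_of_neg hx3.1
    have e2 := abs_of_nonpos hx3.2
    refine key 2 (-y) (by linarith) (by linarith) ?_
    rw [(hs (-y)).2.2.1]
    ext <;> simp <;> field_simp <;> linarith
  · have hxx : 0 ≤ x ∧ y < 0 := by
      constructor
      · by_contra h
        rcases le_or_gt y 0 with h' | h'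
        · exact hx3 ⟨by linarith, h'⟩
        · exact hx2 ⟨by linarith, h'⟩
      · by_contra h
        rcases lt_or_ge 0 x with h' | h'
        · exact hx ⟨h', by linarith⟩
        · rcases (not_lt.1 h).lt_or_eq with h'' | h''
          · exact hx2 ⟨h', h''⟩
          · rcases h'.lt_or_eq with h3 | h3
            · exact hx3 ⟨h3, by linarith⟩
            · rw [h3, ← h''] at ha
              simp at ha
    have e1 := abs_of_nonneg hxx.1
    have e2 := abs_of_neg hxx.2
    refine key 3 x hxx.1 (by linarith) ?_
    rw [(hs x).2.2.2]
    ext <;> simp <;> field_simp <;> linarith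

/-- Polar coordinates for the `ℓ¹`-norm: uniqueness. -/
theorem side_injective {k k' : Fin 4} {u u' : ℝ} (hu : u ∈ Ico (0 : ℝ) 1) (hu' : u' ∈ Ico (0 : ℝ) 1)
    (h : side k u = side k' u') : k = k' ∧ u = u' := by
  obtain ⟨h0, h1, h2, h3⟩ := side_cases u
  obtain ⟨h0', h1', h2', h3'⟩ := side_cases u'
  obtain ⟨a, b⟩ := hu
  obtain ⟨a', b'⟩ := hu'
  fin_cases k <;> fin_cases k' <;> simp only [Fin.zero_eta, Fin.mk_one, Fin.reduceFinMk, h0, h1, h2,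
    h3, h0', h1', h2', h3', Prod.mk.injEq] at h ⊢ <;> obtain ⟨e1, e2⟩ := h <;>
    first
    | exact ⟨trivial, by linarith⟩
    | (exfalso; linarith)

theorem smul_side_injective {k k' : Fin 4} {u u' l l' : ℝ} (hu : u ∈ Ico (0 : ℝ) 1)
    (hu' : u' ∈ Ico (0 : ℝ) 1) (hl : 0 < l) (hl' : 0 < l') (h : l • side k u = l' • side k' u') :
    k = k' ∧ u = u' ∧ l = l' := by
  have h1 := congrArg taxi h
  rw [taxi_smul hl.le, taxi_smul hl'.le, taxi_side k ⟨hu.1, hu.2.le⟩,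
    taxi_side k' ⟨hu'.1, hu'.2.le⟩, mul_one, mul_one] at h1
  subst h1
  obtain ⟨h2, h3⟩ := side_injective hu hu' (smul_right_injective _ hl.ne' h)
  exact ⟨h2, h3, rfl⟩

end Stack

namespace Stack

variable {A : Stack}

/-! ### The blocks of the surface -/

variable (A) in
/-- The distance from the axis of neck `j + 1`, as a function of the parameter `s` that runs along
the neck, from level `j` at `s = -1` through the waist at `s = 0` to level `j + 1` at `s = 1`, in
the direction of the point `side k u` of the boundary of the diamond. -/
noncomputable def rad (j : ℕ) (k : Fin 4) (s u : ℝ) : ℝ :=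
  (1 - |s|) * A.t (j + 1) + |s| * A.len (side k u)

variable (A) in
/-- The height of neck `j + 1`. One of the two summands with `min` and `max` is the height of the
waist. -/
noncomputable def neckHgt (j : ℕ) (k : Fin 4) (s u : ℝ) : ℝ :=
  A.dn j (A.rad j k (min s 0) u) + A.up (j + 1) (A.rad j k (max s 0) u) - A.K (j + 1)

variable (A) in
/-- The neck `j + 1` in the direction of one side of the diamond, parametrized by a square. -/
noncomputable def neckPt (j : ℕ) (c : ℤ × ℤ) (k : Fin 4) (s u : ℝ) : ℝ × ℝ × ℝ :=
  A.pt j c ((A.rad j k s u / A.len (side k u)) • side k u) (A.neckHgt j k s u)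

variable (A) in
/-- The boundaries of the diamonds around the axes of neck `j + 1` at level `j`. -/
noncomputable def linePt (j : ℕ) (c : ℤ × ℤ) (k : Fin 4) (u : ℝ) : ℝ × ℝ × ℝ :=
  A.pt j c (side k u) (A.T j)

theorem r₀_lt_len_side (k : Fin 4) {u : ℝ} (hu : u ∈ Icc (0 : ℝ) 1) : A.r₀ < A.len (side k u) :=
  r₀_lt_len (taxi_side k hu).ge

theorem t_lt_len_side {j : ℕ} (hj : j ≤ A.N) (k : Fin 4) {u : ℝ} (hu : u ∈ Icc (0 : ℝ) 1) :
    A.t j < A.len (side k u) :=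
  (A.t_lt j hj).trans (A.r₁_lt.trans (r₀_lt_len_side k hu))

theorem rad_zero (j : ℕ) (k : Fin 4) (u : ℝ) : A.rad j k 0 u = A.t (j + 1) := by
  simp [rad]

theorem neckHgt_nonpos {j : ℕ} (hj : j + 1 < A.N) (k : Fin 4) {s : ℝ} (hs : s ≤ 0) (u : ℝ) :
    A.neckHgt j k s u = A.dn j (A.rad j k s u) := by
  rw [neckHgt, min_eq_left hs, max_eq_right hs, rad_zero, A.up_waist (j + 1) (by omega) hj]
  ring

theorem neckHgt_nonneg {j : ℕ} (hj : j + 1 < A.N) (k : Fin 4) {s : ℝ} (hs : 0 ≤ s) (u : ℝ) :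
    A.neckHgt j k s u = A.up (j + 1) (A.rad j k s u) := by
  rw [neckHgt, min_eq_right hs, max_eq_left hs, rad_zero, A.dn_waist j hj]
  ring

theorem le_rad {j : ℕ} (hj : j + 1 ≤ A.N) (k : Fin 4) {s u : ℝ} (hs : s ∈ Icc (-1 : ℝ) 1)
    (hu : u ∈ Icc (0 : ℝ) 1) : A.t (j + 1) ≤ A.rad j k s u ∧ A.rad j k s u ≤ A.len (side k u) := by
  have h1 := t_lt_len_side (A := A) hj k hu
  have h2 := abs_le.2 hs
  have h3 := abs_nonneg s
  unfold rad
  constructor <;> nlinarith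

theorem lt_rad {j : ℕ} (hj : j + 1 ≤ A.N) (k : Fin 4) {s u : ℝ} (hs : s ≠ 0)
    (hu : u ∈ Icc (0 : ℝ) 1) : A.t (j + 1) < A.rad j k s u := by
  have h1 := t_lt_len_side (A := A) hj k hu
  have h3 := abs_pos.2 hs
  unfold rad
  nlinarith

theorem rad_lt {j : ℕ} (hj : j + 1 ≤ A.N) (k : Fin 4) {s u : ℝ} (hs : s ∈ Ioo (-1 : ℝ) 1)
    (hu : u ∈ Icc (0 : ℝ) 1) : A.rad j k s u < A.len (side k u) := by
  have h1 := t_lt_len_side (A := A) hj k hu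
  have h2 := abs_lt.2 hs
  unfold rad
  nlinarith

theorem len_scaled {j : ℕ} (hj : j + 1 < A.N) (k : Fin 4) {s u : ℝ} (hs : s ∈ Icc (-1 : ℝ) 1)
    (hu : u ∈ Icc (0 : ℝ) 1) :
    A.len ((A.rad j k s u / A.len (side k u)) • side k u) = A.rad j k s u ∧
      taxi ((A.rad j k s u / A.len (side k u)) • side k u) = A.rad j k s u / A.len (side k u) ∧
      0 < A.rad j k s u / A.len (side k u) ∧ A.rad j k s u / A.len (side k u) ≤ 1 := by
  have h1 := A.r₀_pos.trans (r₀_lt_len_side (A := A) k hu)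
  have h2 := le_rad hj.le k hs hu
  have h3 := A.t_pos (j + 1) (by omega) hj
  have h4 : 0 < A.rad j k s u / A.len (side k u) := div_pos (by linarith) h1
  refine ⟨?_, ?_, h4, (div_le_one h1).2 h2.2⟩
  · rw [len_smul h4.le, div_mul_cancel₀ _ h1.ne']
  · rw [taxi_smul h4.le, taxi_side k hu, mul_one]

theorem neckPt_mem {j : ℕ} (hj : j + 1 < A.N) (c : ℤ × ℤ) (k : Fin 4) {s u : ℝ}
    (hs : s ∈ Icc (-1 : ℝ) 1) (hu : u ∈ Icc (0 : ℝ) 1) : A.neckPt j c k s u ∈ A.lifted := by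
  obtain ⟨h1, h2, -, h4⟩ := len_scaled hj k hs hu
  have h5 := (le_rad hj.le k hs hu).1
  rcases le_total s 0 with h | h
  · exact pt_dn_mem (by omega) (by rw [h2]; exact h4) (by rw [h1]; exact h5)
      (by rw [h1, neckHgt_nonpos hj k h])
  · have e : ((j : ℕ) : ℤ) = ((j + 1 : ℕ) : ℤ) - 1 := by push_cast; ring
    unfold neckPt
    rw [e]
    exact pt_up_mem hj (by rw [h2]; exact h4) (by rw [h1]; exact h5)
      (by rw [h1, neckHgt_nonneg hj k h])

theorem pt_line_mem {j : ℕ} (hj : j < A.N) (c : ℤ × ℤ) {a : ℝ × ℝ} (ha : taxi a = 1) :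
    A.pt j c a (A.T j) ∈ A.lifted := by
  have h := r₀_lt_len (A := A) ha.ge
  exact pt_dn_mem hj ha.le (by linarith [A.t_lt (j + 1) hj, A.r₁_lt])
    (A.dn_far j hj _ (by linarith [A.r₁_lt])).symm

theorem linePt_mem {j : ℕ} (hj : j < A.N) (c : ℤ × ℤ) (k : Fin 4) {u : ℝ}
    (hu : u ∈ Icc (0 : ℝ) 1) : A.linePt j c k u ∈ A.lifted :=
  pt_line_mem hj c (taxi_side k hu)

theorem len_nonneg (a : ℝ × ℝ) : 0 ≤ A.len a := sqrt_nonneg _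

theorem top_mem (c : ℤ × ℤ) {a : ℝ × ℝ} (ha : taxi a ≤ 1) :
    A.pt (A.N - 1) c a (A.T (A.N - 1)) ∈ A.lifted := by
  have hN := A.two_le
  have e : ((A.N : ℕ) : ℤ) - 1 = ((A.N - 1 : ℕ) : ℤ) := by omega
  have e' : A.N - 1 + 1 = A.N := by omega
  rw [e]
  refine pt_dn_mem (by omega) ha ?_ (A.dn_last _).symm
  rw [e']
  linarith [A.t_last, len_nonneg (A := A) a]

theorem bottom_mem (c : ℤ × ℤ) {a : ℝ × ℝ} (ha : taxi a ≤ 1) :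
    A.pt (-1) c a (A.T 0) ∈ A.lifted := by
  have hN := A.two_le
  have h := pt_up_mem (A := A) (j := 0) (c := c) (by omega) ha
    (by linarith [A.t_zero, len_nonneg (A := A) a]) (A.up_zero (A.len a)).symm
  simpa using h

/-- Passing from a point of `[-1, 1]` to its position relative to the nearest odd integer. -/
theorem exists_odd_shift {x : ℝ} (hx : |x| ≤ 1) :
    ∃ (ε : ℤ) (y : ℝ), |y| = 1 - |x| ∧ x + 1 = y + 2 * ε := by
  rcases le_total 0 x with h | h
  · refine ⟨1, x - 1, ?_, by push_cast; ring⟩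
    rw [abs_of_nonneg h] at hx ⊢
    rw [abs_of_nonpos (by linarith)]
    ring
  · refine ⟨0, x + 1, ?_, by push_cast; ring⟩
    rw [abs_of_nonpos h] at hx ⊢
    rw [abs_of_nonneg (by linarith)]
    ring

/-- Moving a point of the boundary of a diamond to a diamond around another axis. -/
theorem exists_line_pt (i σ : ℤ) (c : ℤ × ℤ) {a : ℝ × ℝ} (ha : taxi a = 1) :
    ∃ c' a', taxi a' = 1 ∧ (a.1 = 0 ∨ a.2 = 0 → a'.1 = 0 ∨ a'.2 = 0) ∧
      ∀ z, A.pt σ c a z = A.pt i c' a' z := by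
  rcases Int.even_or_odd' (σ - i) with ⟨d, hd | hd⟩
  · have e : (σ : ℝ) = i + 2 * d := by
      have : σ = i + 2 * d := by omega
      rw [this]; push_cast; ring
    refine ⟨(c.1 + d, c.2 + d), a, ha, id, fun z => ?_⟩
    simp only [pt, e]
    push_cast
    refine Prod.ext ?_ (Prod.ext ?_ rfl) <;> ring
  · have e : (σ : ℝ) = i + 2 * d + 1 := by
      have : σ = i + 2 * d + 1 := by omega
      rw [this]; push_cast; ring
    unfold taxi at ha
    obtain ⟨e1, y1, h1, h1'⟩ := exists_odd_shift (x := a.1) (by linarith [abs_nonneg a.2])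
    obtain ⟨e2, y2, h2, h2'⟩ := exists_odd_shift (x := a.2) (by linarith [abs_nonneg a.1])
    refine ⟨(c.1 + d + e1, c.2 + d + e2), (y1, y2), ?_, ?_, fun z => ?_⟩
    · simp only [taxi]
      linarith
    · rintro (h | h)
      · right
        rw [h, abs_zero] at ha
        exact abs_eq_zero.1 (by linarith)
      · left
        rw [h, abs_zero] at ha
        exact abs_eq_zero.1 (by linarith)
    · simp only [pt, e]
      push_cast
      refine Prod.ext ?_ (Prod.ext ?_ rfl)
      · linear_combination A.X * h1'
      · linear_combination A.Y * h2'

/-- The parameter along the neck of a point over the open diamond. -/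
theorem exists_neck_param {j : ℕ} (hj : j + 1 < A.N) {a : ℝ × ℝ} (ha : taxi a < 1)
    (ht : A.t (j + 1) ≤ A.len a) : ∃ k, ∃ u ∈ Ico (0 : ℝ) 1, ∃ s ∈ Ico (0 : ℝ) 1,
      A.rad j k s u = A.len a ∧ (A.rad j k s u / A.len (side k u)) • side k u = a := by
  have h3 := A.t_pos (j + 1) (by omega) hj
  have ha0 : 0 < taxi a := by
    by_contra hcon
    have h0 : taxi a = 0 := le_antisymm (not_lt.1 hcon) (add_nonneg (abs_nonneg _) (abs_nonneg _))
    have h1 : a.1 = 0 := by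
      unfold taxi at h0
      exact abs_eq_zero.1 (by linarith [abs_nonneg a.1, abs_nonneg a.2])
    have h2 : a.2 = 0 := by
      unfold taxi at h0
      exact abs_eq_zero.1 (by linarith [abs_nonneg a.1, abs_nonneg a.2])
    have : A.len a = 0 := by simp [len, h1, h2]
    linarith
  obtain ⟨k, u, hu, he⟩ := exists_side ha0
  have hu' : u ∈ Icc (0 : ℝ) 1 := ⟨hu.1, hu.2.le⟩
  have hl := t_lt_len_side (A := A) hj.le k hu'
  have hlen : A.len a = taxi a * A.len (side k u) := by
    conv_lhs => rw [he]
    exact len_smul ha0.le _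
  have hlt : A.len a < A.len (side k u) := by
    rw [hlen]
    nlinarith
  have hs : ((A.len a - A.t (j + 1)) / (A.len (side k u) - A.t (j + 1))) ∈ Ico (0 : ℝ) 1 :=
    ⟨div_nonneg (by linarith) (by linarith), (div_lt_one (by linarith)).2 (by linarith)⟩
  have hrad : A.rad j k ((A.len a - A.t (j + 1)) / (A.len (side k u) - A.t (j + 1))) u = A.len a := by
    unfold rad
    rw [abs_of_nonneg hs.1]
    have : A.len (side k u) - A.t (j + 1) ≠ 0 := by linarith
    field_simp
    ring
  refine ⟨k, u, hu, _, hs, hrad, ?_⟩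
  rw [hrad, hlen, mul_div_cancel_right₀ _ (by linarith), ← he]

theorem rad_neg (j : ℕ) (k : Fin 4) (s u : ℝ) : A.rad j k (-s) u = A.rad j k s u := by
  simp [rad]

/-- Every point of the surface lies in one of the blocks. -/
theorem lifted_cases {w : ℝ × ℝ × ℝ} (hw : w ∈ A.lifted) :
    (∃ j, j + 1 < A.N ∧ ∃ c k, ∃ u ∈ Ico (0 : ℝ) 1, ∃ s ∈ Ioo (-1 : ℝ) 1, w = A.neckPt j c k s u) ∨
    (∃ j < A.N, ∃ c k, ∃ u ∈ Ico (0 : ℝ) 1, w = A.linePt j c k u) ∨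
    (∃ c a, taxi a < 1 ∧ w = A.pt (-1) c a (A.T 0)) ∨
    ∃ c a, taxi a < 1 ∧ w = A.pt (A.N - 1) c a (A.T (A.N - 1)) := by
  have hX := A.X_pos
  have hY := A.Y_pos
  have hN := A.two_le
  obtain ⟨x, y, z⟩ := w
  obtain ⟨j, hj, hd, hz⟩ := hw
  simp only at hd hz
  obtain ⟨n, m, hn, hm⟩ := exists_center (A := A) (j + 1) x y
  obtain ⟨a, rfl⟩ : ∃ a, x = (j + 2 * n + a) * A.X := ⟨x / A.X - j - 2 * n, by field_simp; ring⟩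
  obtain ⟨b, rfl⟩ : ∃ b, y = (j + 2 * m + b) * A.Y := ⟨y / A.Y - j - 2 * m, by field_simp; ring⟩
  have ha : |a| ≤ 1 := by
    have e : (j + 2 * n + a) * A.X - (((j + 1 : ℕ) - 1) * A.X + n * (2 * A.X)) = a * A.X := by
      push_cast; ring
    rw [e, abs_mul, abs_of_pos hX] at hn
    nlinarith
  have hb : |b| ≤ 1 := by
    have e : (j + 2 * m + b) * A.Y - (((j + 1 : ℕ) - 1) * A.Y + m * (2 * A.Y)) = b * A.Y := by
      push_cast; ring
    rw [e, abs_mul, abs_of_pos hY] at hm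
    nlinarith
  have hpt : ∀ z, A.pt j (n, m) (a, b) z = ((j + 2 * n + a) * A.X, (j + 2 * m + b) * A.Y, z) := by
    intro z
    simp [pt]
  have hσ : (((j : ℕ) : ℤ) : ℝ) = ((j + 1 : ℕ) : ℝ) - 1 := by push_cast; ring
  rcases lt_trichotomy (taxi (a, b)) 1 with h | h | h
  · -- inside a diamond around the axes of neck `j + 1`
    have h1 := (hgt_pt_dn hj (c := (n, m)) h.le z).1
    have h2 := rho_pt (A := A) hσ (c := (n, m)) h.le z
    rw [hpt] at h1 h2
    simp only at h1 h2
    rw [h1] at hz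
    have h3 := hd.2
    rw [h2] at h3
    by_cases hj1 : j + 1 < A.N
    · left
      obtain ⟨k, u, hu, s, hs, hr, he⟩ := exists_neck_param hj1 h h3
      refine ⟨j, hj1, (n, m), k, u, hu, -s, ⟨by linarith [hs.2], by linarith [hs.1]⟩, ?_⟩
      rw [neckPt, neckHgt_nonpos hj1 k (by linarith [hs.1]), rad_neg, he, hpt, hr, hz]
    · right; right; right
      obtain rfl : j = A.N - 1 := by omega
      refine ⟨(n, m), (a, b), h, ?_⟩
      rw [A.dn_last] at hz
      have e : ((A.N : ℕ) : ℤ) - 1 = ((A.N - 1 : ℕ) : ℤ) := by omega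
      rw [e, hpt, hz]
  · -- on the boundary of a diamond
    right; left
    have h1 := (hgt_pt_dn hj (c := (n, m)) h.le z).1
    rw [hpt] at h1
    simp only at h1
    rw [h1, A.dn_far j hj _ (A.r₁_lt.trans (r₀_lt_len h.ge)).le] at hz
    obtain ⟨k, u, hu, he⟩ := exists_side (a := (a, b)) (by rw [h]; exact one_pos)
    rw [h, one_smul] at he
    exact ⟨j, hj, (n, m), k, u, hu, by rw [linePt, ← he, hpt, hz]⟩
  · -- inside a diamond around the axes of neck `j`
    obtain ⟨e1, a', ha1, ha2⟩ := exists_odd_shift ha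
    obtain ⟨e2, b', hb1, hb2⟩ := exists_odd_shift hb
    have h' : taxi (a', b') < 1 := by
      unfold taxi at h ⊢
      simp only at h ⊢
      linarith
    have hpt' : ∀ z, A.pt (j - 1) (n + e1, m + e2) (a', b') z =
        ((j + 2 * n + a) * A.X, (j + 2 * m + b) * A.Y, z) := by
      intro z
      simp only [pt]
      push_cast
      refine Prod.ext ?_ (Prod.ext ?_ rfl)
      · linear_combination (-A.X) * ha2
      · linear_combination (-A.Y) * hb2
    have hσ' : (((j : ℤ) - 1 : ℤ) : ℝ) = (j : ℝ) - 1 := by push_cast; ring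
    have h1 := (hgt_pt_up hj (c := (n + e1, m + e2)) h'.le z).1
    have h2 := rho_pt (A := A) hσ' (c := (n + e1, m + e2)) h'.le z
    rw [hpt'] at h1 h2
    simp only at h1 h2
    rw [h1] at hz
    have h3 := hd.1
    rw [h2] at h3
    rcases Nat.eq_zero_or_pos j with rfl | hj0
    · right; right; left
      refine ⟨(n + e1, m + e2), (a', b'), h', ?_⟩
      rw [A.up_zero] at hz
      have e : (-1 : ℤ) = ((0 : ℕ) : ℤ) - 1 := by simp
      rw [e, hpt', hz]
    · left
      obtain ⟨i, rfl⟩ : ∃ i, j = i + 1 := ⟨j - 1, by omega⟩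
      obtain ⟨k, u, hu, s, hs, hr, he⟩ := exists_neck_param hj h' h3
      refine ⟨i, hj, (n + e1, m + e2), k, u, hu, s, ⟨by linarith [hs.1], hs.2⟩, ?_⟩
      have e : ((i : ℕ) : ℤ) = ((i + 1 : ℕ) : ℤ) - 1 := by push_cast; ring
      rw [neckPt, neckHgt_nonneg hj k hs.1, he, e, hpt', hr, hz]

end Stack

namespace Stack

variable {A : Stack}

/-! ### Addresses of the points of the surface -/

variable (A) in
/-- The indices of the axes of one neck modulo the periods of `Φ`. -/
abbrev Box : Type := Finset.Ico (0 : ℤ) A.p × Finset.Ico (0 : ℤ) A.q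

/-- The pair of integers given by an element of `Box`. -/
def ctr (c : A.Box) : ℤ × ℤ := (c.1, c.2)

variable (A) in
/-- Coordinates for the points of the surface: a point over the boundaries of the diamonds at some
level, a point on a neck, or a point of the flat diamonds at the bottom (`false`) and at the top
(`true`) of the stack. -/
inductive Addr
  | line (j : Fin A.N) (c : A.Box) (k : Fin 4) (u : ℝ)
  | neck (j : Fin (A.N - 1)) (c : A.Box) (k : Fin 4) (s u : ℝ)
  | cap (b : Bool) (c : A.Box) (a : ℝ × ℝ)

namespace Addr

/-- The point with a given address. -/
noncomputable def pos : A.Addr → ℝ × ℝ × ℝ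
  | line j c k u => A.linePt j (ctr c) k u
  | neck j c k s u => A.neckPt j (ctr c) k s u
  | cap b c a => bif b then A.pt (A.N - 1) (ctr c) a (A.T (A.N - 1)) else A.pt (-1) (ctr c) a (A.T 0)

/-- The addresses with unique points: half-open sides, two vertices for each axis, open necks and
open diamonds. -/
def Valid : A.Addr → Prop
  | line _ _ k u => u ∈ Ico (0 : ℝ) 1 ∧ (u = 0 → k = 0 ∨ k = 1)
  | neck _ _ _ s u => u ∈ Ico (0 : ℝ) 1 ∧ s ∈ Ioo (-1 : ℝ) 1
  | cap _ _ a => taxi a < 1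

end Addr

/-- Every axis is equivalent under the periods of `Φ` to one with indices in `Box`. -/
theorem pt_add_box (σ : ℤ) (c : ℤ × ℤ) (a : ℝ × ℝ) (z : ℝ) :
    ∃ c' : A.Box, Phi (A.pt σ (ctr c') a z) = Phi (A.pt σ c a z) := by
  have hp : (0 : ℤ) < A.p := by exact_mod_cast A.p_pos
  have hq : (0 : ℤ) < A.q := by exact_mod_cast A.q_pos
  refine ⟨(⟨c.1 % A.p, Finset.mem_Ico.2 ⟨Int.emod_nonneg _ hp.ne', Int.emod_lt_of_pos _ hp⟩⟩,
    ⟨c.2 % A.q, Finset.mem_Ico.2 ⟨Int.emod_nonneg _ hq.ne', Int.emod_lt_of_pos _ hq⟩⟩), ?_⟩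
  rw [← Phi_add_period _ _ _ (c.1 / A.p) (c.2 / A.q)]
  have h1 : ((c.1 % A.p : ℤ) : ℝ) + A.p * (c.1 / A.p : ℤ) = c.1 := by
    exact_mod_cast Int.emod_add_mul_ediv c.1 A.p
  have h2 : ((c.2 % A.q : ℤ) : ℝ) + A.q * (c.2 / A.q : ℤ) = c.2 := by
    exact_mod_cast Int.emod_add_mul_ediv c.2 A.q
  congr 1
  simp only [pt, ctr]
  refine Prod.ext ?_ (Prod.ext ?_ rfl)
  · simp only
    rw [← h1, A.per_eq_X]
    ring
  · simp only
    rw [← h2, A.per_eq_Y]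
    ring

theorem Phi_pt_eq {σ σ' : ℤ} {c c' : ℤ × ℤ} {a a' : ℝ × ℝ} {z z' : ℝ} (hz : |z| < π / 4)
    (hz' : |z'| < π / 4) (h : Phi (A.pt σ c a z) = Phi (A.pt σ' c' a' z')) :
    z = z' ∧ ∃ n m : ℤ, a.1 - a'.1 = ((σ' + 2 * c'.1 + 2 * (A.p * n) - σ - 2 * c.1 : ℤ) : ℝ) ∧
      a.2 - a'.2 = ((σ' + 2 * c'.2 + 2 * (A.q * m) - σ - 2 * c.2 : ℤ) : ℝ) := by
  obtain ⟨h1, ⟨n, hn⟩, m, hm⟩ := (Phi_eq_iff (p := A.pt σ c a z) (p' := A.pt σ' c' a' z') hz hz').1 h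
  refine ⟨h1, n, m, ?_, ?_⟩
  · apply mul_right_cancel₀ A.X_pos.ne'
    simp only [pt] at hn
    rw [A.per_eq_X] at hn
    push_cast
    linear_combination hn
  · apply mul_right_cancel₀ A.Y_pos.ne'
    simp only [pt] at hm
    rw [A.per_eq_Y] at hm
    push_cast
    linear_combination hm

/-- Two points at distance less than `2` in the `ℓ¹`-norm which differ by an element of the lattice
of integer points with even sum are equal. -/
theorem int_eq_zero {a a' : ℝ × ℝ} {d e f : ℤ} (h1 : a.1 - a'.1 = d) (h2 : a.2 - a'.2 = e)
    (h : taxi a + taxi a' < 2) (hf : d + e = 2 * f) : d = 0 ∧ e = 0 := by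
  unfold taxi at h
  have h3 : |(d : ℝ)| + |(e : ℝ)| < 2 := by
    rw [← h1, ← h2]
    linarith [abs_sub a.1 a'.1, abs_sub a.2 a'.2]
  have h4 : |d| + |e| < 2 := by exact_mod_cast h3
  rcases abs_cases d with ⟨h5, h5'⟩ | ⟨h5, h5'⟩ <;> rcases abs_cases e with ⟨h6, h6'⟩ | ⟨h6, h6'⟩ <;>
    constructor <;> omega

theorem box_eq {p : ℕ} {c c' : Finset.Ico (0 : ℤ) p} {n : ℤ}
    (h : (c' : ℤ) + p * n = c) : c = c' := by
  obtain ⟨h1, h2⟩ := Finset.mem_Ico.1 c.2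
  obtain ⟨h3, h4⟩ := Finset.mem_Ico.1 c'.2
  apply Subtype.ext
  rw [← Int.emod_eq_of_lt h1 h2, ← Int.emod_eq_of_lt h3 h4, ← h, Int.add_mul_emod_self_left]

theorem ctr_eq {c c' : A.Box} {n m : ℤ} (h1 : (ctr c').1 + A.p * n = (ctr c).1)
    (h2 : (ctr c').2 + A.q * m = (ctr c).2) : c = c' :=
  Prod.ext (box_eq h1) (box_eq h2)

/-- The points over the open diamonds around the axes of neck `ν`: the neck is determined by the
height and the parity of `ν`, the rest by the horizontal position. -/
theorem open_inj {ν ν' : ℕ} (hν : ν ≤ A.N) (hν' : ν' ≤ A.N) {c c' : A.Box} {a a' : ℝ × ℝ} {z z' : ℝ}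
    (ha : taxi a < 1) (ha' : taxi a' < 1) (hz : |z| < π / 4) (hz' : |z'| < π / 4)
    (hw : z ∈ Ioo (A.K (ν - 1)) (A.K (min (ν + 1) A.N)))
    (hw' : z' ∈ Ioo (A.K (ν' - 1)) (A.K (min (ν' + 1) A.N)))
    (h : Phi (A.pt (ν - 1) (ctr c) a z) = Phi (A.pt (ν' - 1) (ctr c') a' z')) :
    ν = ν' ∧ c = c' ∧ a = a' ∧ z = z' := by
  obtain ⟨rfl, n, m, h1, h2⟩ := Phi_pt_eq hz hz' h
  set x : ℤ := A.p * n with hx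
  set y : ℤ := A.q * m with hy
  obtain ⟨e1, e2⟩ := int_eq_zero h1 h2 (by linarith)
    (f := ν' - ν + (ctr c').1 - (ctr c).1 + (ctr c').2 - (ctr c).2 + x + y) (by ring)
  have hνν : ν = ν' := by
    rcases lt_trichotomy ν ν' with h3 | h3 | h3
    · have h4 := A.K_mono (i := min (ν + 1) A.N) (j := ν' - 1) (by omega) (by omega)
      linarith [hw.2, hw'.1]
    · exact h3
    · have h4 := A.K_mono (i := min (ν' + 1) A.N) (j := ν - 1) (by omega) (by omega)
      linarith [hw'.2, hw.1]
  subst hνν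
  refine ⟨rfl, ctr_eq (n := n) (m := m) ?_ ?_, ?_, rfl⟩
  · rw [← hx]; omega
  · rw [← hy]; omega
  · rw [e1, Int.cast_zero] at h1
    rw [e2, Int.cast_zero] at h2
    exact Prod.ext (by linarith) (by linarith)

/-- Points over open diamonds are distinct from points over boundaries of diamonds. -/
theorem open_ne_line {σ σ' : ℤ} {c c' : ℤ × ℤ} {a a' : ℝ × ℝ} {z z' : ℝ}
    (ha : taxi a < 1) (ha' : taxi a' = 1) (hz : |z| < π / 4) (hz' : |z'| < π / 4)
    (h : Phi (A.pt σ c a z) = Phi (A.pt σ' c' a' z')) : False := by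
  obtain ⟨-, n, m, h1, h2⟩ := Phi_pt_eq hz hz' h
  set x : ℤ := A.p * n with hx
  set y : ℤ := A.q * m with hy
  obtain ⟨e1, e2⟩ := int_eq_zero h1 h2 (by linarith)
    (f := σ' - σ + c'.1 - c.1 + c'.2 - c.2 + x + y) (by ring)
  rw [e1, Int.cast_zero] at h1
  rw [e2, Int.cast_zero] at h2
  have : a = a' := Prod.ext (by linarith) (by linarith)
  rw [this] at ha
  linarith

theorem valid_side {k : Fin 4} {u : ℝ} (hu : u ∈ Ico (0 : ℝ) 1) (hk : u = 0 → k = 0 ∨ k = 1) :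
    side k u ∈ Ioc (-1 : ℝ) 1 ×ˢ Ioc (-1 : ℝ) 1 := by
  obtain ⟨h0, h1, h2, h3⟩ := side_cases u
  obtain ⟨a, b⟩ := hu
  rcases a.eq_or_lt with h | h
  · rcases hk h.symm with rfl | rfl
    · rw [h0, ← h]; norm_num
    · rw [h1, ← h]; norm_num
  · fin_cases k <;> simp only [Fin.zero_eta, Fin.mk_one, Fin.reduceFinMk, h0, h1, h2, h3] <;>
      refine ⟨⟨?_, ?_⟩, ⟨?_, ?_⟩⟩ <;> simp only <;> linarith

theorem T_injective {i j : ℕ} (hi : i < A.N) (hj : j < A.N) (h : A.T i = A.T j) : i = j := by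
  rcases lt_trichotomy i j with h1 | h1 | h1
  · linarith [A.T_lt i hi, A.K_mono (i := i + 1) (j := j) h1 hj.le, A.lt_T j hj]
  · exact h1
  · linarith [A.T_lt j hj, A.K_mono (i := j + 1) (j := i) h1 hi.le, A.lt_T i hi]

/-- Points over the boundaries of diamonds: the sides around the axes of one neck already cover the
boundaries around the axes of the other necks, and the half-open sides with two vertices for each
axis cover them once. -/
theorem line_inj {i j : ℕ} (hi : i < A.N) (hj : j < A.N) {c c' : A.Box} {k k' : Fin 4} {u u' : ℝ}
    (hu : u ∈ Ico (0 : ℝ) 1) (hk : u = 0 → k = 0 ∨ k = 1) (hu' : u' ∈ Ico (0 : ℝ) 1)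
    (hk' : u' = 0 → k' = 0 ∨ k' = 1)
    (h : Phi (A.linePt i (ctr c) k u) = Phi (A.linePt j (ctr c') k' u')) :
    i = j ∧ c = c' ∧ k = k' ∧ u = u' := by
  have m1 := abs_lt_of_mem_lifted (linePt_mem hi (ctr c) k ⟨hu.1, hu.2.le⟩)
  have m2 := abs_lt_of_mem_lifted (linePt_mem hj (ctr c') k' ⟨hu'.1, hu'.2.le⟩)
  obtain ⟨h0, n, m, h1, h2⟩ := Phi_pt_eq m1 m2 h
  obtain rfl := T_injective hi hj h0
  set x : ℤ := A.p * n with hx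
  set y : ℤ := A.q * m with hy
  obtain ⟨v1, v2⟩ := valid_side hu hk
  obtain ⟨v1', v2'⟩ := valid_side hu' hk'
  have key : ∀ (d e : ℤ) (s s' : ℝ), s - s' = d → d = 2 * e → s ∈ Ioc (-1 : ℝ) 1 →
      s' ∈ Ioc (-1 : ℝ) 1 → d = 0 := by
    intro d e s s' hd he hs hs'
    have a1 : (-2 : ℝ) < d := by linarith [hs.1, hs'.2]
    have a2 : (d : ℝ) < 2 := by linarith [hs.2, hs'.1]
    have a3 : -2 < d := by exact_mod_cast a1
    have a4 : d < 2 := by exact_mod_cast a2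
    omega
  have e1 := key _ ((ctr c').1 + x - (ctr c).1) _ _ h1 (by ring) v1 v1'
  have e2 := key _ ((ctr c').2 + y - (ctr c).2) _ _ h2 (by ring) v2 v2'
  rw [e1, Int.cast_zero] at h1
  rw [e2, Int.cast_zero] at h2
  obtain ⟨hkk, huu⟩ := side_injective hu hu' (Prod.ext (by linarith) (by linarith))
  refine ⟨rfl, ctr_eq (n := n) (m := m) ?_ ?_, hkk, huu⟩
  · rw [← hx]; omega
  · rw [← hy]; omega

theorem neckHgt_mem {j : ℕ} (hj : j + 1 < A.N) (k : Fin 4) {s u : ℝ} (hu : u ∈ Icc (0 : ℝ) 1) :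
    A.neckHgt j k s u ∈ Ioo (A.K j) (A.K (j + 2)) ∧ (A.neckHgt j k s u ≤ A.K (j + 1) ↔ s ≤ 0) := by
  have h1 := A.K_lt_succ (j := j) (by omega)
  have h2 := A.K_lt_succ hj
  rcases lt_trichotomy s 0 with h | h | h
  · have := A.dn_mem j (by omega) _ (lt_rad hj.le k h.ne hu)
    rw [neckHgt_nonpos hj k h.le]
    exact ⟨⟨this.1, this.2.trans h2⟩, iff_of_true this.2.le h.le⟩
  · subst h
    rw [neckHgt_nonpos hj k le_rfl, rad_zero, A.dn_waist j hj]
    exact ⟨⟨h1, h2⟩, iff_of_true le_rfl le_rfl⟩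
  · have := A.up_mem (j + 1) hj _ (lt_rad hj.le k h.ne' hu)
    rw [neckHgt_nonneg hj k h.le]
    exact ⟨⟨h1.trans this.1, this.2⟩, iff_of_false (not_le.2 this.1) (not_le.2 h)⟩

theorem neck_param_inj {j : ℕ} (hj : j + 1 < A.N) {k k' : Fin 4} {s s' u u' : ℝ}
    (hs : s ∈ Ioo (-1 : ℝ) 1) (hs' : s' ∈ Ioo (-1 : ℝ) 1) (hu : u ∈ Ico (0 : ℝ) 1)
    (hu' : u' ∈ Ico (0 : ℝ) 1)
    (ha : (A.rad j k s u / A.len (side k u)) • side k u =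
      (A.rad j k' s' u' / A.len (side k' u')) • side k' u')
    (hz : A.neckHgt j k s u = A.neckHgt j k' s' u') : k = k' ∧ s = s' ∧ u = u' := by
  have i1 : u ∈ Icc (0 : ℝ) 1 := ⟨hu.1, hu.2.le⟩
  have i2 : u' ∈ Icc (0 : ℝ) 1 := ⟨hu'.1, hu'.2.le⟩
  obtain ⟨-, -, h1, -⟩ := len_scaled hj k (Ioo_subset_Icc_self hs) i1
  obtain ⟨-, -, h2, -⟩ := len_scaled hj k' (Ioo_subset_Icc_self hs') i2
  obtain ⟨rfl, rfl, h3⟩ := smul_side_injective hu hu' h1 h2 ha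
  have hlen := A.r₀_pos.trans (r₀_lt_len_side (A := A) k i1)
  have ht := t_lt_len_side (A := A) hj.le k i1
  have h4 : A.rad j k s u = A.rad j k s' u := (div_left_inj' hlen.ne').1 h3
  have h5 : |s| = |s'| := by
    unfold rad at h4
    apply mul_right_cancel₀ (sub_ne_zero.2 ht.ne')
    linear_combination h4
  refine ⟨rfl, ?_, rfl⟩
  have n1 := (neckHgt_mem hj k (s := s) i1).2
  have n2 := (neckHgt_mem hj k (s := s') i1).2
  rw [hz] at n1
  have h6 : s ≤ 0 ↔ s' ≤ 0 := n1.symm.trans n2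
  rcases le_or_gt s 0 with h | h
  · rw [abs_of_nonpos h, abs_of_nonpos (h6.1 h)] at h5
    linarith
  · have h' : 0 < s' := by
      by_contra hcon
      linarith [h6.2 (not_lt.1 hcon)]
    rwa [abs_of_pos h, abs_of_pos h'] at h5

theorem Addr.pos_mem : ∀ {α : A.Addr}, α.Valid → α.pos ∈ A.lifted
  | .line j c k u, h => linePt_mem j.2 _ k ⟨h.1.1, h.1.2.le⟩
  | .neck j c k s u, h => neckPt_mem (by omega) _ k (Ioo_subset_Icc_self h.2) ⟨h.1.1, h.1.2.le⟩
  | .cap true c a, h => top_mem (ctr c) (le_of_lt h)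
  | .cap false c a, h => bottom_mem (ctr c) (le_of_lt h)

variable (A) in
/-- The point `w` lies over the open diamond around the axis `c` of neck `ν`, at position `a` and
height `z`, in the range of heights that is special to neck `ν` among the necks of its parity. -/
structure IsOver (w : ℝ × ℝ × ℝ) (ν : ℕ) (c : A.Box) (a : ℝ × ℝ) (z : ℝ) : Prop where
  le : ν ≤ A.N
  taxi_lt : taxi a < 1
  mem : z ∈ Ioo (A.K (ν - 1)) (A.K (min (ν + 1) A.N))
  eq : w = A.pt (ν - 1) (ctr c) a z

theorem IsOver.inj {w w' : ℝ × ℝ × ℝ} {ν ν' : ℕ} {c c' : A.Box} {a a' : ℝ × ℝ} {z z' : ℝ}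
    (h : A.IsOver w ν c a z) (h' : A.IsOver w' ν' c' a' z') (hw : w ∈ A.lifted)
    (hw' : w' ∈ A.lifted) (he : Phi w = Phi w') : ν = ν' ∧ c = c' ∧ a = a' ∧ z = z' := by
  have m1 := abs_lt_of_mem_lifted hw
  have m2 := abs_lt_of_mem_lifted hw'
  rw [h.eq, h'.eq] at he
  rw [h.eq] at m1
  rw [h'.eq] at m2
  exact open_inj h.le h'.le h.taxi_lt h'.taxi_lt m1 m2 h.mem h'.mem he

theorem neck_isOver {j : ℕ} (hj : j + 1 < A.N) (c : A.Box) (k : Fin 4) {s u : ℝ}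
    (hs : s ∈ Ioo (-1 : ℝ) 1) (hu : u ∈ Icc (0 : ℝ) 1) :
    A.IsOver (A.neckPt j (ctr c) k s u) (j + 1) c
      ((A.rad j k s u / A.len (side k u)) • side k u) (A.neckHgt j k s u) where
  le := hj.le
  taxi_lt := by
    rw [(len_scaled hj k (Ioo_subset_Icc_self hs) hu).2.1,
      div_lt_one (A.r₀_pos.trans (r₀_lt_len_side k hu))]
    exact rad_lt hj.le k hs hu
  mem := by
    rw [min_eq_left (by omega)]
    exact (neckHgt_mem hj k hu).1
  eq := by
    have e : (((j + 1 : ℕ) : ℤ) - 1) = j := by push_cast; ring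
    rw [e]
    rfl

theorem bottom_isOver (c : A.Box) {a : ℝ × ℝ} (ha : taxi a < 1) :
    A.IsOver (A.pt (-1) (ctr c) a (A.T 0)) 0 c a (A.T 0) where
  le := Nat.zero_le _
  taxi_lt := ha
  mem := by
    have := A.two_le
    rw [min_eq_left (by omega)]
    exact ⟨A.lt_T 0 (by omega), A.T_lt 0 (by omega)⟩
  eq := by simp

theorem top_isOver (c : A.Box) {a : ℝ × ℝ} (ha : taxi a < 1) :
    A.IsOver (A.pt (A.N - 1) (ctr c) a (A.T (A.N - 1))) A.N c a (A.T (A.N - 1)) where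
  le := le_rfl
  taxi_lt := ha
  mem := by
    have := A.two_le
    have h := A.T_lt (A.N - 1) (by omega)
    rw [Nat.sub_add_cancel (by omega)] at h
    rw [min_eq_right (by omega)]
    exact ⟨A.lt_T _ (by omega), h⟩
  eq := rfl

theorem IsOver.ne_line {w : ℝ × ℝ × ℝ} {ν : ℕ} {c c' : A.Box} {a : ℝ × ℝ} {z u : ℝ} {j : ℕ}
    {k : Fin 4} (h : A.IsOver w ν c a z) (hw : w ∈ A.lifted) (hj : j < A.N)
    (hu : u ∈ Icc (0 : ℝ) 1) (he : Phi w = Phi (A.linePt j (ctr c') k u)) : False := by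
  have m1 := abs_lt_of_mem_lifted hw
  have m2 := abs_lt_of_mem_lifted (linePt_mem hj (ctr c') k hu)
  rw [h.eq] at he m1
  exact open_ne_line h.taxi_lt (taxi_side k hu) m1 m2 he

/-- A point of the surface has only one valid address. -/
theorem Addr.pos_inj {α β : A.Addr} (hα : α.Valid) (hβ : β.Valid) (h : Phi α.pos = Phi β.pos) :
    α = β := by
  have hN := A.two_le
  have mα := pos_mem hα
  have mβ := pos_mem hβ
  rcases α with ⟨j, c, k, u⟩ | ⟨j, c, k, s, u⟩ | ⟨b, c, a⟩
  · have hu : u ∈ Icc (0 : ℝ) 1 := ⟨hα.1.1, hα.1.2.le⟩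
    rcases β with ⟨j', c', k', u'⟩ | ⟨j', c', k', s', u'⟩ | ⟨b', c', a'⟩
    · obtain ⟨h1, rfl, rfl, rfl⟩ := line_inj j.2 j'.2 hα.1 hα.2 hβ.1 hβ.2 h
      obtain rfl := Fin.ext h1
      rfl
    · exact ((neck_isOver (by omega) c' k' hβ.2 ⟨hβ.1.1, hβ.1.2.le⟩).ne_line mβ j.2 hu h.symm).elim
    · cases b'
      · exact ((bottom_isOver c' hβ).ne_line mβ j.2 hu h.symm).elim
      · exact ((top_isOver c' hβ).ne_line mβ j.2 hu h.symm).elim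
  · have hu : u ∈ Icc (0 : ℝ) 1 := ⟨hα.1.1, hα.1.2.le⟩
    have o := neck_isOver (j := j) (by omega) c k hα.2 hu
    rcases β with ⟨j', c', k', u'⟩ | ⟨j', c', k', s', u'⟩ | ⟨b', c', a'⟩
    · exact (o.ne_line mα j'.2 ⟨hβ.1.1, hβ.1.2.le⟩ h).elim
    · obtain ⟨h1, rfl, h3, h4⟩ :=
        o.inj (neck_isOver (by omega) c' k' hβ.2 ⟨hβ.1.1, hβ.1.2.le⟩) mα mβ h
      obtain rfl : j = j' := Fin.ext (by omega)
      obtain ⟨rfl, rfl, rfl⟩ := neck_param_inj (by omega) hα.2 hβ.2 hα.1 hβ.1 h3 h4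
      rfl
    · cases b'
      · have := (o.inj (bottom_isOver c' hβ) mα mβ h).1
        omega
      · have := (o.inj (top_isOver c' hβ) mα mβ h).1
        omega
  · rcases β with ⟨j', c', k', u'⟩ | ⟨j', c', k', s', u'⟩ | ⟨b', c', a'⟩
    · cases b
      · exact ((bottom_isOver c hα).ne_line mα j'.2 ⟨hβ.1.1, hβ.1.2.le⟩ h).elim
      · exact ((top_isOver c hα).ne_line mα j'.2 ⟨hβ.1.1, hβ.1.2.le⟩ h).elim
    · have o := neck_isOver (j := j') (by omega) c' k' hβ.2 ⟨hβ.1.1, hβ.1.2.le⟩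
      cases b
      · have := ((bottom_isOver c hα).inj o mα mβ h).1
        omega
      · have := ((top_isOver c hα).inj o mα mβ h).1
        omega
    · cases b <;> cases b'
      · obtain ⟨-, rfl, rfl, -⟩ := (bottom_isOver c hα).inj (bottom_isOver c' hβ) mα mβ h
        rfl
      · have := ((bottom_isOver c hα).inj (top_isOver c' hβ) mα mβ h).1
        omega
      · have := ((top_isOver c hα).inj (bottom_isOver c' hβ) mα mβ h).1
        omega
      · obtain ⟨-, rfl, rfl, -⟩ := (top_isOver c hα).inj (top_isOver c' hβ) mα mβ h
        rfl

end Stack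

namespace Stack

variable {A : Stack}

/-! ### The cell decomposition -/

/-- The dimension of the cell that contains the point with a given valid address. -/
noncomputable def Addr.dim : A.Addr → ℕ
  | line _ _ _ u => if u = 0 then 0 else 1
  | neck _ _ _ _ u => if u = 0 then 1 else 2
  | cap _ _ _ => 2

/-- The points over the boundary of a diamond around an axis of neck `j + 1`, at level `j`. -/
theorem exists_line_addr {j : ℕ} (hj : j < A.N) (c : ℤ × ℤ) {a : ℝ × ℝ} (ha : taxi a = 1) :
    ∃ α : A.Addr, α.Valid ∧ Phi α.pos = Phi (A.pt j c a (A.T j)) ∧ α.dim ≤ 1 ∧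
      (a.1 = 0 ∨ a.2 = 0 → α.dim = 0) := by
  obtain ⟨k, u, hu, he⟩ := exists_side (a := a) (by rw [ha]; exact one_pos)
  rw [ha, one_smul] at he
  have hdim : ∀ c k, (Addr.line (A := A) ⟨j, hj⟩ c k u).dim ≤ 1 := by
    intro c k
    simp only [Addr.dim]
    split_ifs <;> omega
  have hcorner : a.1 = 0 ∨ a.2 = 0 → u = 0 := by
    obtain ⟨h0, h1⟩ := hu
    obtain ⟨s0, s1, s2, s3⟩ := side_cases u
    rw [he]
    fin_cases k <;> simp only [Fin.zero_eta, Fin.mk_one, Fin.reduceFinMk, s0, s1, s2, s3] <;>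
      rintro (h | h) <;> linarith
  -- The vertices of a diamond are counted for the axis to the left of them or below them.
  obtain ⟨d, k', hk', hs⟩ : ∃ (d : ℤ × ℤ) (k' : Fin 4), (u = 0 → k' = 0 ∨ k' = 1) ∧
      ∀ z, A.pt j c (side k u) z = A.pt j (c + d) (side k' u) z := by
    by_cases hu0 : u = 0
    · subst hu0
      simp only [pt, side_zero]
      fin_cases k
      · exact ⟨0, 0, by simp, by simp⟩
      · exact ⟨0, 1, by simp, by simp⟩
      · refine ⟨(-1, 0), 0, by simp, fun z => ?_⟩
        simp only [corner, Fin.reduceFinMk, Matrix.cons_val, Prod.fst_add, Prod.snd_add]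
        push_cast
        refine Prod.ext ?_ (Prod.ext ?_ rfl) <;> ring
      · refine ⟨(0, -1), 1, by simp, fun z => ?_⟩
        simp only [corner, Fin.reduceFinMk, Matrix.cons_val, Prod.fst_add, Prod.snd_add]
        push_cast
        refine Prod.ext ?_ (Prod.ext ?_ rfl) <;> ring
    · exact ⟨0, k, fun h => (hu0 h).elim, fun z => by rw [add_zero]⟩
  obtain ⟨c', hc'⟩ := pt_add_box (A := A) j (c + d) (side k' u) (A.T j)
  refine ⟨.line ⟨j, hj⟩ c' k' u, ⟨hu, hk'⟩, ?_, hdim _ _, fun h => ?_⟩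
  · rw [he, hs]
    exact hc'
  · simp [Addr.dim, hcorner h]

/-- The points over the boundaries of diamonds lie in the skeleton of dimension one. -/
theorem exists_boundary_addr {i : ℕ} (hi : i < A.N) (σ : ℤ) (c : ℤ × ℤ) {a : ℝ × ℝ}
    (ha : taxi a = 1) :
    ∃ α : A.Addr, α.Valid ∧ Phi α.pos = Phi (A.pt σ c a (A.T i)) ∧ α.dim ≤ 1 ∧
      (a.1 = 0 ∨ a.2 = 0 → α.dim = 0) := by
  obtain ⟨c', a', h1, h2, h3⟩ := exists_line_pt (A := A) i σ c ha
  obtain ⟨α, k1, k2, k3, k4⟩ := exists_line_addr hi c' h1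
  exact ⟨α, k1, by rw [k2, h3], k3, fun h => k4 (h2 h)⟩

theorem exists_addr {p : E} (hp : p ∈ A.surf) : ∃ α : A.Addr, α.Valid ∧ Phi α.pos = p := by
  obtain ⟨w, hw, rfl⟩ := hp
  rcases lifted_cases hw with ⟨j, hj, c, k, u, hu, s, hs, rfl⟩ | ⟨j, hj, c, k, u, hu, rfl⟩ |
    ⟨c, a, ha, rfl⟩ | ⟨c, a, ha, rfl⟩
  · obtain ⟨c', hc'⟩ := pt_add_box (A := A) j c
      ((A.rad j k s u / A.len (side k u)) • side k u) (A.neckHgt j k s u)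
    exact ⟨.neck ⟨j, by omega⟩ c' k s u, ⟨hu, hs⟩, hc'⟩
  · obtain ⟨α, h1, h2, -⟩ := exists_line_addr hj c (taxi_side k ⟨hu.1, hu.2.le⟩)
    exact ⟨α, h1, h2⟩
  · obtain ⟨c', hc'⟩ := pt_add_box (A := A) (-1) c a (A.T 0)
    exact ⟨.cap false c' a, ha, hc'⟩
  · obtain ⟨c', hc'⟩ := pt_add_box (A := A) (A.N - 1) c a (A.T (A.N - 1))
    exact ⟨.cap true c' a, ha, hc'⟩

variable (A) in
/-- The cells: at each level two vertices and four edges for each axis; for each neck four edges and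
four faces for each axis; and one face for each flat diamond at the bottom and at the top. -/
def cellIdx : ℕ → Type
  | 0 => Fin A.N × A.Box × {k : Fin 4 // k = 0 ∨ k = 1}
  | 1 => (Fin A.N × A.Box × Fin 4) ⊕ (Fin (A.N - 1) × A.Box × Fin 4)
  | 2 => (Fin (A.N - 1) × A.Box × Fin 4) ⊕ (Bool × A.Box)
  | _ + 3 => Empty

/-- The characteristic maps of the cells. The sides of the diamonds are parametrized by `[-1, 1]`,
the diamonds themselves by a square. -/
noncomputable def cellAddr : ∀ n, A.cellIdx n → (Fin n → ℝ) → A.Addr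
  | 0, (j, c, k), _ => .line j c k 0
  | 1, .inl (j, c, k), x => .line j c k ((1 + x 0) / 2)
  | 1, .inr (j, c, k), x => .neck j c k (x 0) 0
  | 2, .inl (j, c, k), x => .neck j c k (x 0) ((1 + x 1) / 2)
  | 2, .inr (b, c), x => .cap b c ((x 0 + x 1) / 2, (x 0 - x 1) / 2)

theorem ball_one_iff (x : Fin 1 → ℝ) : (x ∈ Metric.ball 0 1 ↔ |x 0| < 1) ∧
    (x ∈ Metric.closedBall 0 1 ↔ |x 0| ≤ 1) ∧ (x ∈ Metric.sphere 0 1 ↔ |x 0| = 1) := by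
  have h : ‖x‖ = |x 0| := by
    rw [Pi.norm_def]
    simp
  simp [h]

theorem ball_two_iff (x : Fin 2 → ℝ) : (x ∈ Metric.ball 0 1 ↔ |x 0| < 1 ∧ |x 1| < 1) ∧
    (x ∈ Metric.closedBall 0 1 ↔ |x 0| ≤ 1 ∧ |x 1| ≤ 1) := by
  simp [pi_norm_lt_iff, pi_norm_le_iff_of_nonneg, Fin.forall_fin_two]

theorem taxi_rotate_lt (x y : ℝ) (hx : |x| < 1) (hy : |y| < 1) :
    taxi ((x + y) / 2, (x - y) / 2) < 1 := by
  have := abs_lt.1 hx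
  have := abs_lt.1 hy
  simp only [taxi]
  rcases abs_cases ((x + y) / 2) with h | h <;> rcases abs_cases ((x - y) / 2) with h' | h' <;>
    linarith

theorem taxi_rotate_le (x y : ℝ) (hx : |x| ≤ 1) (hy : |y| ≤ 1) :
    taxi ((x + y) / 2, (x - y) / 2) ≤ 1 := by
  have := abs_le.1 hx
  have := abs_le.1 hy
  simp only [taxi]
  rcases abs_cases ((x + y) / 2) with h | h <;> rcases abs_cases ((x - y) / 2) with h' | h' <;>
    linarith

theorem cellAddr_valid : ∀ (n : ℕ) (i : A.cellIdx n), ∀ x ∈ Metric.ball (0 : Fin n → ℝ) 1,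
    (cellAddr n i x).Valid ∧ (cellAddr n i x).dim = n
  | 0, (j, c, k), x, _ => ⟨⟨⟨le_rfl, one_pos⟩, fun _ => k.2⟩, if_pos rfl⟩
  | 1, .inl (j, c, k), x, h => by
    have h1 := abs_lt.1 ((ball_one_iff x).1.1 h)
    have h2 : (1 + x 0) / 2 ≠ 0 := by linarith
    exact ⟨⟨⟨by linarith, by linarith⟩, fun h => (h2 h).elim⟩, if_neg h2⟩
  | 1, .inr (j, c, k), x, h =>
    ⟨⟨⟨le_rfl, one_pos⟩, abs_lt.1 ((ball_one_iff x).1.1 h)⟩, if_pos rfl⟩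
  | 2, .inl (j, c, k), x, h => by
    have h0 := abs_lt.1 ((ball_two_iff x).1.1 h).1
    have h1 := abs_lt.1 ((ball_two_iff x).1.1 h).2
    have h2 : (1 + x 1) / 2 ≠ 0 := by linarith
    exact ⟨⟨⟨by linarith, by linarith⟩, h0⟩, if_neg h2⟩
  | 2, .inr (b, c), x, h => by
    have h1 := (ball_two_iff x).1.1 h
    exact ⟨taxi_rotate_lt _ _ h1.1 h1.2, rfl⟩

theorem cellAddr_inj {n n' : ℕ} {i : A.cellIdx n} {i' : A.cellIdx n'} {x : Fin n → ℝ}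
    {x' : Fin n' → ℝ} (hx : x ∈ Metric.ball 0 1) (hx' : x' ∈ Metric.ball 0 1)
    (h : cellAddr n i x = cellAddr n' i' x') :
    (⟨n, i, x⟩ : Σ n, A.cellIdx n × (Fin n → ℝ)) = ⟨n', i', x'⟩ := by
  obtain rfl : n = n' := by
    rw [← (cellAddr_valid n i x hx).2, h, (cellAddr_valid n' i' x' hx').2]
  have e1 : ∀ a b : ℝ, (1 + a) / 2 = (1 + b) / 2 → a = b := fun a b h => by linarith
  rcases n with _ | _ | _ | n
  · obtain ⟨j, c, k⟩ := i
    obtain ⟨j', c', k'⟩ := i'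
    simp only [cellAddr, Addr.line.injEq] at h
    obtain ⟨rfl, rfl, h, -⟩ := h
    obtain rfl := Subtype.ext h
    rw [Subsingleton.elim x x']
  · rcases i with ⟨j, c, k⟩ | ⟨j, c, k⟩ <;> rcases i' with ⟨j', c', k'⟩ | ⟨j', c', k'⟩ <;>
      simp only [cellAddr, Addr.line.injEq, Addr.neck.injEq, reduceCtorEq] at h
    · obtain ⟨rfl, rfl, rfl, h⟩ := h
      have : x = x' := by
        funext i
        rw [Fin.fin_one_eq_zero i]
        exact e1 _ _ h
      rw [this]
    · obtain ⟨rfl, rfl, rfl, h, -⟩ := h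
      have : x = x' := by
        funext i
        rw [Fin.fin_one_eq_zero i]
        exact h
      rw [this]
  · rcases i with ⟨j, c, k⟩ | ⟨b, c⟩ <;> rcases i' with ⟨j', c', k'⟩ | ⟨b', c'⟩ <;>
      simp only [cellAddr, Addr.cap.injEq, Addr.neck.injEq, reduceCtorEq, Prod.mk.injEq] at h
    · obtain ⟨rfl, rfl, rfl, h0, h1⟩ := h
      have : x = x' := by
        funext i
        fin_cases i
        · exact h0
        · exact e1 _ _ h1
      rw [this]
    · obtain ⟨rfl, rfl, h0, h1⟩ := h
      have : x = x' := by
        funext i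
        fin_cases i <;> simp only [Fin.zero_eta, Fin.mk_one] <;> linarith
      rw [this]
  · exact i.elim

theorem exists_cell {α : A.Addr} (hα : α.Valid) : ∃ i : A.cellIdx α.dim,
    ∃ x ∈ Metric.ball (0 : Fin α.dim → ℝ) 1, cellAddr α.dim i x = α := by
  suffices h : ∃ n, n = α.dim ∧ ∃ i : A.cellIdx n, ∃ x ∈ Metric.ball (0 : Fin n → ℝ) 1,
      cellAddr n i x = α by
    obtain ⟨n, rfl, h⟩ := h
    exact h
  have e1 : ∀ u : ℝ, (1 + (2 * u - 1)) / 2 = u := fun u => by ring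
  have e2 : ∀ u ∈ Ico (0 : ℝ) 1, u ≠ 0 → |2 * u - 1| < 1 := fun u hu h0 =>
    abs_lt.2 ⟨by linarith [lt_of_le_of_ne hu.1 (Ne.symm h0)], by linarith [hu.2]⟩
  rcases α with ⟨j, c, k, u⟩ | ⟨j, c, k, s, u⟩ | ⟨b, c, a⟩
  · by_cases hu : u = 0
    · subst hu
      exact ⟨0, (if_pos rfl).symm, (j, c, ⟨k, hα.2 rfl⟩), 0, by simp, rfl⟩
    · refine ⟨1, (if_neg hu).symm, .inl (j, c, k), ![2 * u - 1], ?_, ?_⟩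
      · exact (ball_one_iff _).1.2 (e2 u hα.1 hu)
      · simp [cellAddr]
  · by_cases hu : u = 0
    · subst hu
      refine ⟨1, (if_pos rfl).symm, .inr (j, c, k), ![s], ?_, rfl⟩
      exact (ball_one_iff _).1.2 (abs_lt.2 hα.2)
    · refine ⟨2, (if_neg hu).symm, .inl (j, c, k), ![s, 2 * u - 1], ?_, ?_⟩
      · exact (ball_two_iff _).1.2 ⟨abs_lt.2 hα.2, e2 u hα.1 hu⟩
      · simp [cellAddr]
  · refine ⟨2, rfl, .inr (b, c), ![a.1 + a.2, a.1 - a.2], ?_, ?_⟩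
    · have h : |a.1| + |a.2| < 1 := hα
      refine (ball_two_iff _).1.2 ⟨?_, ?_⟩
      · exact (abs_add_le _ _).trans_lt h
      · exact (abs_sub _ _).trans_lt h
    · simp only [cellAddr, Matrix.cons_val_zero, Matrix.cons_val_one]
      congr 1
      refine Prod.ext ?_ ?_ <;> simp only <;> ring

theorem neckPt_one {j : ℕ} (hj : j + 1 < A.N) (c : ℤ × ℤ) (k : Fin 4) {s u : ℝ} (hs : |s| = 1)
    (hu : u ∈ Icc (0 : ℝ) 1) :
    ∃ i < A.N, A.neckPt j c k s u = A.pt j c (side k u) (A.T i) ∧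
      (s = -1 → i = j) ∧ (s = 1 → i = j + 1) := by
  have h1 := r₀_lt_len_side (A := A) k hu
  have h0 := A.r₀_pos
  have hr : A.rad j k s u = A.len (side k u) := by
    rw [rad, hs]; ring
  rcases (abs_eq one_pos.le).1 hs with rfl | rfl
  · refine ⟨j + 1, hj, ?_, by norm_num, fun _ => rfl⟩
    rw [neckPt, neckHgt_nonneg hj k zero_le_one, hr, div_self (by linarith), one_smul,
      A.up_far (j + 1) hj _ (by linarith [A.r₁_lt])]
  · refine ⟨j, by omega, ?_, fun _ => rfl, by norm_num⟩
    rw [neckPt, neckHgt_nonpos hj k (by norm_num), hr, div_self (by linarith), one_smul,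
      A.dn_far j (by omega) _ (by linarith [A.r₁_lt])]

theorem neckPt_side_one (j : ℕ) (c : ℤ × ℤ) (k : Fin 4) (s : ℝ) :
    A.neckPt j c k s 1 = A.neckPt j c (k + 1) s 0 := by
  simp only [neckPt, neckHgt, rad, side_one, side_zero]

theorem corner_zero (k : Fin 4) : (corner k).1 = 0 ∨ (corner k).2 = 0 := by
  fin_cases k <;> simp [corner]

/-- The boundary of a cell lies in cells of smaller dimension. -/
theorem exists_boundary : ∀ (n : ℕ) (i : A.cellIdx n), ∀ x ∈ Metric.sphere (0 : Fin n → ℝ) 1,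
    ∃ α : A.Addr, α.Valid ∧ α.dim < n ∧ Phi α.pos = Phi (cellAddr n i x).pos
  | 0, _, x, h => by
    rw [Subsingleton.elim x 0, mem_sphere_iff_norm, sub_zero, norm_zero] at h
    exact (zero_ne_one h).elim
  | 1, .inl (j, c, k), x, h => by
    have h1 := (ball_one_iff x).2.2.1 h
    obtain ⟨u, hu, k', hk⟩ : ∃ u, u = (1 + x 0) / 2 ∧ ∃ k', side k u = corner k' := by
      rcases (abs_eq one_pos.le).1 h1 with h2 | h2
      · exact ⟨1, by rw [h2]; norm_num, k + 1, side_one k⟩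
      · exact ⟨0, by rw [h2]; norm_num, k, side_zero k⟩
    have ht : taxi (corner k') = 1 := by rw [← side_zero]; exact taxi_side k' ⟨le_rfl, zero_le_one⟩
    obtain ⟨α, k1, k2, -, k4⟩ := exists_line_addr j.2 (ctr c) ht
    refine ⟨α, k1, by rw [k4 (corner_zero k')]; exact one_pos, ?_⟩
    rw [k2, ← hk, hu]
    rfl
  | 1, .inr (j, c, k), x, h => by
    have h1 := (ball_one_iff x).2.2.1 h
    have h0 : (0 : ℝ) ∈ Icc (0 : ℝ) 1 := ⟨le_rfl, zero_le_one⟩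
    obtain ⟨i, hi, he, -⟩ := neckPt_one (A := A) (j := j) (by omega) (ctr c) k h1 h0
    obtain ⟨α, k1, k2, -, k4⟩ := exists_boundary_addr hi j (ctr c) (taxi_side k h0)
    refine ⟨α, k1, by rw [k4 (by rw [side_zero]; exact corner_zero k)]; exact one_pos, ?_⟩
    rw [k2, ← he]
    rfl
  | 2, .inl (j, c, k), x, h => by
    have hc := (ball_two_iff x).2.1 (Metric.sphere_subset_closedBall h)
    have hb : ¬(|x 0| < 1 ∧ |x 1| < 1) := fun hb =>
      Metric.sphere_disjoint_ball.le_bot ⟨h, (ball_two_iff x).1.2 hb⟩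
    have hu : (1 + x 1) / 2 ∈ Icc (0 : ℝ) 1 := by
      have := abs_le.1 hc.2
      constructor <;> linarith
    rcases hc.1.lt_or_eq with h1 | h1
    · have h2 : |x 1| = 1 := hc.2.lt_or_eq.resolve_left fun h2 => hb ⟨h1, h2⟩
      have hv : ∀ k, (Addr.neck (A := A) j c k (x 0) 0).Valid :=
        fun k => ⟨⟨le_rfl, one_pos⟩, abs_lt.1 h1⟩
      have hd : ∀ k, (Addr.neck (A := A) j c k (x 0) 0).dim < 2 := fun k => by simp [Addr.dim]
      rcases (abs_eq one_pos.le).1 h2 with h2 | h2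
      · refine ⟨_, hv (k + 1), hd _, ?_⟩
        simp only [cellAddr, Addr.pos, h2]
        rw [← neckPt_side_one]
        norm_num
      · refine ⟨_, hv k, hd _, ?_⟩
        simp only [cellAddr, Addr.pos, h2]
        norm_num
    · obtain ⟨i, hi, he, -⟩ := neckPt_one (A := A) (j := j) (by omega) (ctr c) k h1 hu
      obtain ⟨α, k1, k2, k3, -⟩ := exists_boundary_addr hi j (ctr c) (taxi_side k hu)
      refine ⟨α, k1, by omega, ?_⟩
      rw [k2, ← he]
      rfl
  | 2, .inr (b, c), x, h => by
    have hc := (ball_two_iff x).2.1 (Metric.sphere_subset_closedBall h)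
    have hb : ¬(|x 0| < 1 ∧ |x 1| < 1) := fun hb =>
      Metric.sphere_disjoint_ball.le_bot ⟨h, (ball_two_iff x).1.2 hb⟩
    have ht : taxi ((x 0 + x 1) / 2, (x 0 - x 1) / 2) = 1 := by
      refine le_antisymm (taxi_rotate_le _ _ hc.1 hc.2) (not_lt.1 fun hlt => hb ?_)
      simp only [taxi] at hlt
      have e1 : x 0 = (x 0 + x 1) / 2 + (x 0 - x 1) / 2 := by ring
      have e2 : x 1 = (x 0 + x 1) / 2 - (x 0 - x 1) / 2 := by ring
      constructor
      · conv_lhs => rw [e1]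
        exact (abs_add_le _ _).trans_lt hlt
      · conv_lhs => rw [e2]
        exact (abs_sub _ _).trans_lt hlt
    have hN := A.two_le
    cases b
    · obtain ⟨α, k1, k2, k3, -⟩ := exists_boundary_addr (A := A) (i := 0) (by omega) (-1) (ctr c) ht
      exact ⟨α, k1, by omega, k2⟩
    · obtain ⟨α, k1, k2, k3, -⟩ :=
        exists_boundary_addr (A := A) (i := A.N - 1) (by omega) (A.N - 1) (ctr c) ht
      exact ⟨α, k1, by omega, k2⟩

theorem continuous_len : Continuous A.len := by
  unfold len
  fun_prop

theorem continuous_pt (σ : ℤ) (c : ℤ × ℤ) {α : Type*} [TopologicalSpace α] {s : Set α}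
    {f : α → ℝ × ℝ} {g : α → ℝ} (hf : ContinuousOn f s) (hg : ContinuousOn g s) :
    ContinuousOn (fun x => A.pt σ c (f x) (g x)) s := by
  unfold pt
  fun_prop

theorem continuousOn_neckPt {j : ℕ} (hj : j + 1 < A.N) (c : ℤ × ℤ) (k : Fin 4) :
    ContinuousOn (fun v : ℝ × ℝ => A.neckPt j c k v.1 v.2) (Icc (-1) 1 ×ˢ Icc 0 1) := by
  have hside : Continuous fun v : ℝ × ℝ => side k v.2 := (continuous_side k).comp continuous_snd
  have hlen : Continuous fun v : ℝ × ℝ => A.len (side k v.2) := continuous_len.comp hside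
  have hrad : ∀ f : ℝ → ℝ, Continuous f → Continuous fun v : ℝ × ℝ => A.rad j k (f v.1) v.2 := by
    intro f hf
    unfold rad
    fun_prop
  have hmin : ∀ s ∈ Icc (-1 : ℝ) 1, min s 0 ∈ Icc (-1 : ℝ) 1 ∧ max s 0 ∈ Icc (-1 : ℝ) 1 :=
    fun s hs => ⟨⟨le_min hs.1 (by norm_num), (min_le_left _ _).trans hs.2⟩,
      ⟨hs.1.trans (le_max_left _ _), max_le hs.2 zero_le_one⟩⟩
  unfold neckPt
  refine continuous_pt _ _ ?_ ?_
  · refine ContinuousOn.smul (ContinuousOn.div (hrad _ continuous_id).continuousOn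
      hlen.continuousOn fun v hv => ?_) hside.continuousOn
    exact (A.r₀_pos.trans (r₀_lt_len_side k hv.2)).ne'
  · unfold neckHgt
    refine ContinuousOn.sub (ContinuousOn.add ?_ ?_) continuousOn_const
    · exact (A.dn_cont j hj).comp (hrad _ (continuous_id.min continuous_const)).continuousOn
        fun v hv => (le_rad hj.le k (hmin _ hv.1).1 hv.2).1
    · exact (A.up_cont (j + 1) (by omega) hj).comp
        (hrad _ (continuous_id.max continuous_const)).continuousOn
        fun v hv => (le_rad hj.le k (hmin _ hv.1).2 hv.2).1

theorem cellAddr_continuousOn : ∀ (n : ℕ) (i : A.cellIdx n),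
    ContinuousOn (fun x => Phi (cellAddr n i x).pos) (Metric.closedBall 0 1) := by
  intro n i
  refine contDiff_Phi.continuous.comp_continuousOn ?_
  rcases n with _ | _ | _ | n
  · exact continuousOn_const
  · rcases i with ⟨j, c, k⟩ | ⟨j, c, k⟩
    · simp only [cellAddr, Addr.pos, linePt]
      refine continuous_pt _ _ (Continuous.continuousOn ?_) continuousOn_const
      exact (continuous_side k).comp (by fun_prop)
    · simp only [cellAddr, Addr.pos]
      refine (continuousOn_neckPt (j := j) (by omega) (ctr c) k).comp
        (f := fun x : Fin 1 → ℝ => (x 0, (0 : ℝ))) (by fun_prop) fun x hx => ?_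
      exact ⟨abs_le.1 ((ball_one_iff x).2.1.1 hx), le_rfl, zero_le_one⟩
  · rcases i with ⟨j, c, k⟩ | ⟨b, c⟩
    · simp only [cellAddr, Addr.pos]
      refine (continuousOn_neckPt (j := j) (by omega) (ctr c) k).comp
        (f := fun x : Fin 2 → ℝ => (x 0, (1 + x 1) / 2)) (by fun_prop) fun x hx => ?_
      have h := (ball_two_iff x).2.1 hx
      have := abs_le.1 h.2
      exact ⟨abs_le.1 h.1, by simp only; linarith, by simp only; linarith⟩
    · cases b <;> simp only [cellAddr, Addr.pos, cond_true, cond_false] <;>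
        exact continuous_pt _ _ (by fun_prop) continuousOn_const
  · exact i.elim

theorem cellAddr_mem : ∀ (n : ℕ) (i : A.cellIdx n), ∀ x ∈ Metric.closedBall (0 : Fin n → ℝ) 1,
    (cellAddr n i x).pos ∈ A.lifted
  | 0, (j, c, k), x, _ => linePt_mem j.2 _ _ ⟨le_rfl, zero_le_one⟩
  | 1, .inl (j, c, k), x, h => by
    have h1 := abs_le.1 ((ball_one_iff x).2.1.1 h)
    exact linePt_mem j.2 _ _ ⟨by linarith, by linarith⟩
  | 1, .inr (j, c, k), x, h =>
    neckPt_mem (j := j) (by omega) _ k (abs_le.1 ((ball_one_iff x).2.1.1 h)) ⟨le_rfl, zero_le_one⟩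
  | 2, .inl (j, c, k), x, h => by
    have h1 := (ball_two_iff x).2.1 h
    have := abs_le.1 h1.2
    exact neckPt_mem (j := j) (by omega) _ k (abs_le.1 h1.1) ⟨by linarith, by linarith⟩
  | 2, .inr (true, c), x, h =>
    have h1 := (ball_two_iff x).2.1 h
    top_mem (ctr c) (taxi_rotate_le _ _ h1.1 h1.2)
  | 2, .inr (false, c), x, h =>
    have h1 := (ball_two_iff x).2.1 h
    bottom_mem (ctr c) (taxi_rotate_le _ _ h1.1 h1.2)

instance finite_cellIdx : ∀ n, Finite (A.cellIdx n)
  | 0 => inferInstanceAs (Finite (Fin A.N × A.Box × {k : Fin 4 // k = 0 ∨ k = 1}))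
  | 1 => inferInstanceAs
      (Finite ((Fin A.N × A.Box × Fin 4) ⊕ (Fin (A.N - 1) × A.Box × Fin 4)))
  | 2 => inferInstanceAs (Finite ((Fin (A.N - 1) × A.Box × Fin 4) ⊕ (Bool × A.Box)))
  | _ + 3 => inferInstanceAs (Finite Empty)

theorem card_cellIdx : Nat.card (A.cellIdx 0) = A.N * (A.p * A.q * 2) ∧
    Nat.card (A.cellIdx 1) = A.N * (A.p * A.q * 4) + (A.N - 1) * (A.p * A.q * 4) ∧
    Nat.card (A.cellIdx 2) = (A.N - 1) * (A.p * A.q * 4) + 2 * (A.p * A.q) := by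
  have h2 : Nat.card {k : Fin 4 // k = 0 ∨ k = 1} = 2 := by
    rw [Nat.card_eq_fintype_card]
    decide
  have h3 : ∀ n : ℕ, Nat.card (Finset.Ico (0 : ℤ) n) = n := by
    intro n
    rw [Nat.card_eq_fintype_card, Fintype.card_coe, Int.card_Ico]
    simp
  have h4 : Nat.card Bool = 2 := by
    rw [Nat.card_eq_fintype_card]
    rfl
  refine ⟨?_, ?_, ?_⟩ <;>
    simp only [cellIdx, Nat.card_sum, Nat.card_prod, h2, h3, h4, Nat.card_fin]

/-- With `Q = p q` axes for each neck and `M = N - 1` necks the Euler characteristic is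
`2 N Q - (4 N Q + 4 M Q) + (4 M Q + 2 Q) = -2 M Q`. -/
theorem hasGenus (A : Stack) : HasGenus A.surf (A.p * A.q * (A.N - 1) + 1) := by
  refine hasGenus_of_cells A.cellIdx (fun n i x => Phi (cellAddr n i x).pos) finite_cellIdx ?_
    cellAddr_continuousOn ?_ ?_ ?_ ?_ ?_
  · intro n hn
    obtain ⟨k, rfl⟩ : ∃ k, n = k + 3 := ⟨n - 3, by omega⟩
    exact inferInstanceAs (IsEmpty Empty)
  · intro n i n' i' x hx x' hx' h
    exact cellAddr_inj hx hx' (Addr.pos_inj (cellAddr_valid n i x hx).1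
      (cellAddr_valid n' i' x' hx').1 h)
  · intro n i x hx
    exact ⟨_, cellAddr_mem n i x hx, rfl⟩
  · intro p hp
    obtain ⟨α, hα, rfl⟩ := exists_addr hp
    obtain ⟨i, x, hx, he⟩ := exists_cell hα
    exact ⟨α.dim, i, x, hx, by rw [he]⟩
  · intro n i x hx
    obtain ⟨α, hα, hn, he⟩ := exists_boundary n i x hx
    obtain ⟨i', x', hx', he'⟩ := exists_cell hα
    exact ⟨α.dim, hn, i', x', hx', by rw [he', he]⟩
  · obtain ⟨h0, h1, h2⟩ := card_cellIdx (A := A)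
    obtain ⟨M, hM⟩ : ∃ M, A.N = M + 1 := ⟨A.N - 1, by have := A.two_le; omega⟩
    rw [h0, h1, h2, hM, Nat.add_sub_cancel]
    push_cast
    ring

end Stack

namespace Stack

variable {A : Stack}

/-! ### Connectedness -/

theorem joinedIn_of_convex {F : Type*} [AddCommGroup F] [Module ℝ F] [TopologicalSpace F]
    [ContinuousAdd F] [ContinuousSMul ℝ F] {C : Set F} (hC : Convex ℝ C) {f : F → ℝ × ℝ × ℝ}
    (hf : ContinuousOn f C) (hm : ∀ x ∈ C, f x ∈ A.lifted) {x y : F} (hx : x ∈ C) (hy : y ∈ C) :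
    JoinedIn A.surf (Phi (f x)) (Phi (f y)) := by
  have h1 := (hC.isPathConnected ⟨x, hx⟩).image' (contDiff_Phi.continuous.comp_continuousOn hf)
  exact (h1.joinedIn _ (mem_image_of_mem _ hx) _ (mem_image_of_mem _ hy)).mono
    (by rintro - ⟨v, hv, rfl⟩; exact mem_image_of_mem _ (hm v hv))

variable (A) in
/-- The right vertex of the diamond around an axis of neck `j + 1`, at level `j`. -/
noncomputable def vertex (j : ℕ) (c : ℤ × ℤ) : ℝ × ℝ × ℝ := A.pt j c (1, 0) (A.T j)

theorem joinedIn_line {j : ℕ} (hj : j < A.N) (c : ℤ × ℤ) {a : ℝ × ℝ} (ha : taxi a = 1) :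
    JoinedIn A.surf (Phi (A.vertex j c)) (Phi (A.pt j c a (A.T j))) := by
  have h0 : (0 : ℝ) ∈ Icc (0 : ℝ) 1 := ⟨le_rfl, zero_le_one⟩
  have key : ∀ k, ∀ u ∈ Icc (0 : ℝ) 1,
      JoinedIn A.surf (Phi (A.linePt j c k 0)) (Phi (A.linePt j c k u)) := fun k u hu =>
    joinedIn_of_convex (convex_Icc 0 1)
      (continuous_pt _ _ (continuous_side k).continuousOn continuousOn_const)
      (fun v hv => linePt_mem hj c k hv) h0 hu
  have succ : ∀ k, JoinedIn A.surf (Phi (A.linePt j c k 0)) (Phi (A.linePt j c (k + 1) 0)) := by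
    intro k
    have := key k 1 ⟨zero_le_one, le_rfl⟩
    simp only [linePt, side_one, side_zero] at this ⊢
    exact this
  have all : ∀ k, JoinedIn A.surf (Phi (A.linePt j c 0 0)) (Phi (A.linePt j c k 0)) := by
    intro k
    have := succ 0
    have := this.trans (succ 1)
    have := this.trans (succ 2)
    fin_cases k
    · exact key 0 0 h0
    · exact succ 0
    · exact (succ 0).trans (succ 1)
    · exact this
  obtain ⟨k, u, hu, he⟩ := exists_side (a := a) (by rw [ha]; exact one_pos)
  rw [ha, one_smul] at he
  have h1 := (all k).trans (key k u ⟨hu.1, hu.2.le⟩)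
  simp only [linePt, side_zero, ← he] at h1
  exact h1

/-- The diamonds around neighbouring axes share a corner. -/
theorem joinedIn_vertex {j : ℕ} (hj : j < A.N) (c : ℤ × ℤ) :
    JoinedIn A.surf (Phi (A.vertex j 0)) (Phi (A.vertex j c)) := by
  have t1 : taxi (-1, 0) = 1 := by simp [taxi]
  have t2 : taxi (0, 1) = 1 := by simp [taxi]
  have t3 : taxi (0, -1) = 1 := by simp [taxi]
  have right : ∀ n m : ℤ,
      JoinedIn A.surf (Phi (A.vertex j (n, m))) (Phi (A.vertex j (n + 1, m))) := by
    intro n m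
    have h := joinedIn_line hj (n + 1, m) t1
    have e : A.pt j (n + 1, m) (-1, 0) (A.T j) = A.vertex j (n, m) := by
      simp only [vertex, pt]
      push_cast
      refine Prod.ext ?_ (Prod.ext ?_ rfl) <;> ring
    rw [e] at h
    exact h.symm
  have up : ∀ n m : ℤ,
      JoinedIn A.surf (Phi (A.vertex j (n, m))) (Phi (A.vertex j (n, m + 1))) := by
    intro n m
    have h := joinedIn_line hj (n, m + 1) t3
    have h' := joinedIn_line hj (n, m) t2
    have e : A.pt j (n, m + 1) (0, -1) (A.T j) = A.pt j (n, m) (0, 1) (A.T j) := by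
      simp only [pt]
      push_cast
      refine Prod.ext ?_ (Prod.ext ?_ rfl) <;> ring
    rw [e] at h
    exact h'.trans h.symm
  have h0 := joinedIn_line hj 0 (a := (1, 0)) (by simp [taxi])
  have h1 : ∀ n : ℤ, JoinedIn A.surf (Phi (A.vertex j 0)) (Phi (A.vertex j (n, 0))) := by
    intro n
    induction n using Int.induction_on with
    | zero => exact h0
    | succ n ih => exact ih.trans (right n 0)
    | pred n ih =>
      have := right (-n - 1) 0
      rw [sub_add_cancel] at this
      exact ih.trans this.symm
  obtain ⟨n, m⟩ := c
  induction m using Int.induction_on with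
  | zero => exact h1 n
  | succ m ih => exact ih.trans (up n m)
  | pred m ih =>
    have := up n (-m - 1)
    rw [sub_add_cancel] at this
    exact ih.trans this.symm

theorem joinedIn_boundary {i : ℕ} (hi : i < A.N) (σ : ℤ) (c : ℤ × ℤ) {a : ℝ × ℝ}
    (ha : taxi a = 1) :
    JoinedIn A.surf (Phi (A.vertex i 0)) (Phi (A.pt σ c a (A.T i))) := by
  obtain ⟨c', a', h1, -, h3⟩ := exists_line_pt (A := A) i σ c ha
  rw [h3]
  exact (joinedIn_vertex hi c').trans (joinedIn_line hi c' h1)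

theorem joinedIn_neck {j : ℕ} (hj : j + 1 < A.N) (c : ℤ × ℤ) (k : Fin 4) {s s' u : ℝ}
    (hs : s ∈ Icc (-1 : ℝ) 1) (hs' : s' ∈ Icc (-1 : ℝ) 1) (hu : u ∈ Icc (0 : ℝ) 1) :
    JoinedIn A.surf (Phi (A.neckPt j c k s u)) (Phi (A.neckPt j c k s' u)) :=
  joinedIn_of_convex (f := fun s => A.neckPt j c k s u) (convex_Icc (-1) 1)
    ((continuousOn_neckPt hj c k).comp (f := fun s => (s, u)) (by fun_prop) fun _ hv => ⟨hv, hu⟩)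
    (fun _ hv => neckPt_mem hj c k hv hu) hs hs'

theorem joinedIn_level {j : ℕ} (hj : j < A.N) :
    JoinedIn A.surf (Phi (A.vertex 0 0)) (Phi (A.vertex j 0)) := by
  induction j with
  | zero => exact joinedIn_vertex hj 0
  | succ j ih =>
    have h0 : (0 : ℝ) ∈ Icc (0 : ℝ) 1 := ⟨le_rfl, zero_le_one⟩
    obtain ⟨i, hi, h1, h2, -⟩ := neckPt_one hj 0 0 (s := -1) (by simp) h0
    obtain ⟨i', hi', h1', -, h2'⟩ := neckPt_one hj 0 0 (s := 1) (by simp) h0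
    obtain rfl := h2 rfl
    obtain rfl := h2' rfl
    have h3 := joinedIn_neck hj 0 0 (s := -1) (s' := 1) (by simp) (by simp) h0
    rw [h1, h1'] at h3
    exact (ih (by omega)).trans ((joinedIn_boundary hi i 0 (taxi_side 0 h0)).trans
      (h3.trans (joinedIn_boundary hi' i 0 (taxi_side 0 h0)).symm))

theorem convex_taxi : Convex ℝ {a : ℝ × ℝ | taxi a ≤ 1} := by
  intro a ha b hb s t hs ht hst
  simp only [mem_ofPred_eq, taxi, Prod.fst_add, Prod.snd_add, Prod.smul_fst, Prod.smul_snd,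
    smul_eq_mul] at *
  have h1 := abs_add_le (s * a.1) (t * b.1)
  have h2 := abs_add_le (s * a.2) (t * b.2)
  rw [abs_mul, abs_mul, abs_of_nonneg hs, abs_of_nonneg ht] at h1 h2
  nlinarith

theorem joinedIn_cap {i : ℕ} (hi : i < A.N) (σ : ℤ) (c : ℤ × ℤ)
    (hm : ∀ a : ℝ × ℝ, taxi a ≤ 1 → A.pt σ c a (A.T i) ∈ A.lifted) {a : ℝ × ℝ} (ha : taxi a ≤ 1) :
    JoinedIn A.surf (Phi (A.vertex i 0)) (Phi (A.pt σ c a (A.T i))) := by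
  have h1 : taxi (1, 0) = 1 := by simp [taxi]
  exact (joinedIn_boundary hi σ c h1).trans (joinedIn_of_convex
    (f := fun a => A.pt σ c a (A.T i)) convex_taxi
    (continuous_pt _ _ continuousOn_id continuousOn_const) hm h1.le ha)

theorem isConnected (A : Stack) : IsConnected A.surf := by
  have hN := A.two_le
  suffices h : ∀ p ∈ A.surf, JoinedIn A.surf (Phi (A.vertex 0 0)) p by
    have h0 := joinedIn_vertex (A := A) (j := 0) (by omega) 0
    exact IsPathConnected.isConnected ⟨_, h0.source_mem, fun {p} hp => h p hp⟩
  rintro - ⟨w, hw, rfl⟩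
  rcases lifted_cases hw with ⟨j, hj, c, k, u, hu, s, hs, rfl⟩ | ⟨j, hj, c, k, u, hu, rfl⟩ |
    ⟨c, a, ha, rfl⟩ | ⟨c, a, ha, rfl⟩
  · have hu' : u ∈ Icc (0 : ℝ) 1 := ⟨hu.1, hu.2.le⟩
    obtain ⟨i, hi, h1, -⟩ := neckPt_one hj c k (s := -1) (by simp) hu'
    have h3 := joinedIn_neck hj c k (s := -1) (by simp) (Ioo_subset_Icc_self hs) hu'
    rw [h1] at h3
    exact (joinedIn_level hi).trans ((joinedIn_boundary hi j c (taxi_side k hu')).trans h3)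
  · exact (joinedIn_level hj).trans
      (joinedIn_boundary hj j c (taxi_side k ⟨hu.1, hu.2.le⟩))
  · exact joinedIn_cap (by omega) (-1) c (fun a ha => bottom_mem c ha) ha.le
  · exact (joinedIn_level (by omega)).trans
      (joinedIn_cap (i := A.N - 1) (by omega) (A.N - 1) c (fun a ha => top_mem c ha) ha.le)

end Stack

/-! ### Half-catenoids bent to planes: the radial profile -/

section

variable {Ψ : ℝ → ℝ} {R τ H r : ℝ}

theorem StackedTori.IsCutoff.nonneg (hΨ : IsCutoff Ψ) (t : ℝ) : 0 ≤ Ψ t := by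
  rw [← hΨ.zero (min t (-1)) (min_le_right _ _)]
  exact hΨ.mono (min_le_left _ _)

theorem StackedTori.IsCutoff.le_one (hΨ : IsCutoff Ψ) (t : ℝ) : Ψ t ≤ 1 := by
  rw [← hΨ.one (max t 1) (le_max_right _ _)]
  exact hΨ.mono (le_max_left _ _)

/-- The cutoff `ψ[R, 2R]` is constant for `r ≤ 4R/3` and for `r ≥ 5R/3`. -/
theorem cutoff_zero (hΨ : IsCutoff Ψ) (hR : 0 < R) (hr : r ≤ 4 / 3 * R) :
    cutoff Ψ R (2 * R) r = 0 := by
  refine hΨ.zero _ ?_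
  have : 6 * (r - R) / (2 * R - R) ≤ 2 := (div_le_iff₀ (by linarith)).2 (by linarith)
  linarith

theorem cutoff_one (hΨ : IsCutoff Ψ) (hR : 0 < R) (hr : 5 / 3 * R ≤ r) :
    cutoff Ψ R (2 * R) r = 1 := by
  refine hΨ.one _ ?_
  have : 4 ≤ 6 * (r - R) / (2 * R - R) := (le_div_iff₀ (by linarith)).2 (by linarith)
  linarith

theorem cutoff_swap (hΨ : IsCutoff Ψ) (hR : 0 < R) (r : ℝ) :
    cutoff Ψ (2 * R) R r = 1 - cutoff Ψ R (2 * R) r := by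
  unfold cutoff
  have e : -3 + 6 * (r - 2 * R) / (R - 2 * R) = -(-3 + 6 * (r - R) / (2 * R - R)) := by
    have : R - 2 * R = -R := by ring
    have : 2 * R - R = R := by ring
    simp only [*]
    field_simp
    ring
  rw [e]
  linarith [hΨ.odd (-3 + 6 * (r - R) / (2 * R - R))]

theorem contDiff_cutoff (hΨ : IsCutoff Ψ) (R : ℝ) : ContDiff ℝ ∞ (cutoff Ψ R (2 * R)) := by
  unfold cutoff
  exact hΨ.smooth.comp (by fun_prop)

variable (Ψ R τ H) in
/-- The height above the waist of an upper half-catenoid of radius `τ` that is bent to the plane at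
height `H`, as a function of the distance to the axis. -/
noncomputable def bent (r : ℝ) : ℝ :=
  (1 - cutoff Ψ R (2 * R) r) * (τ * arcosh (r / τ)) + cutoff Ψ R (2 * R) r * H

theorem profile_of_lt (hΨ : IsCutoff Ψ) (hR : 0 < R) {zK zT : ℝ} (h : zK < zT) (x y : ℝ) :
    profile Ψ zK zT R τ x y = zK + bent Ψ R τ (zT - zK) √(x ^ 2 + y ^ 2) := by
  rw [profile, cutoff_swap hΨ hR, sgn, if_pos (by linarith), bent]
  ring

theorem profile_of_gt (hΨ : IsCutoff Ψ) (hR : 0 < R) {zK zT : ℝ} (h : zT < zK) (x y : ℝ) :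
    profile Ψ zK zT R τ x y = zK - bent Ψ R τ (zK - zT) √(x ^ 2 + y ^ 2) := by
  rw [profile, cutoff_swap hΨ hR, sgn, if_neg (by linarith), bent]
  ring

theorem bent_far (hΨ : IsCutoff Ψ) (hR : 0 < R) (hr : 5 / 3 * R ≤ r) : bent Ψ R τ H r = H := by
  rw [bent, cutoff_one hΨ hR hr]
  ring

theorem bent_near (hΨ : IsCutoff Ψ) (hR : 0 < R) (hr : r ≤ 4 / 3 * R) :
    bent Ψ R τ H r = τ * arcosh (r / τ) := by
  rw [bent, cutoff_zero hΨ hR hr]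
  ring

theorem bent_waist (hΨ : IsCutoff Ψ) (hτ : 0 < τ) (hτR : τ < R) : bent Ψ R τ H τ = 0 := by
  rw [bent_near hΨ (hτ.trans hτR) (by linarith), div_self hτ.ne', arcosh_zero, mul_zero]

theorem bent_mem (hΨ : IsCutoff Ψ) (hτ : 0 < τ) (hτR : τ < R) (hH : 0 < H) {B : ℝ} (hB : H < B)
    (hB' : τ * arcosh (2 * R / τ) < B) (hr : τ < r) : bent Ψ R τ H r ∈ Ioo 0 B := by
  have hR := hτ.trans hτR
  rcases le_or_gt (5 / 3 * R) r with h | h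
  · rw [bent_far hΨ hR h]
    exact ⟨hH, hB⟩
  have h1 : 1 < r / τ := (one_lt_div hτ).2 hr
  have h2 := mul_pos hτ (arcosh_pos h1)
  have h3 : τ * arcosh (r / τ) < B := by
    refine lt_of_le_of_lt (mul_le_mul_of_nonneg_left ?_ hτ.le) hB'
    rw [arcosh_le_arcosh (by linarith) (by positivity)]
    gcongr
    linarith
  have h4 := hΨ.nonneg (-3 + 6 * (r - R) / (2 * R - R))
  have h5 := hΨ.le_one (-3 + 6 * (r - R) / (2 * R - R))
  change 0 ≤ cutoff Ψ R (2 * R) r at h4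
  change cutoff Ψ R (2 * R) r ≤ 1 at h5
  unfold bent
  rcases h4.eq_or_lt with h6 | h6
  · rw [← h6]
    constructor <;> linarith
  · have h7 := mul_nonneg (sub_nonneg.2 h5) h2.le
    have h8 := mul_le_mul_of_nonneg_left h3.le (sub_nonneg.2 h5)
    have h9 := mul_pos h6 hH
    have h10 := mul_lt_mul_of_pos_left hB h6
    constructor <;> linarith

theorem bent_smooth (hΨ : IsCutoff Ψ) (hτ : 0 < τ) : ContDiffOn ℝ ∞ (bent Ψ R τ H) (Ioi τ) := by
  unfold bent
  have h1 := (contDiff_cutoff hΨ R).contDiffOn (s := Ioi τ)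
  have h2 : ContDiffOn ℝ ∞ (fun r => arcosh (r / τ)) (Ioi τ) :=
    contDiffOn_arcosh.comp (contDiff_id.div_const τ).contDiffOn fun r hr => (one_lt_div hτ).2 hr
  exact ((contDiffOn_const.sub h1).mul (contDiffOn_const.mul h2)).add (h1.mul contDiffOn_const)

theorem bent_cont (hΨ : IsCutoff Ψ) (hτ : 0 < τ) : ContinuousOn (bent Ψ R τ H) (Ici τ) := by
  unfold bent
  have h1 := (contDiff_cutoff hΨ R).continuous.continuousOn (s := Ici τ)
  have h2 : ContinuousOn (fun r => arcosh (r / τ)) (Ici τ) :=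
    continuousOn_arcosh.comp (continuous_id.div_const τ).continuousOn
      fun r hr => (one_le_div hτ).2 hr
  exact ((continuousOn_const.sub h1).mul (continuousOn_const.mul h2)).add (h1.mul continuousOn_const)

/-- Near the waist the surface is a catenoid. -/
theorem bent_cat (hΨ : IsCutoff Ψ) (hτ : 0 < τ) (hτR : τ < R) (hH : 0 < H) : ∃ ε > 0,
    (∀ r, τ ≤ r → bent Ψ R τ H r < ε → r = τ * cosh (bent Ψ R τ H r / τ)) ∧
    ∀ s, 0 ≤ s → τ * s < ε → bent Ψ R τ H (τ * cosh s) = τ * s ∧ τ * cosh s < 2 * R := by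
  have hR := hτ.trans hτR
  have h1 : 1 < 4 / 3 * R / τ := (one_lt_div hτ).2 (by linarith)
  have hA := mul_pos hτ (arcosh_pos h1)
  refine ⟨min (τ * arcosh (4 / 3 * R / τ)) H, lt_min hA hH, fun r hr hb => ?_, fun s hs hb => ?_⟩
  · have h2 : 1 ≤ r / τ := (one_le_div hτ).2 hr
    rcases le_or_gt r (4 / 3 * R) with h | h
    · rw [bent_near hΨ hR h, mul_div_cancel_left₀ _ hτ.ne', cosh_arcosh h2, mul_div_cancel₀ _ hτ.ne']
    · exfalso
      have h3 : τ * arcosh (4 / 3 * R / τ) ≤ τ * arcosh (r / τ) := by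
        refine mul_le_mul_of_nonneg_left ?_ hτ.le
        rw [arcosh_le_arcosh (by linarith) (by linarith)]
        gcongr
      have h4 : 0 ≤ cutoff Ψ R (2 * R) r := hΨ.nonneg _
      have h5 : cutoff Ψ R (2 * R) r ≤ 1 := hΨ.le_one _
      have h6 := mul_le_mul_of_nonneg_left ((min_le_left _ H).trans h3) (sub_nonneg.2 h5)
      have h7 := mul_le_mul_of_nonneg_left (min_le_right (τ * arcosh (4 / 3 * R / τ)) H) h4
      unfold bent at hb
      linarith
  · have h2 : s < arcosh (4 / 3 * R / τ) :=
      lt_of_mul_lt_mul_left (hb.trans_le (min_le_left _ _)) hτ.le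
    have h3 : cosh s < 4 / 3 * R / τ := by
      rw [← cosh_arcosh h1.le, cosh_lt_cosh, abs_of_nonneg hs]
      exact h2.trans_le (le_abs_self _)
    have h4 : τ * cosh s < 4 / 3 * R := by
      rw [lt_div_iff₀ hτ] at h3
      linarith
    rw [bent_near hΨ hR h4.le, mul_div_cancel_left₀ _ hτ.ne', arcosh_cosh hs]
    exact ⟨rfl, by linarith⟩

end

/-! ### The stack of an initial surface -/

/-- Waist radii `τ j` and heights of waists `K j` and levels `T j` in good order. The values `K 0`
and `K N` only delimit the range of heights. -/
structure GoodHeights (N p q : ℕ) (R : ℝ) (τ K T : ℕ → ℝ) : Prop where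
  two_le : 2 ≤ N
  p_pos : 0 < p
  q_pos : 0 < q
  R_lt_p : 2 * R < per / (2 * p) / 2
  R_lt_q : 2 * R < per / (2 * q) / 2
  R_pos : 0 < R
  τ_pos : ∀ j, 0 < j → j < N → 0 < τ j
  τ_lt : ∀ j, 0 < j → j < N → τ j < R
  K_zero : -(π / 4) ≤ K 0
  K_last : K N ≤ π / 4
  lt_T : ∀ j < N, K j < T j
  T_lt : ∀ j < N, T j < K (j + 1)
  up_lt : ∀ j, 0 < j → j < N → τ j * arcosh (2 * R / τ j) < K (j + 1) - K j
  dn_lt : ∀ j, j + 1 < N → τ (j + 1) * arcosh (2 * R / τ (j + 1)) < K (j + 1) - K j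

namespace GoodHeights

variable {Ψ : ℝ → ℝ} {N p q : ℕ} {R : ℝ} {τ K T : ℕ → ℝ}

theorem bent_up_mem (h : GoodHeights N p q R τ K T) (hΨ : IsCutoff Ψ) {j : ℕ} (h0 : 0 < j)
    (hj : j < N) {r : ℝ} (hr : τ j < r) :
    bent Ψ R (τ j) (T j - K j) r ∈ Ioo 0 (K (j + 1) - K j) :=
  bent_mem hΨ (h.τ_pos j h0 hj) (h.τ_lt j h0 hj) (sub_pos.2 (h.lt_T j hj))
    (by linarith [h.T_lt j hj]) (h.up_lt j h0 hj) hr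

theorem bent_dn_mem (h : GoodHeights N p q R τ K T) (hΨ : IsCutoff Ψ) {j : ℕ} (hj : j + 1 < N)
    {r : ℝ} (hr : τ (j + 1) < r) :
    bent Ψ R (τ (j + 1)) (K (j + 1) - T j) r ∈ Ioo 0 (K (j + 1) - K j) :=
  bent_mem hΨ (h.τ_pos _ (by omega) hj) (h.τ_lt _ (by omega) hj)
    (sub_pos.2 (h.T_lt j (by omega))) (by linarith [h.lt_T j (by omega)]) (h.dn_lt j hj) hr

/-- The stack with the given radii and heights, with catenoidal necks. -/
noncomputable def stack (h : GoodHeights N p q R τ K T) (hΨ : IsCutoff Ψ) : Stack where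
  N := N
  p := p
  q := q
  r₀ := 2 * R
  r₁ := 5 / 3 * R
  t j := if 0 < j ∧ j < N then τ j else -1
  K := K
  T := T
  up j r := if j = 0 then T 0 else K j + bent Ψ R (τ j) (T j - K j) r
  dn j r := if j + 1 < N then K (j + 1) - bent Ψ R (τ (j + 1)) (K (j + 1) - T j) r else T j
  two_le := h.two_le
  p_pos := h.p_pos
  q_pos := h.q_pos
  r₁_pos := by linarith [h.R_pos]
  r₁_lt := by linarith [h.R_pos]
  r₀_lt_p := h.R_lt_p
  r₀_lt_q := h.R_lt_q
  t_pos j h0 hj := by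
    rw [if_pos ⟨h0, hj⟩]
    exact h.τ_pos j h0 hj
  t_lt j _ := by
    split_ifs with h1
    · linarith [h.τ_lt j h1.1 h1.2, h.R_pos]
    · linarith [h.R_pos]
  t_zero := by simp
  t_last := by simp
  K_zero := h.K_zero
  K_last := h.K_last
  lt_T := h.lt_T
  T_lt := h.T_lt
  up_far j hj r hr := by
    split_ifs with h1
    · rw [h1]
    · rw [bent_far hΨ h.R_pos hr]; ring
  dn_far j hj r hr := by
    split_ifs with h1
    · rw [bent_far hΨ h.R_pos hr]; ring
    · rfl
  up_zero r := if_pos rfl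
  dn_last r := if_neg (by have := h.two_le; omega)
  up_waist j h0 hj := by
    rw [if_neg h0.ne', if_pos ⟨h0, hj⟩, bent_waist hΨ (h.τ_pos j h0 hj) (h.τ_lt j h0 hj), add_zero]
  dn_waist j hj := by
    rw [if_pos hj, if_pos ⟨Nat.succ_pos j, hj⟩, bent_waist hΨ (h.τ_pos _ (by omega) hj)
      (h.τ_lt _ (by omega) hj), sub_zero]
  up_mem j hj r hr := by
    split_ifs with h1
    · subst h1
      exact ⟨h.lt_T 0 hj, h.T_lt 0 hj⟩
    · have h0 : 0 < j := Nat.pos_of_ne_zero h1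
      rw [if_pos ⟨h0, hj⟩] at hr
      have := h.bent_up_mem hΨ h0 hj hr
      constructor <;> linarith [this.1, this.2]
  dn_mem j hj r hr := by
    split_ifs with h1
    · rw [if_pos ⟨Nat.succ_pos j, h1⟩] at hr
      have := h.bent_dn_mem hΨ h1 hr
      constructor <;> linarith [this.1, this.2]
    · exact ⟨h.lt_T j hj, h.T_lt j hj⟩
  up_smooth j h0 hj := by
    simp only [if_neg h0.ne', if_pos (And.intro h0 hj)]
    exact contDiffOn_const.add (bent_smooth hΨ (h.τ_pos j h0 hj))
  dn_smooth j hj := by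
    simp only [if_pos hj, if_pos (And.intro (Nat.succ_pos j) hj)]
    exact contDiffOn_const.sub (bent_smooth hΨ (h.τ_pos _ (by omega) hj))
  up_cont j h0 hj := by
    simp only [if_neg h0.ne', if_pos (And.intro h0 hj)]
    exact continuousOn_const.add (bent_cont hΨ (h.τ_pos j h0 hj))
  dn_cont j hj := by
    simp only [if_pos hj, if_pos (And.intro (Nat.succ_pos j) hj)]
    exact continuousOn_const.sub (bent_cont hΨ (h.τ_pos _ (by omega) hj))
  up_cat j h0 hj := by
    simp only [if_neg h0.ne', if_pos (And.intro h0 hj)]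
    obtain ⟨ε, hε, h1, h2⟩ := bent_cat hΨ (h.τ_pos j h0 hj) (h.τ_lt j h0 hj)
      (sub_pos.2 (h.lt_T j hj))
    refine ⟨ε, hε, fun r hr hlt => ?_, fun s hs hlt => ?_⟩
    · rw [add_sub_cancel_left]
      exact h1 r hr (by linarith)
    · rw [(h2 s hs hlt).1]
      exact ⟨rfl, (h2 s hs hlt).2⟩
  dn_cat j hj := by
    simp only [if_pos hj, if_pos (And.intro (Nat.succ_pos j) hj)]
    obtain ⟨ε, hε, h1, h2⟩ := bent_cat hΨ (h.τ_pos _ (by omega) hj) (h.τ_lt _ (by omega) hj)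
      (sub_pos.2 (h.T_lt j (by omega)))
    refine ⟨ε, hε, fun r hr hlt => ?_, fun s hs hlt => ?_⟩
    · rw [sub_sub_cancel]
      exact h1 r hr (by linarith)
    · rw [(h2 s hs hlt).1]
      exact ⟨rfl, (h2 s hs hlt).2⟩

end GoodHeights

namespace Stack

variable {A : Stack}

/-! ### Symmetries of the stack -/

theorem lifted_neg {x y z : ℝ} : ((-x, y, z) ∈ A.lifted ↔ (x, y, z) ∈ A.lifted) ∧
    ((x, -y, z) ∈ A.lifted ↔ (x, y, z) ∈ A.lifted) := by
  constructor <;> simp only [lifted, dom, hgt, mem_ofPred_eq, rho_neg]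

theorem diagIso_Phi (a b : ℂ ≃ₗᵢ[ℝ] ℂ) (x y z : ℝ) : diagIso a b (Phi (x, y, z)) =
    !₂[a (Complex.exp (Complex.I * ((√2 * x : ℝ) : ℂ)) * ((Real.sin (z + π / 4) : ℝ) : ℂ)),
      b (Complex.exp (Complex.I * ((√2 * y : ℝ) : ℂ)) * ((Real.cos (z + π / 4) : ℝ) : ℂ))] := by
  ext i
  fin_cases i <;> simp [diagIso, Phi, LinearIsometryEquiv.piLpCongrRight_apply]

theorem rotation_exp (t x s : ℝ) :
    rotation (Circle.exp t) (Complex.exp (Complex.I * ((√2 * x : ℝ) : ℂ)) * (s : ℂ)) =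
      Complex.exp (Complex.I * ((√2 * (x + t / √2) : ℝ) : ℂ)) * (s : ℂ) := by
  have h2 : √2 ≠ 0 := by positivity
  have e : √2 * (x + t / √2) = t + √2 * x := by field_simp; ring
  rw [rotation_apply, Circle.coe_exp, e, ← mul_assoc, ← Complex.exp_add]
  congr 2
  push_cast
  ring

theorem conj_exp (x s : ℝ) :
    Complex.conjLIE (Complex.exp (Complex.I * ((√2 * x : ℝ) : ℂ)) * (s : ℂ)) =
      Complex.exp (Complex.I * ((√2 * (-x) : ℝ) : ℂ)) * (s : ℂ) := by
  rw [Complex.conjLIE_apply, map_mul, ← Complex.exp_conj, map_mul, Complex.conj_I,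
    Complex.conj_ofReal, Complex.conj_ofReal]
  congr 2
  push_cast
  ring

theorem sideX_eq {k m : ℕ} : 2 * π / (k * m) / √2 = 2 * sideX k m := by
  unfold sideX
  field_simp

theorem rotation_first (k m : ℕ) (x y z : ℝ) :
    diagIso (rotation (Circle.exp (2 * π / (k * m)))) (LinearIsometryEquiv.refl ℝ ℂ) (Phi (x, y, z)) =
      Phi (x + 2 * sideX k m, y, z) := by
  rw [diagIso_Phi, rotation_exp, sideX_eq]
  rfl

theorem rotation_second (k m : ℕ) (x y z : ℝ) :
    diagIso (LinearIsometryEquiv.refl ℝ ℂ) (rotation (Circle.exp (2 * π / (k * m)))) (Phi (x, y, z)) =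
      Phi (x, y + 2 * sideX k m, z) := by
  rw [diagIso_Phi, rotation_exp, sideX_eq]
  rfl

theorem conj_first (x y z : ℝ) :
    diagIso Complex.conjLIE (LinearIsometryEquiv.refl ℝ ℂ) (Phi (x, y, z)) = Phi (-x, y, z) := by
  rw [diagIso_Phi, conj_exp]
  rfl

theorem conj_second (x y z : ℝ) :
    diagIso (LinearIsometryEquiv.refl ℝ ℂ) Complex.conjLIE (Phi (x, y, z)) = Phi (x, -y, z) := by
  rw [diagIso_Phi, conj_exp]
  rfl

variable {k ℓ m : ℕ}

/-- The group contains the translations by the periods of the stack. -/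
theorem exists_translation (k ℓ m : ℕ) (n n' : ℤ) : ∃ g ∈ symmGroup k ℓ m, ∀ x y z,
    g (Phi (x, y, z)) = Phi (x + n * (2 * sideX k m), y + n' * (2 * sideX ℓ m), z) := by
  set a := diagIso (rotation (Circle.exp (2 * π / (k * m)))) (LinearIsometryEquiv.refl ℝ ℂ) with ha
  set b := diagIso (LinearIsometryEquiv.refl ℝ ℂ) (rotation (Circle.exp (2 * π / (ℓ * m)))) with hb
  have ma : a ∈ symmGroup k ℓ m := Subgroup.subset_closure (by simp [ha])
  have mb : b ∈ symmGroup k ℓ m := Subgroup.subset_closure (by simp [hb])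
  have mul_apply : ∀ (f g : E ≃ₗᵢ[ℝ] E) (v : E), (f * g) v = f (g v) := fun _ _ _ => rfl
  have inv_apply : ∀ (f : E ≃ₗᵢ[ℝ] E) (v : E), f⁻¹ (f v) = v := fun f v => f.symm_apply_apply v
  have first : ∀ n : ℤ, ∀ x y z, (a ^ n) (Phi (x, y, z)) = Phi (x + n * (2 * sideX k m), y, z) := by
    intro n
    induction n using Int.induction_on with
    | zero => simp
    | succ n ih =>
      intro x y z
      rw [zpow_add_one, mul_apply, rotation_first, ih]
      push_cast
      congr 2
      ring
    | pred n ih =>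
      intro x y z
      have h := rotation_first k m (x - 2 * sideX k m) y z
      rw [sub_add_cancel, ← ha] at h
      rw [zpow_sub_one, mul_apply, ← h, inv_apply, ih]
      push_cast
      congr 2
      ring
  have second : ∀ n : ℤ, ∀ x y z, (b ^ n) (Phi (x, y, z)) = Phi (x, y + n * (2 * sideX ℓ m), z) := by
    intro n
    induction n using Int.induction_on with
    | zero => simp
    | succ n ih =>
      intro x y z
      rw [zpow_add_one, mul_apply, rotation_second, ih]
      push_cast
      congr 3
      ring
    | pred n ih =>
      intro x y z
      have h := rotation_second ℓ m x (y - 2 * sideX ℓ m) z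
      rw [sub_add_cancel, ← hb] at h
      rw [zpow_sub_one, mul_apply, ← h, inv_apply, ih]
      push_cast
      congr 3
      ring
  refine ⟨a ^ n * b ^ n', mul_mem (zpow_mem ma _) (zpow_mem mb _), fun x y z => ?_⟩
  rw [mul_apply, second, first]

theorem image_surf_eq (hX : A.X = sideX k m) (hY : A.Y = sideX ℓ m) {g : E ≃ₗᵢ[ℝ] E}
    (hg : g ∈ symmGroup k ℓ m) : g '' A.surf = A.surf := by
  have key : ∀ (g : E ≃ₗᵢ[ℝ] E) (f f' : ℝ × ℝ × ℝ → ℝ × ℝ × ℝ),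
      (∀ w, g (Phi w) = Phi (f w)) → (∀ w, f (f' w) = w) → (∀ w, f w ∈ A.lifted ↔ w ∈ A.lifted) →
      g '' A.surf = A.surf := by
    intro g f f' h1 h2 h3
    apply Subset.antisymm
    · rintro - ⟨-, ⟨w, hw, rfl⟩, rfl⟩
      exact ⟨f w, (h3 w).2 hw, (h1 w).symm⟩
    · rintro - ⟨w, hw, rfl⟩
      refine ⟨Phi (f' w), ⟨f' w, (h3 _).1 (by rwa [h2]), rfl⟩, by rw [h1, h2]⟩
  have s1 : ∀ w : ℝ × ℝ × ℝ, (w.1 + 2 * sideX k m, w.2.1, w.2.2) ∈ A.lifted ↔ w ∈ A.lifted := by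
    rintro ⟨x, y, z⟩
    simpa [hX] using lifted_add_int (A := A) (x := x) (y := y) (z := z) 1 0
  have s2 : ∀ w : ℝ × ℝ × ℝ, (w.1, w.2.1 + 2 * sideX ℓ m, w.2.2) ∈ A.lifted ↔ w ∈ A.lifted := by
    rintro ⟨x, y, z⟩
    simpa [hY] using lifted_add_int (A := A) (x := x) (y := y) (z := z) 0 1
  induction hg using Subgroup.closure_induction with
  | mem g hg =>
    rcases hg with rfl | rfl | rfl | rfl
    · exact key _ (fun w => (w.1 + 2 * sideX k m, w.2.1, w.2.2))
        (fun w => (w.1 - 2 * sideX k m, w.2.1, w.2.2)) (fun w => rotation_first k m _ _ _)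
        (fun w => by simp) s1
    · exact key _ (fun w => (w.1, w.2.1 + 2 * sideX ℓ m, w.2.2))
        (fun w => (w.1, w.2.1 - 2 * sideX ℓ m, w.2.2)) (fun w => rotation_second ℓ m _ _ _)
        (fun w => by simp) s2
    · exact key _ (fun w => (-w.1, w.2.1, w.2.2)) (fun w => (-w.1, w.2.1, w.2.2))
        (fun w => conj_first _ _ _) (fun w => by simp) (fun w => lifted_neg.1)
    · exact key _ (fun w => (w.1, -w.2.1, w.2.2)) (fun w => (w.1, -w.2.1, w.2.2))
        (fun w => conj_second _ _ _) (fun w => by simp) (fun w => lifted_neg.2)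
  | one => simp
  | mul g g' _ _ h h' =>
    rw [LinearIsometryEquiv.coe_mul, image_comp, h', h]
  | inv g _ h =>
    conv_lhs => rw [← h]
    rw [← image_comp, ← LinearIsometryEquiv.coe_mul, inv_mul_cancel, LinearIsometryEquiv.coe_one,
      image_id]

/-! ### The pieces of the levels over one period -/

variable (A) in
/-- The part of level `j` over the rectangle with sides `2X` and `2Y` around `(eX, eY)`. -/
def piece (j : ℕ) (e : ℝ) : Set (ℝ × ℝ × ℝ) :=
  {w | (w.1 - e * A.X, w.2.1 - e * A.Y) ∈ rect A.X A.Y ∧ (w.1, w.2.1) ∈ A.dom j ∧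
    w.2.2 = A.hgt j (w.1, w.2.1)}

theorem image_eq_piece {j : ℕ} {e : ℝ} {D : Set (ℝ × ℝ)} {f : ℝ × ℝ → ℝ × ℝ × ℝ} {h : ℝ × ℝ → ℝ}
    (hf : ∀ p, f p = (e * A.X + p.1, e * A.Y + p.2, h p)) (hD : D ⊆ rect A.X A.Y)
    (H : ∀ p ∈ rect A.X A.Y, (p ∈ D ↔ (e * A.X + p.1, e * A.Y + p.2) ∈ A.dom j) ∧
      (p ∈ D → h p = A.hgt j (e * A.X + p.1, e * A.Y + p.2))) : f '' D = A.piece j e := by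
  apply Subset.antisymm
  · rintro - ⟨p, hp, rfl⟩
    rw [hf]
    refine ⟨?_, (H p (hD hp)).1.1 hp, (H p (hD hp)).2 hp⟩
    simpa using hD hp
  · rintro ⟨x, y, z⟩ ⟨h1, h2, h3⟩
    simp only at h1 h2 h3
    have e1 : e * A.X + (x - e * A.X) = x := by ring
    have e2 : e * A.Y + (y - e * A.Y) = y := by ring
    have h4 := H _ h1
    simp only [e1, e2] at h4
    have h5 := h4.1.2 h2
    refine ⟨_, h5, ?_⟩
    rw [hf, h4.2 h5, h3]
    simp only [e1, e2]

theorem hgt_zero (p : ℝ × ℝ) : A.hgt 0 p = A.dn 0 (A.rho 1 p) := by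
  have := A.two_le
  rcases hgt_cases (A := A) (j := 0) (by omega) p with h | h
  · rw [h.1, A.up_zero, A.dn_far 0 (by omega) _ (A.r₁_lt.le.trans h.2)]
  · exact h.1

theorem hgt_last (p : ℝ × ℝ) : A.hgt (A.N - 1) p = A.up (A.N - 1) (A.rho (A.N - 1) p) := by
  have := A.two_le
  rcases hgt_cases (A := A) (j := A.N - 1) (by omega) p with h | h
  · exact h.1
  · rw [h.1, A.dn_last, A.up_far (A.N - 1) (by omega) _ (A.r₁_lt.le.trans h.2)]

theorem abs_le_of_mem_rect {X Y : ℝ} {p : ℝ × ℝ} (hp : p ∈ rect X Y) : |p.1| ≤ X ∧ |p.2| ≤ Y :=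
  ⟨abs_le.2 hp.1, abs_le.2 hp.2⟩

/-- The distance to the central axis of a rectangle. -/
theorem rho_center {j : ℕ} {e : ℝ} (he : e = j - 1) {p : ℝ × ℝ} (h1 : |p.1| ≤ A.X)
    (h2 : |p.2| ≤ A.Y) : A.rho j (e * A.X + p.1, e * A.Y + p.2) = √(p.1 ^ 2 + p.2 ^ 2) := by
  rw [rho, he]
  simp only [add_sub_cancel_left]
  rw [fold_eq_abs A.X_pos h1, fold_eq_abs A.Y_pos h2, sq_abs, sq_abs]

theorem _root_.half_le_fold {X x : ℝ} (hX : 0 < X) (h1 : X / 2 ≤ |x|) (h2 : |x| ≤ 3 * X / 2) :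
    X / 2 ≤ fold X x := by
  have key : ∀ x, X / 2 ≤ x → x ≤ 3 * X / 2 → X / 2 ≤ fold X x := by
    intro x h1 h2
    have h := fold_sub_self hX x
    rw [fold_eq_abs hX (abs_le.2 ⟨by linarith, by linarith⟩)] at h
    have : |x - X| ≤ X / 2 := abs_le.2 ⟨by linarith, by linarith⟩
    linarith
  rcases abs_cases x with h | h
  · rw [h.1] at h1 h2
    exact key x h1 h2
  · rw [h.1] at h1 h2
    rw [← fold_neg]
    exact key _ h1 h2

theorem lt_rho_of_half_le_fold {j : ℕ} {p : ℝ × ℝ}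
    (h : A.X / 2 ≤ fold A.X (p.1 - ((j : ℝ) - 1) * A.X) ∨
      A.Y / 2 ≤ fold A.Y (p.2 - ((j : ℝ) - 1) * A.Y)) : A.r₀ < A.rho j p := by
  have h1 := A.r₀_lt_X
  have h2 := A.r₀_lt_Y
  have h3 := abs_le_sqrt_sq_add_sq (fold A.X (p.1 - ((j : ℝ) - 1) * A.X))
    (fold A.Y (p.2 - ((j : ℝ) - 1) * A.Y))
  have h4 := h3.1
  have h5 := h3.2
  change _ ≤ A.rho j p at h4
  change _ ≤ A.rho j p at h5
  rcases h with h | h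
  · linarith [le_abs_self (fold A.X (p.1 - ((j : ℝ) - 1) * A.X))]
  · linarith [le_abs_self (fold A.Y (p.2 - ((j : ℝ) - 1) * A.Y))]

end Stack

namespace GoodHeights

variable {Ψ : ℝ → ℝ} {N p q : ℕ} {R : ℝ} {τ K T : ℕ → ℝ}

theorem stack_t (h : GoodHeights N p q R τ K T) (hΨ : IsCutoff Ψ) {j : ℕ} (h0 : 0 < j)
    (hj : j < N) : (h.stack hΨ).t j = τ j := if_pos ⟨h0, hj⟩

theorem stack_up (h : GoodHeights N p q R τ K T) (hΨ : IsCutoff Ψ) {j : ℕ} (h0 : 0 < j)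
    (hj : j < N) (x y : ℝ) :
    (h.stack hΨ).up j √(x ^ 2 + y ^ 2) = profile Ψ (K j) (T j) R (τ j) x y := by
  rw [profile_of_lt hΨ h.R_pos (h.lt_T j hj)]
  exact if_neg h0.ne'

theorem stack_dn (h : GoodHeights N p q R τ K T) (hΨ : IsCutoff Ψ) {j : ℕ} (hj : j + 1 < N)
    (x y : ℝ) :
    (h.stack hΨ).dn j √(x ^ 2 + y ^ 2) = profile Ψ (K (j + 1)) (T j) R (τ (j + 1)) x y := by
  rw [profile_of_gt hΨ h.R_pos (h.T_lt j (by omega))]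
  exact if_pos hj

theorem mem_extDomain {X Y r : ℝ} {v : ℝ × ℝ} :
    v ∈ extDomain X Y r ↔ v ∈ rect X Y ∧ r ≤ √(v.1 ^ 2 + v.2 ^ 2) := by
  simp [extDomain, disc]

theorem mem_intDomain {X Y r r' : ℝ} {v : ℝ × ℝ} :
    v ∈ intDomain X Y r r' ↔ v ∈ rect X Y ∧ r ≤ √((v.1 + X / 2) ^ 2 + (v.2 + Y / 2) ^ 2) ∧
      r' ≤ √((v.1 - X / 2) ^ 2 + (v.2 - Y / 2) ^ 2) := by
  simp [intDomain, disc]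

theorem bottom_piece (h : GoodHeights N p q R τ K T) (hΨ : IsCutoff Ψ) :
    Text Ψ 0 0 (K 1) (T 0) R (τ 1) '' extDomain (h.stack hΨ).X (h.stack hΨ).Y (τ 1) =
      (h.stack hΨ).piece 0 0 := by
  have hN := h.two_le
  refine Stack.image_eq_piece (h := fun v => profile Ψ (K 1) (T 0) R (τ 1) v.1 v.2)
    (fun v => by simp [Text]) (fun v hv => hv.1) fun v hv => ?_
  obtain ⟨h1, h2⟩ := Stack.abs_le_of_mem_rect hv
  have h3 := Stack.rho_center (A := h.stack hΨ) (j := 1) (e := 0) (by norm_num) h1 h2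
  constructor
  · rw [mem_extDomain]
    have h4 := (h.stack hΨ).t_zero
    have h5 := (h.stack hΨ).rho_nonneg 0
      (0 * (h.stack hΨ).X + v.1, 0 * (h.stack hΨ).Y + v.2)
    have h6 := h.stack_t hΨ one_pos (by omega)
    simp only [Stack.dom, mem_ofPred_eq, zero_add, h3, h6]
    exact ⟨fun h7 => ⟨by linarith, h7.2⟩, fun h7 => ⟨hv, h7.2⟩⟩
  · intro _
    rw [Stack.hgt_zero, h3, h.stack_dn hΨ (by omega)]

theorem top_piece (h : GoodHeights N p q R τ K T) (hΨ : IsCutoff Ψ) :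
    Text Ψ (((N : ℝ) - 2) * (h.stack hΨ).X) (((N : ℝ) - 2) * (h.stack hΨ).Y) (K (N - 1)) (T (N - 1))
        R (τ (N - 1)) '' extDomain (h.stack hΨ).X (h.stack hΨ).Y (τ (N - 1)) =
      (h.stack hΨ).piece (N - 1) ((N : ℝ) - 2) := by
  have hN := h.two_le
  refine Stack.image_eq_piece
    (h := fun v => profile Ψ (K (N - 1)) (T (N - 1)) R (τ (N - 1)) v.1 v.2)
    (fun v => rfl) (fun v hv => hv.1) fun v hv => ?_
  obtain ⟨h1, h2⟩ := Stack.abs_le_of_mem_rect hv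
  have h3 := Stack.rho_center (A := h.stack hΨ) (j := N - 1) (e := (N : ℝ) - 2)
    (by rw [Nat.cast_sub (by omega)]; push_cast; ring) h1 h2
  constructor
  · rw [mem_extDomain]
    have h4 := (h.stack hΨ).t_last
    have h5 := (h.stack hΨ).rho_nonneg N
      (((N : ℝ) - 2) * (h.stack hΨ).X + v.1, ((N : ℝ) - 2) * (h.stack hΨ).Y + v.2)
    have h6 := h.stack_t hΨ (j := N - 1) (by omega) (by omega)
    have e : N - 1 + 1 = N := by omega
    simp only [Stack.dom, mem_ofPred_eq, e, h3, h6]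
    exact ⟨fun h7 => ⟨h7.2, (le_of_lt h4).trans h5⟩, fun h7 => ⟨hv, h7.1⟩⟩
  · intro _
    have h7 := Stack.hgt_last (A := h.stack hΨ)
      (((N : ℝ) - 2) * (h.stack hΨ).X + v.1, ((N : ℝ) - 2) * (h.stack hΨ).Y + v.2)
    change (h.stack hΨ).hgt (N - 1) _ = (h.stack hΨ).up (N - 1) ((h.stack hΨ).rho (N - 1) _) at h7
    rw [h7, h3, h.stack_up hΨ (by omega) (by omega)]

/-- Over the rectangle midway between two necks the piece is described by quadrants. -/
theorem int_piece (h : GoodHeights N p q R τ K T) (hΨ : IsCutoff Ψ) {j : ℕ} (h0 : 0 < j)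
    (hj : j + 1 < N) :
    Tint Ψ ((2 * ((j + 1 : ℕ) : ℝ) - 3) * ((h.stack hΨ).X / 2))
        ((2 * ((j + 1 : ℕ) : ℝ) - 3) * ((h.stack hΨ).Y / 2)) (K j) (K (j + 1)) (T j) R (h.stack hΨ).X
        (h.stack hΨ).Y (τ j) (τ (j + 1)) ''
        intDomain (h.stack hΨ).X (h.stack hΨ).Y (τ j) (τ (j + 1)) =
      (h.stack hΨ).piece j ((j : ℝ) - 1 / 2) := by
  set A := h.stack hΨ with hA
  have hX := A.X_pos
  have hY := A.Y_pos
  have hrX := A.r₀_lt_X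
  have hrY := A.r₀_lt_Y
  have hr₁ := A.r₁_lt
  have t1 : A.t j = τ j := h.stack_t hΨ h0 (by omega)
  have t2 : A.t (j + 1) = τ (j + 1) := h.stack_t hΨ (Nat.succ_pos j) hj
  have t1' : A.t j < A.r₁ := A.t_lt j (by change j ≤ N; omega)
  have t2' : A.t (j + 1) < A.r₁ := A.t_lt (j + 1) (by change j + 1 ≤ N; omega)
  have hj' : j < A.N := by change j < N; omega
  refine Stack.image_eq_piece
    (h := fun v => (Tint Ψ ((2 * ((j + 1 : ℕ) : ℝ) - 3) * (A.X / 2))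
        ((2 * ((j + 1 : ℕ) : ℝ) - 3) * (A.Y / 2)) (K j) (K (j + 1)) (T j) R A.X
        A.Y (τ j) (τ (j + 1)) v).2.2)
    (fun v => ?_) (fun v hv => hv.1) fun v hv => ?_
  · simp only [Tint]
    push_cast
    refine Prod.ext ?_ (Prod.ext ?_ rfl) <;> ring
  obtain ⟨x, y⟩ := v
  obtain ⟨⟨hx1, hx2⟩, hy1, hy2⟩ := id hv
  simp only at hx1 hx2 hy1 hy2
  -- the position relative to the axes of the two necks
  have ea : ∀ X x : ℝ, ((j : ℝ) - 1 / 2) * X + x - ((j : ℝ) - 1) * X = x + X / 2 := fun X x => by ring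
  have eb : ∀ X x : ℝ, ((j : ℝ) - 1 / 2) * X + x - (((j + 1 : ℕ) : ℝ) - 1) * X = x - X / 2 :=
    fun X x => by push_cast; ring
  rw [mem_intDomain]
  simp only [Stack.dom, mem_ofPred_eq, t1, t2, Tint]
  set v : ℝ × ℝ := (((j : ℝ) - 1 / 2) * A.X + x, ((j : ℝ) - 1 / 2) * A.Y + y) with hv'
  have half : ∀ X x : ℝ, 0 < X → |x| ≤ X / 2 → fold X x = |x| :=
    fun X x hX hx => fold_eq_abs hX (by linarith)
  have hbig := Stack.abs_le_sqrt_sq_add_sq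
  by_cases q1 : (x, y) ∈ Icc (-A.X) 0 ×ˢ Icc (-A.Y) 0
  · obtain ⟨⟨-, a1⟩, -, a2⟩ := id q1
    simp only at a1 a2
    have f1 : |x + A.X / 2| ≤ A.X / 2 := abs_le.2 ⟨by linarith, by linarith⟩
    have f2 : |y + A.Y / 2| ≤ A.Y / 2 := abs_le.2 ⟨by linarith, by linarith⟩
    have r1 : A.rho j v = √((x + A.X / 2) ^ 2 + (y + A.Y / 2) ^ 2) := by
      rw [Stack.rho, hv']
      simp only [ea]
      rw [half _ _ hX f1, half _ _ hY f2, sq_abs, sq_abs]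
    have r2 : A.r₀ < A.rho (j + 1) v := by
      apply A.lt_rho_succ_of_fold
      left
      simp only [hv', ea]
      rw [half _ _ hX f1]
      exact f1
    have r3 : A.X / 2 ≤ √((x - A.X / 2) ^ 2 + (y - A.Y / 2) ^ 2) := by
      refine le_trans ?_ (hbig _ _).1
      rw [abs_of_nonpos (by linarith)]
      linarith
    rw [if_pos q1, Stack.hgt_eq_up hj' (hr₁.le.trans r2.le), r1, h.stack_up hΨ h0 (by omega)]
    exact ⟨⟨fun h7 => ⟨h7.2.1, by linarith⟩, fun h7 => ⟨hv, h7.1, by linarith⟩⟩, fun _ => rfl⟩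
  by_cases q2 : (x, y) ∈ Icc 0 A.X ×ˢ Icc 0 A.Y
  · obtain ⟨⟨a1, -⟩, a2, -⟩ := id q2
    simp only at a1 a2
    have f1 : |x - A.X / 2| ≤ A.X / 2 := abs_le.2 ⟨by linarith, by linarith⟩
    have f2 : |y - A.Y / 2| ≤ A.Y / 2 := abs_le.2 ⟨by linarith, by linarith⟩
    have r1 : A.rho (j + 1) v = √((x - A.X / 2) ^ 2 + (y - A.Y / 2) ^ 2) := by
      rw [Stack.rho, hv']
      simp only [eb]
      rw [half _ _ hX f1, half _ _ hY f2, sq_abs, sq_abs]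
    have r2 : A.r₀ < A.rho j v := by
      rw [← A.rho_add_two]
      apply A.lt_rho_succ_of_fold
      left
      simp only [hv', eb]
      rw [half _ _ hX f1]
      exact f1
    have r3 : A.X / 2 ≤ √((x + A.X / 2) ^ 2 + (y + A.Y / 2) ^ 2) := by
      refine le_trans ?_ (hbig _ _).1
      rw [abs_of_nonneg (by linarith)]
      linarith
    rw [if_neg q1, if_pos q2, Stack.hgt_eq_dn hj' (hr₁.le.trans r2.le), r1, h.stack_dn hΨ hj]
    exact ⟨⟨fun h7 => ⟨by linarith, h7.2.2⟩, fun h7 => ⟨hv, by linarith, h7.2⟩⟩, fun _ => rfl⟩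
  · -- In the other two quadrants one coordinate is far from the axes of neck `j`, the other one
    -- from those of neck `j + 1`.
    have hq : (0 < x ∧ y < 0) ∨ (x < 0 ∧ 0 < y) := by
      rcases lt_trichotomy x 0 with a | a | a <;> rcases lt_trichotomy y 0 with b | b | b
      · exact (q1 ⟨⟨hx1, a.le⟩, hy1, b.le⟩).elim
      · exact (q1 ⟨⟨hx1, a.le⟩, hy1, b.le⟩).elim
      · exact Or.inr ⟨a, b⟩
      · exact (q1 ⟨⟨hx1, a.le⟩, hy1, b.le⟩).elim
      · exact (q1 ⟨⟨hx1, a.le⟩, hy1, b.le⟩).elim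
      · exact (q2 ⟨⟨a.ge, hx2⟩, b.le, hy2⟩).elim
      · exact Or.inl ⟨a, b⟩
      · exact (q2 ⟨⟨a.le, hx2⟩, b.ge, hy2⟩).elim
      · exact (q2 ⟨⟨a.le, hx2⟩, b.le, hy2⟩).elim
    rw [if_neg q1, if_neg q2]
    have main : A.r₀ < A.rho j v ∧ A.r₀ < A.rho (j + 1) v ∧
        A.r₀ < √((x + A.X / 2) ^ 2 + (y + A.Y / 2) ^ 2) ∧
        A.r₀ < √((x - A.X / 2) ^ 2 + (y - A.Y / 2) ^ 2) := by
      rcases hq with ⟨a, b⟩ | ⟨a, b⟩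
      · have e1 : |x + A.X / 2| = x + A.X / 2 := abs_of_pos (by linarith)
        have e2 : |y - A.Y / 2| = -(y - A.Y / 2) := abs_of_neg (by linarith)
        refine ⟨Stack.lt_rho_of_half_le_fold (Or.inl ?_),
          Stack.lt_rho_of_half_le_fold (Or.inr ?_), ?_, ?_⟩
        · simp only [hv', ea]
          exact half_le_fold hX (by linarith) (by linarith)
        · simp only [hv', eb]
          exact half_le_fold hY (by linarith) (by linarith)
        · linarith [(hbig (x + A.X / 2) (y + A.Y / 2)).1]
        · linarith [(hbig (x - A.X / 2) (y - A.Y / 2)).2]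
      · have e1 : |y + A.Y / 2| = y + A.Y / 2 := abs_of_pos (by linarith)
        have e2 : |x - A.X / 2| = -(x - A.X / 2) := abs_of_neg (by linarith)
        refine ⟨Stack.lt_rho_of_half_le_fold (Or.inr ?_),
          Stack.lt_rho_of_half_le_fold (Or.inl ?_), ?_, ?_⟩
        · simp only [hv', ea]
          exact half_le_fold hY (by linarith) (by linarith)
        · simp only [hv', eb]
          exact half_le_fold hX (by linarith) (by linarith)
        · linarith [(hbig (x + A.X / 2) (y + A.Y / 2)).2]
        · linarith [(hbig (x - A.X / 2) (y - A.Y / 2)).1]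
    obtain ⟨m1, m2, m3, m4⟩ := main
    rw [Stack.hgt_eq_T hj' (by linarith) (by linarith)]
    exact ⟨⟨fun _ => ⟨by linarith, by linarith⟩, fun _ => ⟨hv, by linarith, by linarith⟩⟩,
      fun _ => rfl⟩

/-- The stack is the union of the images of one piece of each level under the group. -/
theorem initialSurface_eq {k ℓ m : ℕ} {c ζ ξ : ℕ → ℝ}
    (h : GoodHeights N (k * m) (ℓ * m) (radR ℓ m) (tau N k ℓ m c ζ) K T) (hΨ : IsCutoff Ψ)
    (hK : ∀ j, 0 < j → j < N → K j = zK N k ℓ m c ζ ξ j)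
    (hT : ∀ j < N, T j = zT N k ℓ m c ζ ξ (j + 1)) :
    initialSurface Ψ N k ℓ m c ζ ξ = (h.stack hΨ).surf ∧
      ∀ g ∈ symmGroup k ℓ m, g '' (h.stack hΨ).surf = (h.stack hΨ).surf := by
  set A := h.stack hΨ with hA
  have hN := h.two_le
  have hp := h.p_pos
  have hq := h.q_pos
  have hX : A.X = sideX k m := by
    change per / (2 * ((k * m : ℕ) : ℝ)) = _
    unfold per sideX
    have : 0 < √2 := by positivity
    have hk : (0 : ℝ) < k := by exact_mod_cast Nat.pos_of_mul_pos_right hp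
    have hm : (0 : ℝ) < m := by exact_mod_cast Nat.pos_of_mul_pos_left hp
    push_cast
    field_simp
    exact sq_sqrt two_pos.le
  have hY : A.Y = sideY ℓ m := by
    change per / (2 * ((ℓ * m : ℕ) : ℝ)) = _
    unfold per sideY
    have : 0 < √2 := by positivity
    have hk : (0 : ℝ) < ℓ := by exact_mod_cast Nat.pos_of_mul_pos_right hq
    have hm : (0 : ℝ) < m := by exact_mod_cast Nat.pos_of_mul_pos_left hq
    push_cast
    field_simp
    exact sq_sqrt two_pos.le
  have hG : ∀ g ∈ symmGroup k ℓ m, g '' A.surf = A.surf :=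
    fun g hg => Stack.image_surf_eq hX hY hg
  have hΩ : ∀ j < N, ∃ e, Omega Ψ N k ℓ m c ζ ξ (j + 1) = Phi '' A.piece j e := by
    intro j hj
    unfold Omega
    rw [← hX, ← hY]
    rcases Nat.eq_zero_or_pos j with rfl | h0
    · refine ⟨0, ?_⟩
      rw [← h.bottom_piece hΨ, hK 1 one_pos (by omega), hT 0 (by omega)]
      simp only [zero_add, if_true]
      rfl
    rcases (Nat.succ_le_of_lt hj).lt_or_eq with h1 | h1
    · refine ⟨(j : ℝ) - 1 / 2, ?_⟩
      rw [← h.int_piece hΨ h0 h1, hK j h0 (by omega), hK (j + 1) (by omega) h1, hT j hj]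
      simp only [if_neg (show ¬(j + 1 = 1) by omega), if_neg h1.ne, Nat.add_sub_cancel]
      rfl
    · refine ⟨(N : ℝ) - 2, ?_⟩
      obtain rfl : j = N - 1 := by omega
      have e : N - 1 + 1 = N := by omega
      rw [← h.top_piece hΨ, hK (N - 1) h0 (by omega), hT _ hj]
      simp only [e, if_neg (show ¬(N = 1) by omega), if_true]
      rfl
  refine ⟨Subset.antisymm ?_ ?_, hG⟩
  · refine iUnion₂_subset fun g hg => ?_
    rw [← hG g hg]
    refine image_mono (iUnion₂_subset fun i hi => ?_)
    obtain ⟨h1, h2⟩ := Finset.mem_Icc.1 hi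
    obtain ⟨j, rfl⟩ : ∃ j, i = j + 1 := ⟨i - 1, by omega⟩
    obtain ⟨e, he⟩ := hΩ j (by omega)
    rw [he]
    exact image_mono fun w hw => ⟨j, by change j < N; omega, hw.2⟩
  · rintro - ⟨⟨x, y, z⟩, ⟨j, hj, hd, hz⟩, rfl⟩
    simp only at hd hz
    have hj : j < N := hj
    obtain ⟨e, he⟩ := hΩ j hj
    obtain ⟨n, hn, -⟩ := exists_fold_eq A.X_pos (x - e * A.X)
    obtain ⟨n', hn', -⟩ := exists_fold_eq A.Y_pos (y - e * A.Y)
    obtain ⟨g, hg, hgP⟩ := Stack.exists_translation k ℓ m n n'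
    have e1 : x + ((-n : ℤ) : ℝ) * (2 * A.X) - e * A.X = x - e * A.X - n * (2 * A.X) := by
      push_cast; ring
    have e2 : y + ((-n' : ℤ) : ℝ) * (2 * A.Y) - e * A.Y = y - e * A.Y - n' * (2 * A.Y) := by
      push_cast; ring
    have hw : (x + ((-n : ℤ) : ℝ) * (2 * A.X), y + ((-n' : ℤ) : ℝ) * (2 * A.Y), z) ∈
        A.piece j e := by
      refine ⟨?_, ?_, ?_⟩
      · simp only [e1, e2]
        exact ⟨abs_le.1 hn, abs_le.1 hn'⟩
      · exact (Stack.dom_add_int j x y _ _).2 hd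
      · simp only [Stack.hgt_add_int]
        exact hz
    refine mem_iUnion₂.2 ⟨g, hg, Phi (x + ((-n : ℤ) : ℝ) * (2 * A.X),
      y + ((-n' : ℤ) : ℝ) * (2 * A.Y), z), mem_iUnion₂.2 ⟨j + 1, Finset.mem_Icc.2 ⟨by omega, hj⟩, ?_⟩, ?_⟩
    · rw [he]
      exact mem_image_of_mem _ hw
    · rw [hgP, hX, show sideX ℓ m = A.Y from hY.symm]
      push_cast
      congr 2
      · ring
      · congr 1
        ring

end GoodHeights

/-! ### Radii and heights for large `m` -/

section

variable {N k ℓ : ℕ} {w : ℕ → ℕ → ℝ}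

/-- The waist ratios stay away from `0` and `∞`, and the exponent of the waist radii is
proportional to `m²`. -/
theorem waistRatios_bounds (hN : 2 ≤ N) (hw : IsWaistRatios N k ℓ w) :
    ∃ β δ : ℝ, 1 ≤ β ∧ 0 < δ ∧ ∀ᶠ m in atTop,
      (∀ i, 1 ≤ i → i < N → 1 / 2 ≤ w m i ∧ w m i ≤ β) ∧
      δ ≤ 1 - (if N = 2 then 0 else w m 2) / 2 := by
  obtain ⟨hbal, d, hd2, hdm, hlim⟩ := hw
  have hd1 : ∀ i, 2 ≤ i → i ≤ N / 2 → 1 < d i := by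
    intro i hi
    induction i, hi using Nat.le_induction with
    | base => exact fun h => (hd2 h).1
    | succ i hi ih => exact fun h => (ih (by omega)).trans (hdm i hi h)
  have hβ : ∀ i, 2 ≤ i → i ≤ N / 2 → d i + 1 ≤ 1 + ∑ j ∈ Finset.Icc 2 (N / 2), (d j + 1) := by
    intro i h2 hn
    have h1 : ∀ j ∈ Finset.Icc 2 (N / 2), 0 ≤ d j + 1 := fun j hj => by
      have := hd1 j (Finset.mem_Icc.1 hj).1 (Finset.mem_Icc.1 hj).2
      linarith
    have := Finset.single_le_sum h1 (Finset.mem_Icc.2 ⟨h2, hn⟩)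
    linarith
  have h1 : ∀ᶠ m in atTop, ∀ i ∈ Finset.Icc 2 (N / 2), 1 / 2 ≤ w m i ∧ w m i ≤ d i + 1 := by
    rw [Filter.eventually_all_finset]
    intro i hi
    obtain ⟨h2, hn⟩ := Finset.mem_Icc.1 hi
    have := hd1 i h2 hn
    filter_upwards [(hlim i h2 hn).eventually_const_le (by linarith : (1 / 2 : ℝ) < d i),
      (hlim i h2 hn).eventually_le_const (by linarith : d i < d i + 1)] with m a b using ⟨a, b⟩
  obtain ⟨δ, hδ, h2⟩ : ∃ δ > 0, ∀ᶠ m in atTop, δ ≤ 1 - (if N = 2 then 0 else w m 2) / 2 := by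
    rcases lt_or_ge N 4 with h4 | h4
    · rcases (show N = 2 ∨ N = 3 by omega) with rfl | rfl
      · exact ⟨1, one_pos, Eventually.of_forall fun m => by norm_num⟩
      · refine ⟨1 / 2, by norm_num, hbal.mono fun m hm => ?_⟩
        rw [if_neg (by norm_num), hm.refl 2 (by norm_num) (by norm_num), hm.one]
        norm_num
    · have h5 := (hd2 (by omega)).2
      refine ⟨(2 - d 2) / 4, by linarith, ?_⟩
      filter_upwards [(hlim 2 le_rfl (by omega)).eventually_le_const
        (by linarith : d 2 < 1 + d 2 / 2)] with m hm
      rw [if_neg (by omega)]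
      linarith
  refine ⟨1 + ∑ j ∈ Finset.Icc 2 (N / 2), (d j + 1), δ, ?_, hδ, ?_⟩
  · have : 0 ≤ ∑ j ∈ Finset.Icc 2 (N / 2), (d j + 1) := Finset.sum_nonneg fun j hj => by
      have := hd1 j (Finset.mem_Icc.1 hj).1 (Finset.mem_Icc.1 hj).2
      linarith
    linarith
  · filter_upwards [hbal, h1, h2] with m hm hm1 hm2
    refine ⟨?_, hm2⟩
    have key : ∀ i, 1 ≤ i → i ≤ N / 2 →
        1 / 2 ≤ w m i ∧ w m i ≤ 1 + ∑ j ∈ Finset.Icc 2 (N / 2), (d j + 1) := by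
      intro i h1 hn
      rcases h1.eq_or_lt with rfl | h1
      · rw [hm.one]
        refine ⟨by norm_num, ?_⟩
        have : 0 ≤ ∑ j ∈ Finset.Icc 2 (N / 2), (d j + 1) := Finset.sum_nonneg fun j hj => by
          have := hd1 j (Finset.mem_Icc.1 hj).1 (Finset.mem_Icc.1 hj).2
          linarith
        linarith
      · have := hm1 i (Finset.mem_Icc.2 ⟨h1, hn⟩)
        exact ⟨this.1, this.2.trans (hβ i h1 hn)⟩
    intro i h1 hi
    rcases le_total i (N / 2) with h | h
    · exact key i h1 h
    · rcases (show i = N / 2 ∨ N - i ≤ N / 2 by omega) with h' | h'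
      · exact key i h1 h'.le
      · rw [hm.refl i h1 hi]
        exact key (N - i) (by omega) h'

/-- For large `m` the waist radii are comparable to each other and arbitrarily small in comparison
to `R`. -/
theorem tau_asymptotics (hN : 2 ≤ N) (hk : 1 ≤ k) (hℓ : 1 ≤ ℓ) (hw : IsWaistRatios N k ℓ w) {c : ℝ}
    (hc : 0 < c) : ∃ M : ℝ, 1 ≤ M ∧ ∀ B : ℝ, ∀ᶠ m in atTop, ∀ ζ : ℕ → ℝ,
      (∀ i, 1 ≤ i → i < N → |ζ i| ≤ c) → ∀ i, 1 ≤ i → i < N →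
        0 < tau N k ℓ m (w m) ζ i ∧
        (∀ j, 1 ≤ j → j < N → tau N k ℓ m (w m) ζ i ≤ M * tau N k ℓ m (w m) ζ j) ∧
        B < Real.log (radR ℓ m / tau N k ℓ m (w m) ζ i) := by
  obtain ⟨β, δ, hβ, hδ, hev⟩ := waistRatios_bounds hN hw
  refine ⟨Real.exp (4 * c) * (2 * β), ?_, fun B => ?_⟩
  · have := Real.one_le_exp (by linarith : 0 ≤ 4 * c)
    nlinarith
  have hgrow : ∀ᶠ m : ℕ in atTop, (B + 2 * c + Real.log β) * (4 * π) / δ < m :=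
    tendsto_natCast_atTop_atTop.eventually_gt_atTop _
  filter_upwards [hev, hgrow, eventually_ge_atTop 1] with m ⟨hm1, hm2⟩ hm3 hm4 ζ hζ
  have hk' : (1 : ℝ) ≤ k := by exact_mod_cast hk
  have hℓ' : (1 : ℝ) ≤ ℓ := by exact_mod_cast hℓ
  have hm' : (1 : ℝ) ≤ m := by exact_mod_cast hm4
  have hkl : (1 : ℝ) ≤ k * ℓ := by nlinarith
  have hkm : (m : ℝ) ≤ k * ℓ * m ^ 2 := by nlinarith
  have hR : 0 < radR ℓ m := by unfold radR; positivity
  set G : ℝ := k * ℓ * m ^ 2 / (4 * π) * (1 - (if N = 2 then 0 else w m 2) / 2) with hG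
  obtain ⟨η, hη, hτ⟩ : ∃ η : ℕ → ℝ, (∀ i, 1 ≤ i → i < N → |η i| ≤ 2 * c) ∧
      ∀ i, tau N k ℓ m (w m) ζ i = Real.exp (η i) * (w m i * (radR ℓ m * Real.exp (-G))) := by
    refine ⟨fun i => if i = 1 then ζ 1 else ζ 1 + ζ i / (k * ℓ * m ^ 2), fun i h1 hi => ?_,
      fun i => ?_⟩
    · have e1 := hζ 1 le_rfl (by omega)
      simp only
      split_ifs
      · linarith
      · have e2 := hζ i h1 hi
        have e3 : |ζ i / (k * ℓ * m ^ 2)| ≤ c := by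
          rw [abs_div, abs_of_pos (by linarith : (0 : ℝ) < k * ℓ * m ^ 2)]
          exact (div_le_self (abs_nonneg _) (by linarith)).trans e2
        linarith [abs_add_le (ζ 1) (ζ i / (k * ℓ * m ^ 2))]
    · rw [tau, tauBar, hG, radR, neg_mul]
  have hpos : ∀ i, 1 ≤ i → i < N → 0 < w m i := fun i h1 hi => by linarith [(hm1 i h1 hi).1]
  intro i h1 hi
  have hwi := hpos i h1 hi
  refine ⟨?_, fun j h1j hj => ?_, ?_⟩
  · rw [hτ]; positivity
  · have hwj := hpos j h1j hj
    rw [hτ, hτ]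
    have a1 := abs_le.1 (hη i h1 hi)
    have a2 := abs_le.1 (hη j h1j hj)
    have a3 : Real.exp (η i) ≤ Real.exp (4 * c) * Real.exp (η j) := by
      rw [← Real.exp_add]
      exact Real.exp_le_exp.2 (by linarith)
    have a4 : w m i ≤ 2 * β * w m j := by nlinarith [(hm1 i h1 hi).2, (hm1 j h1j hj).1]
    calc Real.exp (η i) * (w m i * (radR ℓ m * Real.exp (-G)))
        ≤ (Real.exp (4 * c) * Real.exp (η j)) * (2 * β * w m j * (radR ℓ m * Real.exp (-G))) := by
          gcongr
      _ = _ := by ring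
  · have e : radR ℓ m / tau N k ℓ m (w m) ζ i = Real.exp (-η i) * (Real.exp G / w m i) := by
      rw [hτ, Real.exp_neg, Real.exp_neg]
      field_simp
    rw [e, Real.log_mul (Real.exp_pos _).ne' (by positivity), Real.log_div (Real.exp_pos _).ne' hwi.ne',
      Real.log_exp, Real.log_exp]
    have b1 := abs_le.1 (hη i h1 hi)
    have b2 := Real.log_le_log hwi (hm1 i h1 hi).2
    have b3 : m / (4 * π) * δ ≤ G := by
      rw [hG]
      have hπ := Real.pi_pos
      gcongr
    have b4 : B + 2 * c + Real.log β < m / (4 * π) * δ := by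
      rw [div_lt_iff₀ hδ] at hm3
      have hπ : 0 < 4 * π := by positivity
      rw [div_mul_eq_mul_div, lt_div_iff₀ hπ]
      linarith
    linarith

/-- The height of a half-catenoid of radius `τ` at distance `r` is at most `τ log (2 r / τ)`. -/
theorem arcosh_le_log {x : ℝ} (hx : 1 ≤ x) : arcosh x ≤ Real.log (2 * x) := by
  unfold arcosh
  apply Real.log_le_log
  · positivity
  · have : √(x ^ 2 - 1) ≤ x := by
      rw [Real.sqrt_le_left (by linarith)]
      linarith
    linarith

/-- With radii of comparable size that are small in comparison to `R`, and `R` small, the heights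
prescribed by the parameters are in good order. -/
theorem goodHeights {p q m : ℕ} {c M B : ℝ} {r ζ ξ : ℕ → ℝ} (hN : 2 ≤ N) (hp : 0 < p) (hq : 0 < q)
    (hRp : 2 * radR ℓ m < per / (2 * p) / 2) (hRq : 2 * radR ℓ m < per / (2 * q) / 2)
    (hR : 0 < radR ℓ m) (hc : 0 < c) (hM : 1 ≤ M) (hξ : ∀ i, 1 ≤ i → i < N → |ξ i| ≤ c)
    (hB : M * (2 + 2 * (c * M)) ≤ B)
    (hsmall : (c + 2 * N + 8) * radR ℓ m < π / 4)
    (hpos : ∀ i, 1 ≤ i → i < N → 0 < tau N k ℓ m r ζ i)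
    (hcomp : ∀ i, 1 ≤ i → i < N → ∀ j, 1 ≤ j → j < N → tau N k ℓ m r ζ i ≤ M * tau N k ℓ m r ζ j)
    (hlog : ∀ i, 1 ≤ i → i < N → B < Real.log (radR ℓ m / tau N k ℓ m r ζ i)) :
    GoodHeights N p q (radR ℓ m) (tau N k ℓ m r ζ)
      (fun j => if j = 0 then -(π / 4) else if j < N then zK N k ℓ m r ζ ξ j else π / 4)
      (fun j => zT N k ℓ m r ζ ξ (j + 1)) := by
  set R := radR ℓ m with hRdef
  set τ := tau N k ℓ m r ζ with hτdef
  set L := lam N k ℓ m r ζ with hLdef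
  have hlam : ∀ i, L i = τ i * Real.log (R / τ i) := by
    intro i
    rw [hLdef, hτdef, hRdef, lam, radR, div_div]
  have hcM : 0 ≤ c * M := by nlinarith
  have hB2 : 2 + 2 * (c * M) ≤ B := by nlinarith
  have hτR : ∀ i, 1 ≤ i → i < N → τ i < R := by
    intro i h1 hi
    have h2 := hpos i h1 hi
    by_contra hcon
    have : R / τ i ≤ 1 := (div_le_one h2).2 (not_lt.1 hcon)
    have := Real.log_nonpos (div_nonneg hR.le h2.le) this
    linarith [hlog i h1 hi]
  have hLpos : ∀ i, 1 ≤ i → i < N → τ i * B < L i := by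
    intro i h1 hi
    rw [hlam]
    exact mul_lt_mul_of_pos_left (hlog i h1 hi) (hpos i h1 hi)
  have hL0 : ∀ i, 1 ≤ i → i < N → 0 < L i := by
    intro i h1 hi
    have := mul_pos (hpos i h1 hi) (by linarith : 0 < B)
    linarith [hLpos i h1 hi]
  -- `x log (1 / x) ≤ 1`
  have hLR : ∀ i, 1 ≤ i → i < N → L i ≤ R := by
    intro i h1 hi
    have h2 := hpos i h1 hi
    have h3 := Real.log_le_sub_one_of_pos (div_pos hR h2)
    rw [hlam]
    calc τ i * Real.log (R / τ i) ≤ τ i * (R / τ i) :=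
          mul_le_mul_of_nonneg_left (by linarith) h2.le
      _ = R := by field_simp
  have harc : ∀ i, 1 ≤ i → i < N → τ i * arcosh (2 * R / τ i) ≤ 2 * τ i + L i := by
    intro i h1 hi
    have h2 := hpos i h1 hi
    have h3 := hτR i h1 hi
    have h4 : 1 ≤ 2 * R / τ i := (one_le_div h2).2 (by linarith)
    have h5 := arcosh_le_log h4
    have e : 2 * (2 * R / τ i) = 2 ^ 2 * (R / τ i) := by ring
    rw [e, Real.log_mul (by norm_num) (div_pos hR h2).ne', Real.log_pow] at h5
    have h6 := Real.log_two_lt_d9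
    rw [hlam, ← mul_comm (τ i) 2, ← mul_add]
    refine mul_le_mul_of_nonneg_left ?_ h2.le
    push_cast at h5
    linarith
  -- the unperturbed heights
  set s : ℕ → ℝ := fun i => 2 * (∑ j ∈ Finset.Icc 1 (i - 1), L j - ∑ j ∈ Finset.Icc 1 (N / 2 - 1), L j)
    - 2 ^ (N % 2) * L (N / 2) with hs
  have hs_succ : ∀ i, 1 ≤ i → s (i + 1) = s i + 2 * L i := by
    intro i h1
    obtain ⟨j, rfl⟩ : ∃ j, i = j + 1 := ⟨i - 1, by omega⟩
    simp only [hs, Nat.add_sub_cancel]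
    rw [Finset.sum_Icc_succ_top (by omega)]
    ring
  have hsum : ∀ i, i ≤ N → 0 ≤ ∑ j ∈ Finset.Icc 1 (i - 1), L j ∧
      ∑ j ∈ Finset.Icc 1 (i - 1), L j ≤ N * R := by
    intro i hi
    have h1 : ∀ j ∈ Finset.Icc 1 (i - 1), 1 ≤ j ∧ j < N := fun j hj => by
      obtain ⟨a, b⟩ := Finset.mem_Icc.1 hj
      omega
    refine ⟨Finset.sum_nonneg fun j hj => (hL0 j (h1 j hj).1 (h1 j hj).2).le, ?_⟩
    have h2 := Finset.sum_le_card_nsmul (Finset.Icc 1 (i - 1)) L R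
      fun j hj => hLR j (h1 j hj).1 (h1 j hj).2
    rw [Nat.card_Icc, Nat.add_sub_cancel, nsmul_eq_mul] at h2
    refine h2.trans (mul_le_mul_of_nonneg_right ?_ hR.le)
    exact_mod_cast (by omega : i - 1 ≤ N)
  have hs_le : ∀ i, i ≤ N → |s i| ≤ (2 * N + 2) * R := by
    intro i hi
    have h1 := hsum i hi
    have h2 := hsum (N / 2) (by omega)
    have h3 := hL0 (N / 2) (by omega) (by omega)
    have h4 := hLR (N / 2) (by omega) (by omega)
    have h5 : 0 ≤ 2 ^ (N % 2) * L (N / 2) ∧ 2 ^ (N % 2) * L (N / 2) ≤ 2 * R := by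
      rcases Nat.mod_two_eq_zero_or_one N with h | h <;> rw [h] <;> constructor <;> linarith
    simp only [hs]
    rw [abs_le]
    constructor <;> linarith
  -- the perturbations
  have he : ∀ i, 1 ≤ i → i < N → ∀ j, 1 ≤ j → j < N → |τ i * ξ i| ≤ c * M * τ j := by
    intro i h1 hi j h1j hj
    rw [abs_mul, abs_of_pos (hpos i h1 hi)]
    calc τ i * |ξ i| ≤ M * τ j * c :=
          mul_le_mul (hcomp i h1 hi j h1j hj) (hξ i h1 hi) (abs_nonneg _)
            (by have := hpos j h1j hj; positivity)
      _ = c * M * τ j := by ring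
  have heR : ∀ i, 1 ≤ i → i < N → |τ i * ξ i| ≤ c * R := by
    intro i h1 hi
    rw [abs_mul, abs_of_pos (hpos i h1 hi), mul_comm]
    exact mul_le_mul (hξ i h1 hi) (hτR i h1 hi).le (hpos i h1 hi).le hc.le
  have hzK : ∀ i, zK N k ℓ m r ζ ξ i = s i + L i + τ i * ξ i := by
    intro i
    simp only [zK, hs]
    ring
  have hzT : ∀ i, 1 ≤ i → i ≤ N → ∃ e, zT N k ℓ m r ζ ξ i = s i + e ∧ |e| ≤ c * R ∧
      ∀ j, (1 ≤ j ∧ j < N) → |e| ≤ c * M * τ j := by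
    intro i h1 hi
    simp only [zT, hs]
    by_cases hi1 : i = 1
    · subst hi1
      rw [if_pos rfl]
      exact ⟨τ 1 * ξ 1, by simp; ring, heR 1 le_rfl (by omega),
        fun j hj => he 1 le_rfl (by omega) j hj.1 hj.2⟩
    · rw [if_neg hi1]
      by_cases hiN : i = N
      · subst hiN
        rw [if_pos rfl]
        refine ⟨τ (i - 1) * ξ (i - 1), ?_, heR _ (by omega) (by omega),
          fun j hj => he _ (by omega) (by omega) j hj.1 hj.2⟩
        have e1 : ∑ j ∈ Finset.Icc 1 (i - 1), L j =
            ∑ j ∈ Finset.Icc 1 (i / 2 - 1), L j + ∑ j ∈ Finset.Icc (i / 2) (i - 1), L j := by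
          have u : Finset.Icc 1 (i - 1) = Finset.Ico 1 (i / 2) ∪ Finset.Icc (i / 2) (i - 1) := by
            ext j
            simp only [Finset.mem_union, Finset.mem_Icc, Finset.mem_Ico]
            omega
          have u' : Finset.Icc 1 (i / 2 - 1) = Finset.Ico 1 (i / 2) := by
            ext j
            simp only [Finset.mem_Icc, Finset.mem_Ico]
            omega
          rw [u, u', Finset.sum_union]
          rw [Finset.disjoint_left]
          intro j hj hj'
          rw [Finset.mem_Ico] at hj
          rw [Finset.mem_Icc] at hj'
          omega
        rw [e1]
        ring
      · rw [if_neg hiN]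
        refine ⟨(τ (i - 1) * ξ (i - 1) + τ i * ξ i) / 2, by ring, ?_, fun j hj => ?_⟩
        · have a1 := heR (i - 1) (by omega) (by omega)
          have a2 := heR i (by omega) (by omega)
          rw [abs_div, abs_two]
          linarith [abs_add_le (τ (i - 1) * ξ (i - 1)) (τ i * ξ i)]
        · have a1 := he (i - 1) (by omega) (by omega) j hj.1 hj.2
          have a2 := he i (by omega) (by omega) j hj.1 hj.2
          rw [abs_div, abs_two]
          linarith [abs_add_le (τ (i - 1) * ξ (i - 1)) (τ i * ξ i)]
  have hKsmall : ∀ i, 1 ≤ i → i < N → |zK N k ℓ m r ζ ξ i| + 3 * R < π / 4 := by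
    intro i h1 hi
    rw [hzK]
    have a1 := abs_le.1 (hs_le i hi.le)
    have a2 := abs_le.1 (heR i h1 hi)
    have a3 := hL0 i h1 hi
    have a4 := hLR i h1 hi
    have : |s i + L i + τ i * ξ i| ≤ (c + 2 * N + 3) * R := abs_le.2 ⟨by linarith, by linarith⟩
    linarith
  have hTsmall : ∀ i, 1 ≤ i → i ≤ N → |zT N k ℓ m r ζ ξ i| < π / 4 := by
    intro i h1 hi
    obtain ⟨e, h2, h3, -⟩ := hzT i h1 hi
    rw [h2]
    have := abs_add_le (s i) e
    linarith [hs_le i hi]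
  have hKT : ∀ i, 1 ≤ i → i < N → zT N k ℓ m r ζ ξ i < zK N k ℓ m r ζ ξ i ∧
      zK N k ℓ m r ζ ξ i < zT N k ℓ m r ζ ξ (i + 1) := by
    intro i h1 hi
    obtain ⟨e, h2, -, h3⟩ := hzT i h1 hi.le
    obtain ⟨e', h2', -, h3'⟩ := hzT (i + 1) (by omega) hi
    have a1 := abs_le.1 (h3 i ⟨h1, hi⟩)
    have a2 := abs_le.1 (h3' i ⟨h1, hi⟩)
    have a3 := abs_le.1 (he i h1 hi i h1 hi)
    have a4 := hLpos i h1 hi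
    have a5 := mul_le_mul_of_nonneg_left hB2 (hpos i h1 hi).le
    have a6 := hpos i h1 hi
    rw [h2, h2', hzK, hs_succ i h1]
    constructor <;> linarith
  have hKK : ∀ i, 1 ≤ i → i + 1 < N →
      2 * τ i + L i < zK N k ℓ m r ζ ξ (i + 1) - zK N k ℓ m r ζ ξ i ∧
      2 * τ (i + 1) + L (i + 1) < zK N k ℓ m r ζ ξ (i + 1) - zK N k ℓ m r ζ ξ i := by
    intro i h1 hi
    have key : ∀ i, 1 ≤ i → i < N → ∀ j, 1 ≤ j → j < N → τ j * (2 + 2 * (c * M)) < L i := by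
      intro i h1 hi j h1j hj
      have b1 := hLpos i h1 hi
      have b2 := mul_le_mul_of_nonneg_left hB (hpos i h1 hi).le
      have b3 := mul_le_mul_of_nonneg_right (hcomp j h1j hj i h1 hi)
        (by linarith : 0 ≤ 2 + 2 * (c * M))
      linarith
    rw [hzK, hzK, hs_succ i h1]
    have c1 := key (i + 1) (by omega) hi i h1 (by omega)
    have c2 := key i h1 (by omega) (i + 1) (by omega) hi
    have a1 := abs_le.1 (he i h1 (by omega) i h1 (by omega))
    have a2 := abs_le.1 (he (i + 1) (by omega) hi i h1 (by omega))
    have a3 := abs_le.1 (he i h1 (by omega) (i + 1) (by omega) hi)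
    have a4 := abs_le.1 (he (i + 1) (by omega) hi (i + 1) (by omega) hi)
    constructor <;> linarith
  refine
    { two_le := hN
      p_pos := hp
      q_pos := hq
      R_lt_p := hRp
      R_lt_q := hRq
      R_pos := hR
      τ_pos := fun j h0 hj => hpos j h0 hj
      τ_lt := fun j h0 hj => hτR j h0 hj
      K_zero := by simp
      K_last := by simp [show N ≠ 0 by omega]
      lt_T := fun j hj => ?_
      T_lt := fun j hj => ?_
      up_lt := fun j h0 hj => ?_
      dn_lt := fun j hj => ?_ }
  · have h1 := abs_lt.1 (hTsmall (j + 1) (by omega) hj)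
    rcases Nat.eq_zero_or_pos j with rfl | h0
    · simpa using h1.1
    · simp only [if_neg h0.ne', if_pos hj]
      exact (hKT j h0 hj).2
  · have h1 := abs_lt.1 (hTsmall (j + 1) (by omega) hj)
    simp only [if_neg (Nat.succ_ne_zero j)]
    split_ifs with h2
    · exact (hKT (j + 1) (by omega) h2).1
    · exact h1.2
  · simp only [if_neg (Nat.succ_ne_zero j), if_neg h0.ne', if_pos hj]
    refine (harc j h0 hj).trans_lt ?_
    split_ifs with h2
    · exact (hKK j h0 h2).1
    · have h1 := hKsmall j h0 hj
      have h3 := le_abs_self (zK N k ℓ m r ζ ξ j)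
      linarith [hτR j h0 hj, hLR j h0 hj]
  · simp only [if_neg (Nat.succ_ne_zero j), if_pos hj]
    refine (harc (j + 1) (by omega) hj).trans_lt ?_
    split_ifs with h2 h3
    · subst h2
      have h1 := hKsmall (0 + 1) le_rfl hj
      have h3 := neg_abs_le (zK N k ℓ m r ζ ξ (0 + 1))
      linarith [hτR (0 + 1) le_rfl hj, hLR (0 + 1) le_rfl hj]
    · exact (hKK j (by omega) hj).2
    · omega

end

/-! ### Existence of waist ratios -/

/-- The solution of the recursion `c (i + 2) = t c (i + 1) - c i + κ c (i + 1) log c (i + 1)` with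
`c 0 = 0` and `c 1 = 1`, so that `c 2 = t`. -/
noncomputable def ratio (t κ : ℝ) : ℕ → ℝ
  | 0 => 0
  | 1 => 1
  | i + 2 => t * ratio t κ (i + 1) - ratio t κ i + κ * (ratio t κ (i + 1) * Real.log (ratio t κ (i + 1)))

theorem continuous_ratio (i : ℕ) : Continuous fun v : ℝ × ℝ => ratio v.1 v.2 i := by
  induction i using Nat.strong_induction_on with
  | _ i ih =>
    match i with
    | 0 => exact continuous_const
    | 1 => exact continuous_const
    | i + 2 =>
      have h1 := ih (i + 1) (by omega)
      have h0 := ih i (by omega)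
      have h2 := Real.continuous_mul_log.comp h1
      simp only [ratio]
      exact ((continuous_fst.mul h1).sub h0).add (continuous_snd.mul h2)

/-- For `κ = 0` the recursion is that of the Chebyshev polynomials of the second kind. -/
theorem ratio_mul_sin (θ : ℝ) (i : ℕ) : ratio (2 * cos θ) 0 i * sin θ = sin (i * θ) := by
  induction i using Nat.strong_induction_on with
  | _ i ih =>
    match i with
    | 0 => simp [ratio]
    | 1 => simp [ratio]
    | i + 2 =>
      have h1 := ih (i + 1) (by omega)
      have h0 := ih i (by omega)
      have e1 : ((i + 2 : ℕ) : ℝ) * θ = ((i + 1 : ℕ) : ℝ) * θ + θ := by push_cast; ring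
      have e0 : (i : ℝ) * θ = ((i + 1 : ℕ) : ℝ) * θ - θ := by push_cast; ring
      rw [e0, sin_sub] at h0
      rw [e1, sin_add]
      simp only [ratio]
      linear_combination (2 * cos θ) * h1 - h0

/-- The failure of the solution of the recursion to be symmetric at the middle of the stack. The
last equation of the balancing system says that it vanishes: `N - (N / 2 + 1)` is `N / 2 - 1` for
even `N` and `N / 2` for odd `N`. -/
noncomputable def defect (N : ℕ) (t κ : ℝ) : ℝ := ratio t κ (N / 2 + 1) - ratio t κ (N - (N / 2 + 1))

theorem isBalanced_of_defect {N k ℓ m : ℕ} (hN : 2 ≤ N) {t : ℝ}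
    (h : defect N t (8 * π / (k * ℓ * m ^ 2)) = 0)
    (hpos : ∀ i, 1 ≤ i → i ≤ N / 2 → 0 < ratio t (8 * π / (k * ℓ * m ^ 2)) i) :
    IsBalanced N k ℓ m fun i => ratio t (8 * π / (k * ℓ * m ^ 2)) (min i (N - i)) := by
  set κ : ℝ := 8 * π / (k * ℓ * m ^ 2) with hκ
  have hmin : ∀ i, i ≤ N / 2 → min i (N - i) = i := fun i hi => min_eq_left (by omega)
  have h2 : 2 ≤ N / 2 → ratio t κ (min 2 (N - 2)) = t := by
    intro h2
    rw [hmin 2 h2]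
    simp [ratio]
  refine
    { one := by rw [hmin 1 (by omega)]; rfl
      pos := fun i h1 hi => hpos _ (by omega) (by omega)
      refl := fun i h1 hi => by
            rw [Nat.sub_sub_self hi.le, min_comm]
      first := fun h3 => ?_
      mid := fun i h3 hi => ?_
      last := fun h3 => ?_ }
  · rw [h2 (by omega), hmin 3 h3]
    simp [ratio, ← hκ]
    ring
  · obtain ⟨j, rfl⟩ : ∃ j, i = j + 1 := ⟨i - 1, by omega⟩
    rw [h2 (by omega), hmin _ (by omega), hmin (j + 1) (by omega), hmin _ hi, Nat.add_sub_cancel,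
      ← hκ]
    simp only [ratio]
    ring
  · obtain ⟨j, hj⟩ : ∃ j, N / 2 = j + 1 := ⟨N / 2 - 1, by omega⟩
    rw [h2 h3, hmin (N / 2) le_rfl, hmin (N / 2 - 1) (by omega), ← hκ, hj, Nat.add_sub_cancel]
    unfold defect at h
    rw [hj] at h
    rcases Nat.mod_two_eq_zero_or_one N with h0 | h0
    · have e1 : (N + 1) % 2 = 1 := by omega
      have e2 : N - (j + 1 + 1) = j := by omega
      rw [e2] at h
      simp only [ratio] at h
      rw [e1, h0]
      push_cast
      linarith
    · have e1 : (N + 1) % 2 = 0 := by omega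
      have e2 : N - (j + 1 + 1) = j + 1 := by omega
      rw [e2] at h
      simp only [ratio] at h
      rw [e1, h0]
      push_cast
      linarith

theorem defect_zero (N : ℕ) (hN : 2 ≤ N) (θ : ℝ) : defect N (2 * cos θ) 0 * sin θ =
    2 * cos (N * θ / 2) * sin ((N / 2 + 1 : ℕ) * θ - N * θ / 2) := by
  rw [defect, sub_mul, ratio_mul_sin, ratio_mul_sin, Nat.cast_sub (by omega), sin_sub_sin]
  have e1 : (((N / 2 + 1 : ℕ) : ℝ) * θ + ((N : ℝ) - ((N / 2 + 1 : ℕ) : ℝ)) * θ) / 2 = N * θ / 2 := by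
    ring
  have e2 : (((N / 2 + 1 : ℕ) : ℝ) * θ - ((N : ℝ) - ((N / 2 + 1 : ℕ) : ℝ)) * θ) / 2 =
      ((N / 2 + 1 : ℕ) : ℝ) * θ - N * θ / 2 := by ring
  rw [e1, e2]
  ring

/-- The defect at `κ = 0` changes its sign at `t = 2 cos (π / N)`. -/
theorem defect_sign {N : ℕ} (hN : 2 ≤ N) {θ : ℝ} (h0 : 0 < θ) (h1 : N * θ < 2 * π) :
    (N * θ < π → 0 < defect N (2 * cos θ) 0) ∧ (π < N * θ → defect N (2 * cos θ) 0 < 0) := by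
  have hN' : (2 : ℝ) ≤ N := by exact_mod_cast hN
  have h2 : θ < π := by nlinarith
  have hs := sin_pos_of_pos_of_lt_pi h0 h2
  have a1 : (N : ℝ) < 2 * (N / 2 + 1 : ℕ) := by exact_mod_cast (by omega : N < 2 * (N / 2 + 1))
  have a2 : (2 * (N / 2 + 1 : ℕ) : ℝ) ≤ N + 2 := by exact_mod_cast (by omega : 2 * (N / 2 + 1) ≤ N + 2)
  have hs' : 0 < sin ((N / 2 + 1 : ℕ) * θ - N * θ / 2) :=
    sin_pos_of_pos_of_lt_pi (by nlinarith) (by nlinarith)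
  have key := defect_zero N hN θ
  constructor
  · intro h3
    have hc : 0 < cos (N * θ / 2) := cos_pos_of_mem_Ioo ⟨by nlinarith [pi_pos], by linarith⟩
    have h4 : 0 < 2 * cos (N * θ / 2) * sin ((N / 2 + 1 : ℕ) * θ - N * θ / 2) := by positivity
    rw [← key] at h4
    exact pos_of_mul_pos_left h4 hs.le
  · intro h3
    have hc : cos (N * θ / 2) < 0 :=
      cos_neg_of_pi_div_two_lt_of_lt (by linarith) (by linarith [pi_pos])
    have h4 : 2 * cos (N * θ / 2) * sin ((N / 2 + 1 : ℕ) * θ - N * θ / 2) < 0 :=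
      mul_neg_of_neg_of_pos (by linarith) hs'
    rw [← key] at h4
    by_contra hcon
    exact absurd (mul_nonneg (not_lt.1 hcon) hs.le) (not_le.2 h4)

/-- For small `κ` the defect vanishes for some `t` near `2 cos (π / N)`. -/
theorem exists_defect_eq_zero {N : ℕ} (hN : 2 ≤ N) {κ : ℕ → ℝ} (hκ : Tendsto κ atTop (𝓝 0)) {δ : ℝ}
    (hδ : 0 < δ) : ∀ᶠ m in atTop, ∃ t, dist (2 * cos (π / N)) t < δ ∧ defect N t (κ m) = 0 := by
  have hN' : (2 : ℝ) ≤ N := by exact_mod_cast hN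
  have hπ := pi_pos
  have hcont : ∀ t, Tendsto (fun m => defect N t (κ m)) atTop (𝓝 (defect N t 0)) := by
    intro t
    have h : Continuous fun κ => defect N t κ := by
      unfold defect
      exact ((continuous_ratio _).comp (Continuous.prodMk_right t)).sub
        ((continuous_ratio _).comp (Continuous.prodMk_right t))
    exact (h.tendsto 0).comp hκ
  obtain ⟨η, hη, hball⟩ := Metric.continuous_iff.1
    (by fun_prop : Continuous fun θ : ℝ => 2 * cos θ) (π / N) δ hδ
  obtain ⟨ε, hε, hεη, hεN⟩ : ∃ ε > 0, ε < η ∧ ε < π / N :=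
    ⟨min η (π / N) / 2, by positivity, by linarith [min_le_left η (π / N), lt_min hη (by positivity : 0 < π / N)],
      by linarith [min_le_right η (π / N), lt_min hη (by positivity : 0 < π / N)]⟩
  have hNπ : N * (π / N) = π := by field_simp
  have hNε : 0 < N * ε := by positivity
  have hNε' : N * ε < π := by
    rw [lt_div_iff₀ (by positivity)] at hεN
    linarith
  have d1 : dist (2 * cos (π / N - ε)) (2 * cos (π / N)) < δ := hball _ (by
    rw [Real.dist_eq, sub_sub_cancel_left, abs_neg, abs_of_pos hε]; exact hεη)
  have d2 : dist (2 * cos (π / N + ε)) (2 * cos (π / N)) < δ := hball _ (by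
    rw [Real.dist_eq, add_sub_cancel_left, abs_of_pos hε]; exact hεη)
  have s1 := (defect_sign hN (θ := π / N - ε) (by linarith) (by rw [mul_sub, hNπ]; linarith)).1
    (by rw [mul_sub, hNπ]; linarith)
  have s2 := (defect_sign hN (θ := π / N + ε) (by positivity) (by rw [mul_add, hNπ]; linarith)).2
    (by rw [mul_add, hNπ]; linarith)
  have hle : π / N ≤ π / 2 := by gcongr
  have hord : 2 * cos (π / N + ε) ≤ 2 * cos (π / N - ε) := by
    have := cos_le_cos_of_nonneg_of_le_pi (x := π / N - ε) (y := π / N + ε) (by linarith)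
      (by linarith) (by linarith)
    linarith
  filter_upwards [(hcont _).eventually_const_lt s1, (hcont _).eventually_lt_const s2] with m h1 h2
  have hc : ContinuousOn (fun t => defect N t (κ m))
      (Icc (2 * cos (π / N + ε)) (2 * cos (π / N - ε))) := by
    unfold defect
    exact (((continuous_ratio _).comp (Continuous.prodMk_left _)).sub
      ((continuous_ratio _).comp (Continuous.prodMk_left _))).continuousOn
  obtain ⟨t, ht, he⟩ := intermediate_value_Icc hord hc ⟨h2.le, h1.le⟩
  refine ⟨t, ?_, he⟩
  rw [Real.dist_eq, abs_lt] at d1 d2 ⊢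
  constructor <;> linarith [ht.1, ht.2]

/-- Solutions that exist near `x` for large `m` can be chosen to converge to `x`. -/
theorem exists_tendsto_of_near {P : ℕ → ℝ → Prop} {x : ℝ}
    (h : ∀ δ > 0, ∀ᶠ m in atTop, ∃ t, dist x t < δ ∧ P m t) :
    ∃ u : ℕ → ℝ, (∀ᶠ m in atTop, P m (u m)) ∧ Tendsto u atTop (𝓝 x) := by
  have key : ∀ m, ∃ t, (∃ t, P m t) →
      P m t ∧ dist x t < Metric.infDist x {t | P m t} + 1 / ((m : ℝ) + 1) := by
    intro m
    by_cases hm : ∃ t, P m t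
    · have h1 : Metric.infDist x {t | P m t} <
          Metric.infDist x {t | P m t} + 1 / ((m : ℝ) + 1) := by
        have : 0 < 1 / ((m : ℝ) + 1) := by positivity
        linarith
      obtain ⟨t, ht, hd⟩ := (Metric.infDist_lt_iff (by exact hm)).1 h1
      exact ⟨t, fun _ => ⟨ht, hd⟩⟩
    · exact ⟨0, fun h => (hm h).elim⟩
  choose u hu using key
  refine ⟨u, (h 1 one_pos).mono fun m ⟨t, _, ht⟩ => (hu m ⟨t, ht⟩).1, ?_⟩
  rw [Metric.tendsto_nhds]
  intro ε hε
  have h2 := (tendsto_one_div_add_atTop_nhds_zero_nat (𝕜 := ℝ)).eventually_lt_const (half_pos hε)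
  filter_upwards [h (ε / 2) (half_pos hε), h2] with m ⟨t, htd, ht⟩ hm
  have h3 := (hu m ⟨t, ht⟩).2
  have h4 := Metric.infDist_le_dist_of_mem (x := x) (show t ∈ {t | P m t} from ht)
  rw [dist_comm]
  linarith

/-- For `κ = 0` and `t = 2 cos (π / N)` the ratios are `sin (i π / N) / sin (π / N)`. -/
theorem exists_waistRatios {N k ℓ : ℕ} (hN : 2 ≤ N) (hk : 1 ≤ k) (hℓ : 1 ≤ ℓ) :
    ∃ w, IsWaistRatios N k ℓ w := by
  have hN' : (2 : ℝ) ≤ N := by exact_mod_cast hN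
  have hπ := pi_pos
  set κ : ℕ → ℝ := fun m => 8 * π / (k * ℓ * m ^ 2) with hκ
  have hκ0 : Tendsto κ atTop (𝓝 0) := by
    refine Tendsto.const_div_atTop ?_ _
    refine Tendsto.const_mul_atTop (by positivity) ?_
    exact (tendsto_pow_atTop two_ne_zero).comp tendsto_natCast_atTop_atTop
  obtain ⟨u, hu, hlim⟩ := exists_tendsto_of_near (P := fun m t => defect N t (κ m) = 0)
    fun δ hδ => exists_defect_eq_zero hN hκ0 hδ
  set d : ℕ → ℝ := fun i => ratio (2 * cos (π / N)) 0 i with hd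
  have hθ : 0 < π / N := by positivity
  have hθ2 : π / N ≤ π / 2 := by gcongr
  have hsin : 0 < sin (π / N) := sin_pos_of_pos_of_lt_pi hθ (by linarith)
  have hdlim : ∀ i, Tendsto (fun m => ratio (u m) (κ m) i) atTop (𝓝 (d i)) := fun i =>
    ((continuous_ratio i).tendsto (2 * cos (π / N), 0)).comp (hlim.prodMk_nhds hκ0)
  have hdsin : ∀ i, d i * sin (π / N) = sin (i * (π / N)) := ratio_mul_sin _
  have hle : ∀ i : ℕ, i ≤ N / 2 → (i : ℝ) * (π / N) ≤ π / 2 := by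
    intro i hi
    have : (2 : ℝ) * i ≤ N := by exact_mod_cast (by omega : 2 * i ≤ N)
    rw [mul_div_assoc', div_le_div_iff₀ (by positivity) two_pos]
    nlinarith
  have hdpos : ∀ i, 1 ≤ i → i ≤ N / 2 → 0 < d i := by
    intro i h1 hi
    have h2 := hle i hi
    have h3 : (1 : ℝ) ≤ i := by exact_mod_cast h1
    have h4 : 0 < sin (i * (π / N)) := sin_pos_of_pos_of_lt_pi (by positivity) (by linarith)
    rw [← hdsin] at h4
    exact pos_of_mul_pos_left h4 hsin.le
  have hev : ∀ᶠ m in atTop, ∀ i ∈ Finset.Icc 1 (N / 2), 0 < ratio (u m) (κ m) i := by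
    rw [Filter.eventually_all_finset]
    intro i hi
    obtain ⟨h1, h2⟩ := Finset.mem_Icc.1 hi
    exact (hdlim i).eventually_const_lt (hdpos i h1 h2)
  refine ⟨fun m i => ratio (u m) (κ m) (min i (N - i)), ?_, d, ?_, ?_, ?_⟩
  · filter_upwards [hu, hev] with m h1 h2
    exact isBalanced_of_defect hN h1 fun i hi hi' => h2 i (Finset.mem_Icc.2 ⟨hi, hi'⟩)
  · intro h2
    have h4 : (4 : ℝ) ≤ N := by exact_mod_cast (by omega : 4 ≤ N)
    have e : d 2 = 2 * cos (π / N) := by simp [hd, ratio]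
    have hlt : π / N < π / 3 := by gcongr; linarith
    have h5 := cos_lt_cos_of_nonneg_of_le_pi hθ.le (by linarith : π / 3 ≤ π) hlt
    have h6 := cos_lt_cos_of_nonneg_of_le_pi le_rfl (by linarith : π / N ≤ π) hθ
    rw [cos_pi_div_three] at h5
    rw [cos_zero] at h6
    rw [e]
    constructor <;> linarith
  · intro i h2 hi
    have h3 := hle (i + 1) hi
    have h4 : sin (i * (π / N)) < sin ((i + 1 : ℕ) * (π / N)) := by
      apply sin_lt_sin_of_lt_of_le_pi_div_two _ h3
      · push_cast
        nlinarith
      · have : (0 : ℝ) ≤ i * (π / N) := by positivity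
        linarith
    rw [← hdsin, ← hdsin] at h4
    exact lt_of_mul_lt_mul_right h4 hsin.le
  · intro i h2 hi
    have e : min i (N - i) = i := min_eq_left (by omega)
    simp only [e]
    exact hdlim i

/-- The discs of radius `2R` around the axes of one neck are smaller than half the distance to the
axes of the next one. -/
theorem two_mul_radR_lt {k ℓ m : ℕ} (hk : 1 ≤ k) (hkl : k ≤ ℓ) (hm : 1 ≤ m) :
    2 * radR ℓ m < per / (2 * (k * m : ℕ)) / 2 := by
  have hk' : (0 : ℝ) < k := by exact_mod_cast hk
  have hkl' : (k : ℝ) ≤ ℓ := by exact_mod_cast hkl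
  have hm' : (0 : ℝ) < m := by exact_mod_cast hm
  have h2 : 1 < √2 := by
    rw [Real.lt_sqrt zero_le_one]
    norm_num
  have h3 := Real.pi_gt_three
  have h4 : 3 < √2 * π := by nlinarith
  calc 2 * radR ℓ m ≤ 2 * (1 / (10 * k * m)) := by
        unfold radR
        gcongr
    _ < 3 / (2 * (k * m)) / 2 := by
        rw [← sub_pos]
        have : 3 / (2 * ((k : ℝ) * m)) / 2 - 2 * (1 / (10 * k * m)) = 11 / 20 / (k * m) := by
          field_simp
          norm_num
        rw [this]
        positivity
    _ ≤ per / (2 * (k * m : ℕ)) / 2 := by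
        unfold per
        push_cast
        gcongr

theorem mainTheorem2 (Ψ : ℝ → ℝ) (hΨ : IsCutoff Ψ) (N k ℓ : ℕ) (hN : 2 ≤ N) (hk : 1 ≤ k)
    (hkl : k ≤ ℓ) :
    (∃ w : ℕ → ℕ → ℝ, IsWaistRatios N k ℓ w) ∧
    ∀ w : ℕ → ℕ → ℝ, IsWaistRatios N k ℓ w → ∀ c : ℝ, 0 < c →
      ∃ m₀ : ℕ, 0 < m₀ ∧ ∀ m : ℕ, m₀ ≤ m → ∀ ζ ξ : ℕ → ℝ,
        (∀ i ∈ Finset.Icc 1 (N - 1), ζ i ∈ Set.Icc (-c) c ∧ ξ i ∈ Set.Icc (-c) c) →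
        ∀ S : Set E, S = initialSurface Ψ N k ℓ m (w m) ζ ξ →
          S ⊆ S3 ∧ IsSmoothSurface S ∧ IsCompact S ∧ IsConnected S ∧ IsOrientable S ∧
            HasGenus S (k * ℓ * m ^ 2 * (N - 1) + 1) ∧
            ∀ g ∈ symmGroup k ℓ m, g '' S = S := by
  have hℓ : 1 ≤ ℓ := hk.trans hkl
  refine ⟨exists_waistRatios hN hk hℓ, fun w hw c hc => ?_⟩
  obtain ⟨M, hM, hτ⟩ := tau_asymptotics hN hk hℓ hw hc
  have hsmall : ∀ᶠ m : ℕ in atTop, (c + 2 * N + 8) / (π / 4) < m :=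
    tendsto_natCast_atTop_atTop.eventually_gt_atTop _
  obtain ⟨m₀, hm₀⟩ := eventually_atTop.1 ((hτ (M * (2 + 2 * (c * M)))).and hsmall)
  refine ⟨max m₀ 1, by positivity, fun m hm ζ ξ hζξ S hS => ?_⟩
  have hm1 : 1 ≤ m := (le_max_right _ _).trans hm
  obtain ⟨h1, h2⟩ := hm₀ m ((le_max_left _ _).trans hm)
  have hbound : ∀ i, 1 ≤ i → i < N → |ζ i| ≤ c ∧ |ξ i| ≤ c := fun i hi hi' => by
    obtain ⟨a, b⟩ := hζξ i (Finset.mem_Icc.2 ⟨hi, by omega⟩)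
    exact ⟨abs_le.2 a, abs_le.2 b⟩
  have h3 := h1 ζ fun i hi hi' => (hbound i hi hi').1
  have hℓ' : (1 : ℝ) ≤ ℓ := by exact_mod_cast hℓ
  have hm' : (1 : ℝ) ≤ m := by exact_mod_cast hm1
  have hR : 0 < radR ℓ m := by
    unfold radR
    positivity
  have hRm : radR ℓ m ≤ 1 / m := by
    unfold radR
    gcongr
    nlinarith
  have hRsmall : (c + 2 * N + 8) * radR ℓ m < π / 4 := by
    rw [div_lt_iff₀ (by positivity)] at h2
    calc (c + 2 * N + 8) * radR ℓ m ≤ (c + 2 * N + 8) * (1 / m) := by gcongr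
      _ < π / 4 := by
        rw [mul_one_div, div_lt_iff₀ (by linarith)]
        linarith
  have hgood := goodHeights (p := k * m) (q := ℓ * m) (m := m) (r := w m) (ζ := ζ) (ξ := ξ) hN
    (Nat.mul_pos hk hm1) (Nat.mul_pos hℓ hm1) (two_mul_radR_lt hk hkl hm1)
    (two_mul_radR_lt hℓ le_rfl hm1) hR hc hM (fun i hi hi' => (hbound i hi hi').2) le_rfl hRsmall
    (fun i hi hi' => (h3 i hi hi').1) (fun i hi hi' j hj hj' => (h3 i hi hi').2.1 j hj hj')
    (fun i hi hi' => (h3 i hi hi').2.2)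
  obtain ⟨h4, h5⟩ := hgood.initialSurface_eq hΨ
    (fun j h0 hj => by simp only [if_neg h0.ne', if_pos hj]) (fun j _ => rfl)
  rw [h4] at hS
  subst hS
  have hgenus : HasGenus (hgood.stack hΨ).surf (k * ℓ * m ^ 2 * (N - 1) + 1) := by
    have e : k * ℓ * m ^ 2 * (N - 1) + 1 = k * m * (ℓ * m) * (N - 1) + 1 := by ring
    rw [e]
    exact (hgood.stack hΨ).hasGenus
  refine ⟨?_, (hgood.stack hΨ).isSmoothSurface, HasGenus.isCompact hgenus,
    (hgood.stack hΨ).isConnected, (hgood.stack hΨ).isOrientable, hgenus, h5⟩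
  rintro - ⟨v, -, rfl⟩
  exact Phi_mem_S3 v
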